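/- **Setting.** Let $d\ge 1$. For a parameter $\alpha\in\mathbb R$ let $\operatorname{SignReLU}(x;\alpha)=x$ for $x>0$ and $\alpha\,x/(1+|x|)$ for $x\le 0$. Let $\mathcal{NN}(\mathcal W,\mathcal L,\mathcal M)$ be the set of functions $\mathbb R^d\to\mathbb R^d$ of the form $\mathcal A_{\mathcal L}\circ\sigma\circ\mathcal A_{\mathcal L-1}\circ\cdots\circ\sigma\circ\mathcal A_0$, where $\sigma=\operatorname{SignReLU}(\cdot;\alpha)$ acts coordinatewise, $\mathcal A_\ell(x)=A_\ell x+b_\ell$, every hidden layer has width at most $\mathcal W$, and $$\|(A_{\mathcal L},b_{\mathcal L})\|_\infty\prod_{\ell=0}^{\mathcal L-1}\max\{\|(A_\ell,b_\ell)\|_\infty,1\}\le\mathcal M,$$ with $\|(A,b)\|_\infty=\max_i\big(\sum_j|A_{ij}|+|b_i|\big)$. Let $q_0$ be a probability density on $\mathbb R^d$ that vanishes outside $[-1,1]^d$, is of class $C^k$ on $[-1,1]^d$ for some $k\ge 0$, and satisfies $C_{q_0}^{-1}\le q_0\le C_{q_0}$ on $[-1,1]^d$ for some $C_{q_0}\ge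 1$. Let $T\ge 1$, $\beta_1,\dots,\beta_T\in(0,1)$, $\alpha_T=\prod_{t=1}^T(1-\beta_t)$, and let $q_T$ be the density of the last state of the forward process, $$q_T(z)=\int q_0(x)\,\mathcal N\big(z;\sqrt{\alpha_T}\,x,(1-\alpha_T)I_d\big)\,dx .$$ For reverse standard deviations $\sigma_{p,1},\dots,\sigma_{p,T}>0$ and $\phi_1,\dots,\phi_T\in\mathcal{NN}(\mathcal W,\mathcal L,\mathcal M)$ put $$p_0(\{\phi_t\};x)=\int r(z_T)\,p(x\mid z_1)\prod_{t=2}^T p(z_{t-1}\mid z_t)\,dz_1\cdots dz_T,\qquad p(z_{t-1}\mid z_t)=\mathcal N\big(z_{t-1};\phi_t(z_t),\sigma_{p,t}^2I_d\big),$$ where the terminal density $r$ is $q_T$ (or, throughout, the standard Gaussian density on $\mathbb R^d$). For $\eta\ge 0$ and samples $x_1,\dots,x_m$, let $\{\tilde\phi_t\}$ maximize $\mathbb E_{x\sim q_0}\log p_0(\{\phi_t\};x)$ and let $\{\hat\phi_t\}$ maximize $\frac1m\sum_{i=1}^m\log p_0(\{\phi_t\};x_i)$ over all families $\phi_1,\dots,\phi_T\in\mathcal{NN}(\mathcal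 W,\mathcal L,\mathcal M)$, in both cases up to an additive error $\eta$ ($\eta=0$ means exact maximizers). Write $\tilde p_0=p_0(\{\tilde\phi_t\};\cdot)$ and $\hat p_0=p_0(\{\hat\phi_t\};\cdot)$. **Theorem.** For all $d\ge1$, $\alpha\in\mathbb R$, $0<s_1\le s_2$, $c>0$ and $\mathcal M_0>1$ there is a constant $K>0$, depending only on $(d,\alpha,s_1,s_2,c,\mathcal M_0)$, such that the following holds for all integers $T,n,m\ge 1$, all $\mathcal W\le c\,(n+9d)$, all $\mathcal M\ge\mathcal M_0$, all $\delta\in(0,1)$, all $\eta\ge 0$, all $q_0$ and $\beta_t$ as above, and all $\sigma_{p,1},\dots,\sigma_{p,T}\in[s_1,s_2]$. Let $x_1,\dots,x_m$ be i.i.d. with density $q_0$ and let the network class be $\mathcal{NN}(\mathcal W,7,\mathcal M)$. Then, with probability at least $1-2\delta$, for every such $\{\hat\phi_t\}$ the divergences $D_{KL}(q_0\|\hat p_0)$ and $D_{KL}(q_0\|\tilde p_0)$ are finite and $$D_{KL}(q_0\|\hat p_0)-D_{KL}(q_0\|\tilde p_0)\le K\,T\big(\mathcal M^2+\log\mathcal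 M+T^3\mathcal M^2\log\mathcal M\big)\left(\sqrt{\frac{7n^2}{m}}+\sqrt{\frac{2\log(1/\delta)}{m}}\right)+\eta .$$ -/

import Mathlib

open MeasureTheory InformationTheory
open scoped NNReal ENNReal

noncomputable section

namespace DDPM

/-- The data space `ℝ^d` with the Euclidean norm. -/
abbrev E (d : ℕ) : Type := EuclideanSpace ℝ (Fin d)

/-- The activation `SignReLU(x; α)`. -/
def signReLU (α x : ℝ) : ℝ := if 0 < x then x else α * (x / (1 + |x|))

/-- Fully connected networks `A_L ∘ σ ∘ A_{L-1} ∘ ⋯ ∘ σ ∘ A_0`; in `Net o L k` there are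
`L` hidden layers, `k` inputs and `o` outputs. The constructor `hidden` puts one hidden layer
`σ ∘ A_0` of width `l` in front of a network with `L` hidden layers and `l` inputs. -/
inductive Net (o : ℕ) : ℕ → ℕ → Type where
  | out {k : ℕ} (A : Matrix (Fin o) (Fin k) ℝ) (b : Fin o → ℝ) : Net o 0 k
  | hidden {L k : ℕ} (l : ℕ) (A : Matrix (Fin l) (Fin k) ℝ) (b : Fin l → ℝ)
      (rest : Net o L l) : Net o (L + 1) k

/-- `‖(A, b)‖_∞`: the maximal absolute row sum of the augmented matrix `(A, b)`, that is, its
operator norm for the sup norms. -/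
def augNorm {l k : ℕ} (A : Matrix (Fin l) (Fin k) ℝ) (b : Fin l → ℝ) : ℝ :=
  ((Finset.univ.sup fun i : Fin l => (∑ j, ‖A i j‖₊) + ‖b i‖₊ : ℝ≥0) : ℝ)

namespace Net

/-- The function computed by a network, with activation `SignReLU(·; α)`. -/
def realize (α : ℝ) {o : ℕ} : {L k : ℕ} → Net o L k → (Fin k → ℝ) → (Fin o → ℝ)
  | _, _, out A b, x => A.mulVec x + b
  | _, _, hidden _ A b rest, x =>
      realize α rest fun i => signReLU α ((A.mulVec x + b) i)

/-- `‖(A_L, b_L)‖_∞ ∏_{ℓ < L} max {‖(A_ℓ, b_ℓ)‖_∞, 1}`. -/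
def paramNorm {o : ℕ} : {L k : ℕ} → Net o L k → ℝ
  | _, _, out A b => augNorm A b
  | _, _, hidden _ A b rest => max (augNorm A b) 1 * paramNorm rest

/-- All hidden layers have width at most `W`. -/
def WidthLE (W : ℕ) {o : ℕ} : {L k : ℕ} → Net o L k → Prop
  | _, _, out _ _ => True
  | _, _, hidden l _ _ rest => l ≤ W ∧ WidthLE W rest

end Net

/-- The class `NN(W, L, M)` of SignReLU networks, as functions `ℝ^d → ℝ^d`. -/
def networkClass (α : ℝ) (d W L : ℕ) (M : ℝ) : Set (E d → E d) :=
  {f | ∃ N : Net d L d, N.WidthLE W ∧ N.paramNorm ≤ M ∧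
    ∀ z : E d, f z = WithLp.toLp 2 (N.realize α (WithLp.ofLp z))}

/-- The density at `x` of the Gaussian law `N(μ, s² I_d)`. -/
def gaussianDensity {d : ℕ} (μ : E d) (s : ℝ) (x : E d) : ℝ :=
  (2 * Real.pi * s ^ 2) ^ (-(d : ℝ) / 2) * Real.exp (-‖x - μ‖ ^ 2 / (2 * s ^ 2))

/-- The cube `[-1, 1]^d`. -/
def cube (d : ℕ) : Set (E d) := {x | ∀ i, x i ∈ Set.Icc (-1 : ℝ) 1}

/-- `q₀` is a probability density supported on `[-1, 1]^d`, of class `C^k` there and with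
values in `[C⁻¹, C]` there. -/
structure IsTargetDensity {d : ℕ} (k : ℕ) (C : ℝ) (q₀ : E d → ℝ) : Prop where
  one_le : 1 ≤ C
  support : ∀ x, x ∉ cube d → q₀ x = 0
  smooth : ContDiffOn ℝ k q₀ (cube d)
  lower : ∀ x ∈ cube d, C⁻¹ ≤ q₀ x
  upper : ∀ x ∈ cube d, q₀ x ≤ C
  integral_eq_one : ∫ x, q₀ x = 1

/-- The measure on `ℝ^d` with density `p`. -/
def densityMeasure {d : ℕ} (p : E d → ℝ) : Measure (E d) :=
  (volume : Measure (E d)).withDensity fun x => ENNReal.ofReal (p x)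

/-- `α_T = ∏_{t ≤ T} (1 - β_t)`; the index `t : Fin T` stands for the step `t + 1`. -/
def alphaBar {T : ℕ} (β : Fin T → ℝ) : ℝ := ∏ t, (1 - β t)

/-- The density `q_T` of the last state of the forward process, whose law given `X = x` is
`N(√α_T x, (1 - α_T) I_d)`. -/
def forwardMarginal {d T : ℕ} (q₀ : E d → ℝ) (β : Fin T → ℝ) (z : E d) : ℝ :=
  ∫ x, q₀ x * gaussianDensity (Real.sqrt (alphaBar β) • x) (Real.sqrt (1 - alphaBar β)) z

/-- The density at `x` generated by the reverse chain with terminal density `r` at time `T` and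
transitions `p(z_{t-1} | z_t) = N(φ_t(z_t), σ_t² I_d)`, namely
`p₀(x) = ∫ r(z_T) p(x | z_1) ∏_{t=2}^T p(z_{t-1} | z_t) dz_1 ⋯ dz_T`.
Here `Fin.cons x z` is the path `(z_0, …, z_T)` with `z_0 = x`, and `φ t`, `σ t` for
`t : Fin T` belong to the transition from time `t + 1` to time `t`. -/
def generatedDensity {d T : ℕ} (r : E d → ℝ) (σ : Fin T → ℝ) (φ : Fin T → E d → E d)
    (x : E d) : ℝ :=
  ∫ z : Fin T → E d,
    let path : Fin (T + 1) → E d := Fin.cons x z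
    r (path (Fin.last T)) *
      ∏ t : Fin T, gaussianDensity (φ t (path t.succ)) (σ t) (path t.castSucc)

/-- The families `(φ_1, …, φ_T)` of networks in `NN(W, L, M)`. -/
def networkFamilies (α : ℝ) (d W L : ℕ) (M : ℝ) (T : ℕ) : Set (Fin T → E d → E d) :=
  {φ | ∀ t, φ t ∈ networkClass α d W L M}

/-- The expected log-likelihood `E_{x ∼ q₀} log p₀({φ_t}; x)`. -/
def populationLogLik {d T : ℕ} (q₀ r : E d → ℝ) (σ : Fin T → ℝ) (φ : Fin T → E d → E d) : ℝ :=
  ∫ x, Real.log (generatedDensity r σ φ x) ∂(densityMeasure q₀)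

/-- The empirical log-likelihood `(1/m) ∑ᵢ log p₀({φ_t}; x_i)`. -/
def empiricalLogLik {d T m : ℕ} (x : Fin m → E d) (r : E d → ℝ) (σ : Fin T → ℝ)
    (φ : Fin T → E d → E d) : ℝ :=
  (1 / (m : ℝ)) * ∑ i, Real.log (generatedDensity r σ φ (x i))

/-- `φ` maximizes `J` over `S` up to the error `η`; for `η = 0` it is a maximizer. -/
def IsArgmaxUpTo {A : Type*} (η : ℝ) (J : A → ℝ) (S : Set A) (φ : A) : Prop :=
  φ ∈ S ∧ ∀ ψ ∈ S, J ψ ≤ J φ + η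

end DDPM

end

/-! The entropy of `q₀` cancels in the difference of the two divergences, so the excess risk is at
most twice the supremum over the class of |empirical − population log-likelihood|, plus the
optimization error (`klDiv_sub_klDiv_le`). This supremum is bounded by chaining
(`exists_uniform_deviation`), which needs a sup bound `B` for `log p₀` on the cube and nets of
precision `B / 2 ^ j` with log-cardinality at most `H (j + 1)`.

The bound `B` is of order `T M²`. From above, `p₀` is at most the sup of the first Gaussian kernel,
since the other factors integrate to one. From below, all path points are confined to a fixed ball
carrying half of the terminal mass; each kernel there is at least `exp (-O(M²))`.

For the nets, `log p₀` must depend continuously on the maps `φ_t`, although these grow linearly and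
the path space is unbounded. Moving each `φ_t` by `ε max(1, ‖z‖)` multiplies the weight of a path by
at least `exp (-η (1 + S))`, where `S` is the noise energy of the path and `η` is `ε` times a factor
exponential in `T`. As `S` has an exponential moment, a Jensen argument (`log_integral_le_of_tilt`)
turns this into a bound on `log p₀`. The exponential factor costs only `O(T log M)` additional
dyadic scales (`exists_dyadic_exponent`).

The networks themselves are covered layer by layer (`exists_cover_scaledClass`). Only the product of
the layer norms is controlled, so each layer is normalized and its scale is pushed through the
activation; SignReLU is not homogeneous, and the price is one further parameter `ρ ∈ (0, 1]` per
layer. This gives `H = (K T n log M)²`, so that `B √(H / m)` is of order `T² M² log M · n / √m`,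
within the stated rate. -/

noncomputable section

namespace DDPM

/-! ### Concentration and chaining. -/

/-- **Hoeffding's inequality** for the empirical mean of a bounded function. -/
theorem measure_abs_empiricalMean_sub_integral_gt_le {X : Type*} [MeasurableSpace X]
    (μ : Measure X) [IsProbabilityMeasure μ] {m : ℕ} (hm : 1 ≤ m) {g : X → ℝ}
    (hg : Measurable g) {D u : ℝ} (hD : 0 < D) (hgD : ∀ x, |g x| ≤ D) (hu : 0 ≤ u) :
    Measure.pi (fun _ : Fin m => μ) {x | u < |(1 / (m : ℝ)) * ∑ i, g (x i) - ∫ y, g y ∂μ|} ≤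
      ENNReal.ofReal (2 * Real.exp (-(m * u ^ 2) / (2 * D ^ 2))) := by
  have hm0 : (0 : ℝ) < m := by exact_mod_cast hm
  have key : ∀ h : X → ℝ, Measurable h → (∀ x, |h x| ≤ D) →
      (Measure.pi (fun _ : Fin m => μ)).real {x | m * u ≤ ∑ i, (h (x i) - ∫ y, h y ∂μ)} ≤
        Real.exp (-(m * u ^ 2) / (2 * D ^ 2)) := by
    intro h hh hhD
    have h1 := ProbabilityTheory.HasSubgaussianMGF.measure_sum_ge_le_of_iIndepFun
      (μ := Measure.pi (fun _ : Fin m => μ))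
      (X := fun (i : Fin m) (x : Fin m → X) => h (x i) - ∫ y, h y ∂μ)
      (ProbabilityTheory.iIndepFun_pi (X := fun _ y => h y - ∫ y, h y ∂μ)
        (fun _ => (hh.sub_const _).aemeasurable))
      (c := fun _ => (‖D - (-D)‖₊ / 2) ^ 2) (s := Finset.univ) (ε := m * u) ?_ (by positivity)
    · refine h1.trans (Real.exp_le_exp.mpr (le_of_eq ?_))
      have : ‖D - (-D)‖ = 2 * D := by
        rw [Real.norm_eq_abs, abs_of_pos (by linarith)]; ring
      simp only [Finset.sum_const, Finset.card_univ, Fintype.card_fin, nsmul_eq_mul]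
      push_cast
      rw [this]
      field_simp
    · intro i _
      have h2 := ProbabilityTheory.hasSubgaussianMGF_of_mem_Icc
        (μ := Measure.pi (fun _ : Fin m => μ)) (X := fun x : Fin m → X => h (x i))
        (a := -D) (b := D) (hh.comp (measurable_pi_apply i)).aemeasurable
        (ae_of_all _ fun x => ⟨(abs_le.mp (hhD _)).1, (abs_le.mp (hhD _)).2⟩)
      rwa [integral_comp_eval (μ := fun _ : Fin m => μ) hh.aestronglyMeasurable] at h2
  have hsub : {x : Fin m → X | u < |(1 / (m : ℝ)) * ∑ i, g (x i) - ∫ y, g y ∂μ|} ⊆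
      {x | m * u ≤ ∑ i, (g (x i) - ∫ y, g y ∂μ)} ∪
      {x | m * u ≤ ∑ i, (-g (x i) - ∫ y, -g y ∂μ)} := by
    intro x hx
    simp only [Set.mem_ofPred_eq, Set.mem_union, Finset.sum_sub_distrib, Finset.sum_const,
      Finset.card_univ, Fintype.card_fin, nsmul_eq_mul, integral_neg, Finset.sum_neg_distrib] at hx ⊢
    have e : (1 / (m : ℝ)) * ∑ i, g (x i) - ∫ y, g y ∂μ =
        (∑ i, g (x i) - m * ∫ y, g y ∂μ) / m := by field_simp
    rw [e] at hx
    rcases lt_abs.mp hx with h | h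
    · left; rw [lt_div_iff₀ hm0] at h; linarith
    · right; rw [← neg_div, lt_div_iff₀ hm0] at h; linarith
  refine (measure_mono hsub).trans ((measure_union_le _ _).trans ?_)
  rw [two_mul, ENNReal.ofReal_add (Real.exp_pos _).le (Real.exp_pos _).le]
  refine add_le_add ?_ ?_
  · rw [← ofReal_measureReal]
    exact ENNReal.ofReal_le_ofReal (key g hg hgD)
  · rw [← ofReal_measureReal]
    exact ENNReal.ofReal_le_ofReal (key (fun x => -g x) hg.neg (by simpa using hgD))

/-- Union bound over one chaining level. The threshold makes each Hoeffding tail `2 exp (-(2h +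
a))`; the cardinality consumes one `h`, and the other remains as the factor `exp (-h)` that makes
the levels summable. -/
theorem measure_iUnion_deviation_le {X : Type*} [MeasurableSpace X]
    (μ : Measure X) [IsProbabilityMeasure μ] {m : ℕ} (hm : 1 ≤ m) {D h a : ℝ} (hD : 0 < D)
    (hh : 0 ≤ h) (ha : 0 ≤ a) (S : Finset (X → ℝ)) (hS : ∀ g ∈ S, Measurable g ∧ ∀ x, |g x| ≤ D)
    (hcard : (S.card : ℝ) ≤ Real.exp h) :
    Measure.pi (fun _ : Fin m => μ)
      (⋃ g ∈ S, {x | D * √(2 * (2 * h + a) / m) <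
        |(1 / (m : ℝ)) * ∑ i, g (x i) - ∫ y, g y ∂μ|}) ≤
      ENNReal.ofReal (2 * Real.exp (-a) * Real.exp (-h)) := by
  have hm0 : (0 : ℝ) < m := by exact_mod_cast hm
  have hb : ∀ g ∈ S, Measure.pi (fun _ : Fin m => μ) {x | D * √(2 * (2 * h + a) / m) <
        |(1 / (m : ℝ)) * ∑ i, g (x i) - ∫ y, g y ∂μ|} ≤
      ENNReal.ofReal (2 * Real.exp (-(2 * h + a))) := by
    intro g hg
    refine (measure_abs_empiricalMean_sub_integral_gt_le μ hm (hS g hg).1 hD (hS g hg).2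
      (by positivity)).trans (ENNReal.ofReal_le_ofReal (le_of_eq ?_))
    rw [mul_pow, Real.sq_sqrt (by positivity)]
    congr 2
    field_simp
  refine (measure_biUnion_finset_le S _).trans ((Finset.sum_le_sum hb).trans ?_)
  rw [Finset.sum_const, nsmul_eq_mul, ← ENNReal.ofReal_natCast,
    ← ENNReal.ofReal_mul (Nat.cast_nonneg _)]
  refine ENNReal.ofReal_le_ofReal ?_
  calc (S.card : ℝ) * (2 * Real.exp (-(2 * h + a)))
      ≤ Real.exp h * (2 * Real.exp (-(2 * h + a))) := by gcongr
    _ = 2 * Real.exp (-a) * Real.exp (-h) := by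
      rw [show -(2 * h + a) = -h + -h + -a by ring, Real.exp_add, Real.exp_add]
      have : Real.exp h * Real.exp (-h) = 1 := by rw [← Real.exp_add]; simp
      linear_combination (2 * Real.exp (-h) * Real.exp (-a)) * this

theorem sum_range_chain_le (x y : ℝ) (hx : 0 ≤ x) (hy : 0 ≤ y) (J : ℕ) :
    ∑ j ∈ Finset.range J, (((j : ℝ) + 1) * x + y) / 2 ^ j ≤ 4 * x + 2 * y := by
  -- Exact partial sums make the induction close; the subtracted remainder is nonnegative.
  have : ∑ j ∈ Finset.range J, (((j : ℝ) + 1) * x + y) / 2 ^ j =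
      4 * x + 2 * y - (2 * (J + 2) * x + 2 * y) / 2 ^ J := by
    induction J with
    | zero => simp; ring
    | succ J ih => rw [Finset.sum_range_succ, ih]; push_cast; field_simp; ring
  rw [this]
  have : 0 ≤ (2 * ((J : ℝ) + 2) * x + 2 * y) / 2 ^ J := by positivity
  linarith

theorem sqrt_add_le_add_sqrt {x y : ℝ} (hx : 0 ≤ x) (hy : 0 ≤ y) : √(x + y) ≤ √x + √y := by
  refine Real.sqrt_le_iff.mpr ⟨by positivity, ?_⟩
  nlinarith [Real.sq_sqrt hx, Real.sq_sqrt hy, mul_nonneg (Real.sqrt_nonneg x) (Real.sqrt_nonneg y)]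

/-- A uniform deviation inequality by **chaining**: `f θ` has a `B / 2 ^ j`-net of cardinality at
most `exp (H (j + 1))` for every `j`. -/
theorem exists_uniform_deviation {X : Type*} [MeasurableSpace X] (μ : Measure X)
    [IsProbabilityMeasure μ] {m : ℕ} (hm : 1 ≤ m) {Θ : Type*} (f : Θ → X → ℝ)
    (hf : ∀ θ, Measurable (f θ)) {B H δ : ℝ} (hB : 0 < B) (hfB : ∀ θ x, |f θ x| ≤ B)
    (hH : 1 ≤ H) (F : ℕ → Finset Θ) (hcard : ∀ j, ((F j).card : ℝ) ≤ Real.exp (H * (j + 1)))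
    (hF : ∀ j θ, ∃ θ' ∈ F j, ∀ x, |f θ x - f θ' x| ≤ B / 2 ^ j) (hδ : 0 < δ) (hδ1 : δ < 1) :
    ∃ G : Set (Fin m → X), MeasurableSet G ∧
      ENNReal.ofReal (1 - 2 * δ) ≤ Measure.pi (fun _ : Fin m => μ) G ∧
      ∀ x ∈ G, ∀ θ, |(1 / (m : ℝ)) * ∑ i, f θ (x i) - ∫ y, f θ y ∂μ| ≤
        34 * B * (√(H / m) + √(2 * Real.log (1 / δ) / m)) := by
  classical
  have hm0 : (0 : ℝ) < m := by exact_mod_cast hm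
  set a := Real.log (1 / δ) with ha_def
  have ha : 0 ≤ a := Real.log_nonneg (by rw [le_div_iff₀ hδ]; linarith)
  have hea : Real.exp (-a) = δ := by
    rw [ha_def, Real.log_div one_ne_zero hδ.ne', Real.log_one, zero_sub, neg_neg, Real.exp_log hδ]
  choose π hπF hπ using hF
  -- Level `0` is the coarsest net; level `j + 1` consists of increments between consecutive nets.
  -- The filter keeps those of the size a chain can produce, `B / 2 ^ (j + 1) + B / 2 ^ j`.
  let S : ℕ → Finset (X → ℝ) := fun j => Nat.casesOn j ((F 0).image f) fun j =>
    ((F (j + 1) ×ˢ F j).image fun p x => f p.1 x - f p.2 x).filter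
      fun g => ∀ x, |g x| ≤ 3 * B / 2 ^ (j + 1)
  let D : ℕ → ℝ := fun j => 3 * B / 2 ^ j
  let h : ℕ → ℝ := fun j => 2 * H * (j + 1)
  have hD : ∀ j, 0 < D j := fun j => by positivity
  have hh : ∀ j, 0 ≤ h j := fun j => by positivity
  have hS : ∀ j, ∀ g ∈ S j, Measurable g ∧ ∀ x, |g x| ≤ D j := by
    intro j g hg
    cases j with
    | zero =>
      obtain ⟨θ, -, rfl⟩ := Finset.mem_image.mp hg
      exact ⟨hf θ, fun x => (hfB θ x).trans (by simp only [D, pow_zero, div_one]; linarith)⟩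
    | succ j =>
      obtain ⟨hg1, hg2⟩ := Finset.mem_filter.mp hg
      obtain ⟨p, -, rfl⟩ := Finset.mem_image.mp hg1
      exact ⟨(hf _).sub (hf _), hg2⟩
  have hcS : ∀ j, ((S j).card : ℝ) ≤ Real.exp (h j) := by
    intro j
    cases j with
    | zero =>
      refine (Nat.cast_le.mpr Finset.card_image_le).trans ((hcard 0).trans ?_)
      refine Real.exp_le_exp.mpr ?_
      simp only [h, Nat.cast_zero]; linarith
    | succ j =>
      refine (Nat.cast_le.mpr ((Finset.card_filter_le _ _).trans Finset.card_image_le)).trans ?_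
      rw [Finset.card_product, Nat.cast_mul]
      refine (mul_le_mul (hcard _) (hcard _) (Nat.cast_nonneg _) (Real.exp_pos _).le).trans ?_
      rw [← Real.exp_add]
      refine Real.exp_le_exp.mpr ?_
      simp only [h]; push_cast; nlinarith
  let bad : ℕ → Set (Fin m → X) := fun j => ⋃ g ∈ S j,
    {x | D j * √(2 * (2 * h j + a) / m) < |(1 / (m : ℝ)) * ∑ i, g (x i) - ∫ y, g y ∂μ|}
  have hbadm : ∀ j, MeasurableSet (bad j) := by
    intro j
    refine Finset.measurableSet_biUnion _ fun g hg => ?_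
    have hgm := (hS j g hg).1
    refine measurableSet_lt measurable_const ?_
    exact ((measurable_const.mul (Finset.measurable_sum _ fun i _ =>
      hgm.comp (measurable_pi_apply i))).sub_const _).norm
  have hbad : Measure.pi (fun _ : Fin m => μ) (⋃ j, bad j) ≤ ENNReal.ofReal (2 * δ) := by
    refine (measure_iUnion_le _).trans ?_
    have h1 : ∀ j, Measure.pi (fun _ : Fin m => μ) (bad j) ≤
        ENNReal.ofReal (2 * δ * (1 / 2 / 2 ^ j)) := by
      intro j
      refine (measure_iUnion_deviation_le μ hm (hD j) (hh j) ha (S j) (hS j) (hcS j)).trans ?_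
      rw [hea]
      -- Since `H ≥ 1`, `exp (-h j) ≤ 2 ^ (-(j + 1))`, and these weights sum to one: the total
      -- failure probability is `2δ`.
      refine ENNReal.ofReal_le_ofReal (mul_le_mul_of_nonneg_left ?_ (by positivity))
      calc Real.exp (-h j) ≤ Real.exp (-(j + 1 : ℕ)) := by
            refine Real.exp_le_exp.mpr (neg_le_neg ?_)
            simp only [h]; push_cast; nlinarith [show (0 : ℝ) ≤ j from Nat.cast_nonneg _]
        _ = (Real.exp 1)⁻¹ ^ (j + 1) := by
            rw [Real.exp_neg, ← Real.exp_one_pow, inv_pow]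
        _ ≤ (2 : ℝ)⁻¹ ^ (j + 1) := by
            have := Real.add_one_le_exp (1 : ℝ)
            gcongr; linarith
        _ = 1 / 2 / 2 ^ j := by rw [pow_succ, inv_pow]; ring
    refine (ENNReal.tsum_le_tsum h1).trans ?_
    rw [← ENNReal.ofReal_tsum_of_nonneg (fun j => by positivity)
      (summable_geometric_two' 1 |>.mul_left _), tsum_mul_left, tsum_geometric_two']
    simp
  -- Only countably many functions define the good event, so it is measurable whatever the size of
  -- `Θ`.
  refine ⟨(⋃ j, bad j)ᶜ, (MeasurableSet.iUnion hbadm).compl, ?_, ?_⟩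
  · rw [prob_compl_eq_one_sub (MeasurableSet.iUnion hbadm),
      ENNReal.ofReal_sub _ (by positivity), ENNReal.ofReal_one]
    exact tsub_le_tsub_left hbad 1
  intro x hx θ
  let dev : (X → ℝ) → ℝ := fun g => (1 / (m : ℝ)) * ∑ i, g (x i) - ∫ y, g y ∂μ
  have hgood : ∀ j, ∀ g ∈ S j, |dev g| ≤ D j * √(2 * (2 * h j + a) / m) := by
    intro j g hg
    by_contra hcon
    exact hx (Set.mem_iUnion.mpr ⟨j, Set.mem_iUnion₂.mpr ⟨g, hg, lt_of_not_ge hcon⟩⟩)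
  have hint : ∀ θ, Integrable (f θ) μ := fun θ =>
    Integrable.of_bound (hf θ).aestronglyMeasurable B (ae_of_all _ (hfB θ))
  have hdev_sub : ∀ θ θ', dev (f θ) = dev (f θ') + dev (fun x => f θ x - f θ' x) := by
    intro θ θ'
    simp only [dev, Finset.sum_sub_distrib, integral_sub (hint θ) (hint θ')]
    ring
  -- The number `17 / 6` is a rational upper bound for `√8`; the final constant is `34 = 4 · 3 · 17
  -- / 6`.
  have hu : ∀ j, D j * √(2 * (2 * h j + a) / m) ≤
      (((j : ℝ) + 1) * (3 * B * (17 / 6 * √(H / m))) + 3 * B * √(2 * a / m)) / 2 ^ j := by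
    intro j
    have h1 : √(2 * (2 * h j + a) / m) ≤ 17 / 6 * (j + 1) * √(H / m) + √(2 * a / m) := by
      rw [show 2 * (2 * h j + a) / (m : ℝ) = 8 * (j + 1) * (H / m) + 2 * a / m by
        simp only [h]; field_simp; ring]
      refine (sqrt_add_le_add_sqrt (by positivity) (by positivity)).trans
        (add_le_add_left ?_ _)
      rw [Real.sqrt_mul (by positivity)]
      refine mul_le_mul_of_nonneg_right ?_ (Real.sqrt_nonneg _)
      refine Real.sqrt_le_iff.mpr ⟨by positivity, ?_⟩
      nlinarith [show (0 : ℝ) ≤ j from Nat.cast_nonneg _]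
    calc D j * √(2 * (2 * h j + a) / m)
        ≤ D j * (17 / 6 * (j + 1) * √(H / m) + √(2 * a / m)) :=
          mul_le_mul_of_nonneg_left h1 (hD j).le
      _ = _ := by simp only [D]; ring
  have hchain : ∀ J : ℕ, |dev (f (π J θ))| ≤
      ∑ j ∈ Finset.range (J + 1), D j * √(2 * (2 * h j + a) / m) := by
    intro J
    induction J with
    | zero =>
      rw [zero_add, Finset.sum_range_one]
      exact hgood 0 _ (Finset.mem_image_of_mem _ (hπF 0 θ))
    | succ J ih =>
      rw [Finset.sum_range_succ, hdev_sub (π (J + 1) θ) (π J θ)]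
      refine (abs_add_le _ _).trans (add_le_add ih (hgood (J + 1) (fun y => f (π (J + 1) θ) y - f (π J θ) y) ?_))
      refine Finset.mem_filter.mpr ⟨Finset.mem_image.mpr ⟨(π (J + 1) θ, π J θ),
        Finset.mem_product.mpr ⟨hπF _ _, hπF _ _⟩, rfl⟩, fun y => ?_⟩
      have e1 := hπ (J + 1) θ y
      have e2 := hπ J θ y
      have e3 : B / 2 ^ J = 2 * B / 2 ^ (J + 1) := by rw [pow_succ]; field_simp
      calc |f (π (J + 1) θ) y - f (π J θ) y|
          = |(f θ y - f (π J θ) y) - (f θ y - f (π (J + 1) θ) y)| := by congr 1; ring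
        _ ≤ B / 2 ^ J + B / 2 ^ (J + 1) := (abs_sub _ _).trans (add_le_add e2 e1)
        _ = 3 * B / 2 ^ (J + 1) := by rw [e3]; ring
  -- The unchained remainder is uniformly at most `B / 2 ^ J`, so it contributes at most this much
  -- to the empirical mean and to the expectation; it disappears as `J → ∞`.
  have hfin : ∀ J : ℕ, |dev (f θ)| ≤
      34 * B * (√(H / m) + √(2 * a / m)) + 2 * B / 2 ^ J := by
    intro J
    have h1 : |dev (fun x => f θ x - f (π J θ) x)| ≤ 2 * B / 2 ^ J := by
      have h2 : |(1 / (m : ℝ)) * ∑ i, (f θ (x i) - f (π J θ) (x i))| ≤ B / 2 ^ J := by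
        rw [abs_mul, abs_of_pos (by positivity : (0 : ℝ) < 1 / m), one_div_mul_eq_div,
          div_le_iff₀ hm0]
        refine (Finset.abs_sum_le_sum_abs _ _).trans
          ((Finset.sum_le_sum fun i _ => hπ J θ (x i)).trans (le_of_eq ?_))
        simp; ring
      have h3 : |∫ y, (f θ y - f (π J θ) y) ∂μ| ≤ B / 2 ^ J := by
        have := norm_integral_le_of_norm_le_const (μ := μ)
          (f := fun y => f θ y - f (π J θ) y) (ae_of_all _ (hπ J θ))
        simpa using this
      exact (abs_sub _ _).trans ((add_le_add h2 h3).trans (le_of_eq (by ring)))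
    rw [hdev_sub θ (π J θ)]
    refine (abs_add_le _ _).trans (add_le_add ?_ h1)
    refine (hchain J).trans ((Finset.sum_le_sum fun j _ => hu j).trans
      ((sum_range_chain_le _ _ (by positivity) (by positivity) _).trans ?_))
    have := mul_nonneg hB.le (Real.sqrt_nonneg (2 * a / m))
    nlinarith
  have hlim : Filter.Tendsto (fun J : ℕ => 34 * B * (√(H / m) + √(2 * a / m)) + 2 * B / 2 ^ J)
      Filter.atTop (nhds (34 * B * (√(H / m) + √(2 * a / m)) + 0)) := by
    refine tendsto_const_nhds.add ?_
    have := (tendsto_pow_atTop_nhds_zero_of_lt_one (r := (1 / 2 : ℝ)) (by norm_num)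
      (by norm_num)).const_mul (2 * B)
    simpa [div_eq_mul_inv] using this
  rw [add_zero] at hlim
  exact ge_of_tendsto' hlim hfin

/-! ### Covering numbers of finite-dimensional balls. -/

/-- A maximal `1`-separated subset is a `1`-net. If no net of this size existed, every separated set
could be enlarged by a point, contradicting the bound `5 ^ n` on separated sets from the Besicovitch
covering theorem. -/
theorem exists_cover_closedBall_two (V : Type*) [NormedAddCommGroup V] [NormedSpace ℝ V]
    [FiniteDimensional ℝ V] :
    ∃ S : Finset V, S.card ≤ 5 ^ Module.finrank ℝ V ∧
      ∀ v : V, ‖v‖ ≤ 2 → ∃ s ∈ S, ‖v - s‖ ≤ 1 := by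
  classical
  by_contra! hcon
  have hex : ∀ n : ℕ, ∃ s : Finset V, s.card = n ∧ (∀ c ∈ s, ‖c‖ ≤ 2) ∧
      ∀ c ∈ s, ∀ d ∈ s, c ≠ d → 1 ≤ ‖c - d‖ := by
    intro n
    induction n with
    | zero => exact ⟨∅, by simp⟩
    | succ n ih =>
      obtain ⟨s, hsn, hs2, hsep⟩ := ih
      obtain ⟨v, hv2, hv⟩ := hcon s (Besicovitch.card_le_of_separated s hs2 hsep)
      have hvs : v ∉ s := fun h => by have := hv v h; simp at this; linarith
      refine ⟨insert v s, by rw [Finset.card_insert_of_notMem hvs, hsn], ?_, ?_⟩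
      · intro c hc
        rcases Finset.mem_insert.mp hc with rfl | hc
        exacts [hv2, hs2 c hc]
      · intro c hc d hd hcd
        rcases Finset.mem_insert.mp hc with hc' | hc' <;>
          rcases Finset.mem_insert.mp hd with hd' | hd'
        · exact absurd (hc'.trans hd'.symm) hcd
        · rw [hc']; exact (hv d hd').le
        · rw [hd', norm_sub_rev]; exact (hv c hc').le
        · exact hsep c hc' d hd' hcd
  obtain ⟨s, hsn, hs2, hsep⟩ := hex (5 ^ Module.finrank ℝ V + 1)
  have := Besicovitch.card_le_of_separated s hs2 hsep
  omega

/-- The unit ball of an `n`-dimensional normed space is covered by `5 ^ (n j)` balls of radius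
`2⁻ʲ`. -/
theorem exists_cover_closedBall_one (V : Type*) [NormedAddCommGroup V] [NormedSpace ℝ V]
    [FiniteDimensional ℝ V] (j : ℕ) :
    ∃ S : Finset V, S.card ≤ (5 ^ Module.finrank ℝ V) ^ j ∧
      ∀ v : V, ‖v‖ ≤ 1 → ∃ s ∈ S, ‖v - s‖ ≤ 1 / 2 ^ j := by
  classical
  induction j with
  | zero => exact ⟨{0}, by simp, fun v hv => ⟨0, by simp, by simpa using hv⟩⟩
  | succ j ih =>
    obtain ⟨S, hS, hSc⟩ := ih
    obtain ⟨S₂, hS₂, hS₂c⟩ := exists_cover_closedBall_two V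
    refine ⟨(S ×ˢ S₂).image fun p => p.1 + (1 / (2 : ℝ) ^ (j + 1)) • p.2, ?_, ?_⟩
    · refine Finset.card_image_le.trans ?_
      rw [Finset.card_product, pow_succ]
      exact Nat.mul_le_mul hS hS₂
    · intro v hv
      obtain ⟨s, hs, hvs⟩ := hSc v hv
      have hp : (0 : ℝ) < 2 ^ (j + 1) := by positivity
      -- The residual at scale `2⁻ʲ`, blown up to the ball of radius `2`, is covered once more.
      obtain ⟨w, hw, hvw⟩ := hS₂c ((2 : ℝ) ^ (j + 1) • (v - s)) (by
        rw [norm_smul, Real.norm_of_nonneg hp.le]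
        calc (2 : ℝ) ^ (j + 1) * ‖v - s‖ ≤ 2 ^ (j + 1) * (1 / 2 ^ j) := by gcongr
          _ = 2 := by rw [pow_succ]; field_simp)
      refine ⟨_, Finset.mem_image_of_mem _ (Finset.mk_mem_product hs hw), ?_⟩
      have e : v - (s + (1 / (2 : ℝ) ^ (j + 1)) • w) =
          (1 / (2 : ℝ) ^ (j + 1)) • ((2 : ℝ) ^ (j + 1) • (v - s) - w) := by
        rw [smul_sub, smul_smul, one_div_mul_cancel hp.ne', one_smul]; abel
      rw [e, norm_smul, Real.norm_of_nonneg (by positivity)]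
      exact mul_le_of_le_one_right (by positivity) hvw

/-! ### Affine layers as a normed space. -/

/-- Augmented matrices `(A, b)` with the maximal absolute row sum as norm. -/
abbrev AugMatrix (l k : ℕ) : Type := Fin l → PiLp 1 fun _ : Option (Fin k) => ℝ

namespace AugMatrix

variable {l k : ℕ}

/-- The augmented matrix of `(A, b)`. -/
def mk (A : Matrix (Fin l) (Fin k) ℝ) (b : Fin l → ℝ) : AugMatrix l k := fun i =>
  WithLp.toLp 1 fun o => o.elim (b i) (A i)

/-- The affine map of an augmented matrix. -/
def app (v : AugMatrix l k) (z : Fin k → ℝ) : Fin l → ℝ := fun i =>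
  ∑ j, v i (some j) * z j + v i none

theorem norm_row (w : PiLp 1 fun _ : Option (Fin k) => ℝ) :
    ‖w‖ = ∑ j, |w (some j)| + |w none| := by
  rw [PiLp.norm_eq_of_L1, Fintype.sum_option, add_comm]
  simp [Real.norm_eq_abs]

theorem norm_mk (A : Matrix (Fin l) (Fin k) ℝ) (b : Fin l → ℝ) : ‖mk A b‖ = augNorm A b := by
  rw [Pi.norm_def, augNorm]
  congr 1
  refine Finset.sup_congr rfl fun i _ => NNReal.eq ?_
  rw [coe_nnnorm, norm_row]
  simp [mk]

theorem app_mk (A : Matrix (Fin l) (Fin k) ℝ) (b : Fin l → ℝ) (z : Fin k → ℝ) :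
    app (mk A b) z = A.mulVec z + b := by
  ext i
  simp [app, mk, Matrix.mulVec, dotProduct]

theorem app_sub (v w : AugMatrix l k) (z : Fin k → ℝ) : app (v - w) z = app v z - app w z := by
  ext i
  simp only [app, Pi.sub_apply, PiLp.sub_apply, sub_mul, Finset.sum_sub_distrib]
  ring

theorem app_smul (c : ℝ) (v : AugMatrix l k) (z : Fin k → ℝ) : app (c • v) z = c • app v z := by
  ext i
  simp only [app, Pi.smul_apply, PiLp.smul_apply, smul_eq_mul, mul_add, Finset.mul_sum, mul_assoc]

/-- The bias acts as a weight on an additional input equal to `1`, whence `max 1 ‖z‖`. -/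
theorem norm_app_le (v : AugMatrix l k) (z : Fin k → ℝ) : ‖app v z‖ ≤ ‖v‖ * max 1 ‖z‖ := by
  refine (pi_norm_le_iff_of_nonneg (by positivity)).mpr fun i => ?_
  refine le_trans ?_ (mul_le_mul_of_nonneg_right (norm_le_pi_norm v i) (by positivity))
  rw [norm_row, add_mul, Finset.sum_mul, app]
  refine (norm_add_le _ _).trans (add_le_add ((norm_sum_le _ _).trans
    (Finset.sum_le_sum fun j _ => ?_)) ?_)
  · rw [norm_mul, Real.norm_eq_abs]
    exact mul_le_mul_of_nonneg_left ((norm_le_pi_norm z j).trans (le_max_right _ _))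
      (abs_nonneg _)
  · exact le_mul_of_one_le_right (abs_nonneg _) (le_max_left _ _)

theorem norm_app_sub_le (v : AugMatrix l k) (z z' : Fin k → ℝ) :
    ‖app v z - app v z'‖ ≤ ‖v‖ * ‖z - z'‖ := by
  refine (pi_norm_le_iff_of_nonneg (by positivity)).mpr fun i => ?_
  refine le_trans ?_ (mul_le_mul_of_nonneg_right (norm_le_pi_norm v i) (by positivity))
  have e : (app v z - app v z') i = ∑ j, v i (some j) * (z - z') j := by
    simp only [app, Pi.sub_apply, mul_sub, Finset.sum_sub_distrib]; ring
  rw [norm_row, add_mul, Finset.sum_mul, e]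
  refine le_add_of_le_of_nonneg ((norm_sum_le _ _).trans (Finset.sum_le_sum fun j _ => ?_))
    (by positivity)
  rw [norm_mul, Real.norm_eq_abs]
  exact mul_le_mul_of_nonneg_left (norm_le_pi_norm (z - z') j) (abs_nonneg _)

theorem finrank_eq : Module.finrank ℝ (AugMatrix l k) = l * (k + 1) := by
  rw [Module.finrank_pi_fintype]
  simp only [(WithLp.linearEquiv 1 ℝ (Option (Fin k) → ℝ)).finrank_eq,
    Module.finrank_fintype_fun_eq_card]
  simp

end AugMatrix

/-! ### Rescaled activations, normalized layers and nets of networks. -/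

/-- The rescaled activation `x ↦ ρ σ(x / ρ)`. -/
def scaledSignReLU (α ρ x : ℝ) : ℝ := if 0 < x then x else α * (ρ * x / (ρ + |x|))

/-- Substitute for positive homogeneity: pulling a scale out of the activation stays within a
one-parameter family. This allows layer norms to be moved towards the output. -/
theorem signReLU_eq_scaled (α x : ℝ) {R : ℝ} (hR : 0 < R) :
    signReLU α (R * x) = R * scaledSignReLU α R⁻¹ x := by
  unfold signReLU scaledSignReLU
  by_cases hx : 0 < x
  · simp [hx, hR]
  · have h1 : ¬ 0 < R * x := by simpa [mul_pos_iff, hR, hR.not_gt] using hx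
    rw [if_neg h1, if_neg hx, abs_mul, abs_of_pos hR]
    have : 0 < 1 + R * |x| := by positivity
    have : 0 < R⁻¹ + |x| := by positivity
    field_simp

theorem signReLU_eq_scaled_one (α x : ℝ) : signReLU α x = scaledSignReLU α 1 x := by
  simpa using signReLU_eq_scaled α x one_pos

/-- On the negative branch the difference quotient, up to `α`, is `ρ² / ((ρ + |x|) (ρ + |y|)) ≤ 1`,
so the constant does not degenerate as `ρ → 0`. -/
theorem scaledSignReLU_lipschitz (α : ℝ) {ρ : ℝ} (hρ : 0 < ρ) (x y : ℝ) :
    |scaledSignReLU α ρ x - scaledSignReLU α ρ y| ≤ max 1 |α| * |x - y| := by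
  have aux : ∀ x : ℝ, x ≤ 0 → |ρ * x / (ρ + |x|)| ≤ |x| := by
    intro x hx
    have h : 0 < ρ + |x| := by positivity
    rw [abs_div, abs_mul, abs_of_pos hρ, abs_of_pos h, div_le_iff₀ h]
    nlinarith [abs_nonneg x]
  have mixed : ∀ x y : ℝ, 0 < x → y ≤ 0 →
      |x - α * (ρ * y / (ρ + |y|))| ≤ max 1 |α| * |x - y| := by
    intro x y hx hy
    rw [abs_of_pos (by linarith : 0 < x - y)]
    refine (abs_sub _ _).trans ?_
    rw [abs_mul, abs_of_pos hx]
    have h1 := aux y hy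
    rw [abs_of_nonpos hy] at h1
    have h2 := mul_le_mul (le_max_right 1 |α|) h1 (abs_nonneg _) (by positivity)
    have h3 := mul_le_mul_of_nonneg_right (le_max_left 1 |α|) hx.le
    rw [abs_of_nonpos hy]
    linarith
  unfold scaledSignReLU
  split_ifs with hx hy hy
  · exact le_mul_of_one_le_left (abs_nonneg _) (le_max_left _ _)
  · exact mixed x y hx (not_lt.mp hy)
  · rw [abs_sub_comm, abs_sub_comm x]; exact mixed y x hy (not_lt.mp hx)
  · rw [not_lt] at hx hy
    rw [← mul_sub, abs_mul]
    refine mul_le_mul (le_max_right _ _) ?_ (abs_nonneg _) (by positivity)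
    rw [abs_of_nonpos hx, abs_of_nonpos hy]
    have h1 : 0 < ρ + -x := by linarith
    have h2 : 0 < ρ + -y := by linarith
    have e : ρ * x / (ρ + -x) - ρ * y / (ρ + -y) =
        (ρ * ρ / ((ρ + -x) * (ρ + -y))) * (x - y) := by field_simp; ring
    rw [e, abs_mul]
    refine mul_le_of_le_one_left (abs_nonneg _) ?_
    rw [abs_of_nonneg (by positivity), div_le_one (by positivity)]
    nlinarith

/-- The difference quotient in `ρ` is, up to sign and `α`, `x² / ((ρ + |x|) (ρ' + |x|)) ≤ 1`.
Uniformity in `x` and down to `ρ = 0` is what lets a finite grid of scales suffice. -/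
theorem scaledSignReLU_sub_le (α : ℝ) {ρ ρ' : ℝ} (hρ : 0 < ρ) (hρ' : 0 < ρ') (x : ℝ) :
    |scaledSignReLU α ρ x - scaledSignReLU α ρ' x| ≤ max 1 |α| * |ρ - ρ'| := by
  unfold scaledSignReLU
  split_ifs with hx
  · simp
  · rw [not_lt] at hx
    rw [← mul_sub, abs_mul]
    refine mul_le_mul (le_max_right _ _) ?_ (abs_nonneg _) (by positivity)
    rw [abs_of_nonpos hx]
    have h1 : 0 < ρ + -x := by linarith
    have h2 : 0 < ρ' + -x := by linarith
    have e : ρ * x / (ρ + -x) - ρ' * x / (ρ' + -x) =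
        (x * x / ((ρ + -x) * (ρ' + -x))) * (ρ' - ρ) := by field_simp; ring
    rw [e, abs_mul, abs_sub_comm ρ']
    refine mul_le_of_le_one_left (abs_nonneg _) ?_
    rw [abs_of_nonneg (div_nonneg (mul_self_nonneg x) (by positivity)), div_le_one (by positivity)]
    nlinarith

theorem abs_scaledSignReLU_le (α : ℝ) {ρ : ℝ} (hρ : 0 < ρ) (x : ℝ) :
    |scaledSignReLU α ρ x| ≤ max 1 |α| * |x| := by
  simpa [scaledSignReLU] using scaledSignReLU_lipschitz α hρ x 0

theorem norm_scaledSignReLU_sub_le (α : ℝ) {ρ ρ' : ℝ} (hρ : 0 < ρ) (hρ' : 0 < ρ') {l : ℕ}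
    (u v : Fin l → ℝ) :
    ‖(fun i => scaledSignReLU α ρ (u i)) - fun i => scaledSignReLU α ρ' (v i)‖ ≤
      max 1 |α| * (‖u - v‖ + |ρ - ρ'|) := by
  refine (pi_norm_le_iff_of_nonneg (by positivity)).mpr fun i => ?_
  rw [Pi.sub_apply, Real.norm_eq_abs]
  have h1 := scaledSignReLU_lipschitz α hρ (u i) (v i)
  have h2 := scaledSignReLU_sub_le α hρ hρ' (v i)
  have h3 := mul_le_mul_of_nonneg_left (norm_le_pi_norm (u - v) i)
    (by positivity : 0 ≤ max 1 |α|)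
  rw [Pi.sub_apply, Real.norm_eq_abs] at h3
  have h4 := abs_sub_le (scaledSignReLU α ρ (u i)) (scaledSignReLU α ρ (v i))
    (scaledSignReLU α ρ' (v i))
  linarith

theorem norm_scaledSignReLU_le (α : ℝ) {ρ : ℝ} (hρ : 0 < ρ) {l : ℕ} (u : Fin l → ℝ) :
    ‖fun i => scaledSignReLU α ρ (u i)‖ ≤ max 1 |α| * ‖u‖ := by
  refine (pi_norm_le_iff_of_nonneg (by positivity)).mpr fun i => ?_
  exact (abs_scaledSignReLU_le α hρ _).trans
    (mul_le_mul_of_nonneg_left (norm_le_pi_norm u i) (by positivity))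

theorem augNorm_nonneg {l k : ℕ} (A : Matrix (Fin l) (Fin k) ℝ) (b : Fin l → ℝ) :
    0 ≤ augNorm A b := NNReal.coe_nonneg _

namespace Net

theorem paramNorm_nonneg {o L k : ℕ} (N : Net o L k) : 0 ≤ N.paramNorm := by
  induction N with
  | out A b => exact augNorm_nonneg A b
  | hidden l A b rest ih => exact mul_nonneg (by positivity) ih

theorem realize_hidden (α : ℝ) {o L k l : ℕ} (A : Matrix (Fin l) (Fin k) ℝ) (b : Fin l → ℝ)
    (rest : Net o L l) (z : Fin k → ℝ) :
    realize α (hidden l A b rest) z = realize α rest fun i =>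
      scaledSignReLU α 1 (AugMatrix.app (AugMatrix.mk A b) z i) := by
  simp only [realize, AugMatrix.app_mk, signReLU_eq_scaled_one]

theorem norm_realize_le (α : ℝ) {o L k : ℕ} (N : Net o L k) (z : Fin k → ℝ) :
    ‖N.realize α z‖ ≤ N.paramNorm * max 1 |α| ^ L * max 1 ‖z‖ := by
  induction N with
  | out A b =>
    rw [realize, ← AugMatrix.app_mk, paramNorm, ← AugMatrix.norm_mk, pow_zero, mul_one]
    exact AugMatrix.norm_app_le _ _
  | @hidden L k l A b rest ih =>
    rw [realize_hidden, paramNorm, ← AugMatrix.norm_mk]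
    refine (ih _).trans ?_
    have h1 := norm_scaledSignReLU_le α one_pos (AugMatrix.app (AugMatrix.mk A b) z)
    have h2 := AugMatrix.norm_app_le (AugMatrix.mk A b) z
    set c := max 1 |α|
    have hc : 1 ≤ c := le_max_left _ _
    set r := max ‖AugMatrix.mk A b‖ 1
    have hr : 1 ≤ r := le_max_right _ _
    have hz : 1 ≤ max 1 ‖z‖ := le_max_left _ _
    have h3 : max 1 ‖fun i => scaledSignReLU α 1 (AugMatrix.app (AugMatrix.mk A b) z i)‖ ≤
        c * (r * max 1 ‖z‖) := by
      refine max_le (one_le_mul_of_one_le_of_one_le hc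
        (one_le_mul_of_one_le_of_one_le hr hz)) (h1.trans ?_)
      gcongr
      exact h2.trans (mul_le_mul_of_nonneg_right (le_max_left _ _) (by positivity))
    calc rest.paramNorm * c ^ L * max 1 _ ≤ rest.paramNorm * c ^ L * (c * (r * max 1 ‖z‖)) :=
          mul_le_mul_of_nonneg_left h3 (mul_nonneg rest.paramNorm_nonneg (by positivity))
      _ = _ := by ring

theorem norm_realize_sub_le (α : ℝ) {o L k : ℕ} (N : Net o L k) (z z' : Fin k → ℝ) :
    ‖N.realize α z - N.realize α z'‖ ≤ N.paramNorm * max 1 |α| ^ L * ‖z - z'‖ := by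
  induction N with
  | out A b =>
    rw [realize, realize, ← AugMatrix.app_mk, ← AugMatrix.app_mk, paramNorm, ← AugMatrix.norm_mk,
      pow_zero, mul_one]
    exact AugMatrix.norm_app_sub_le _ _ _
  | @hidden L k l A b rest ih =>
    rw [realize_hidden, realize_hidden, paramNorm, ← AugMatrix.norm_mk]
    refine (ih _ _).trans ?_
    have h1 := norm_scaledSignReLU_sub_le α one_pos one_pos (AugMatrix.app (AugMatrix.mk A b) z)
      (AugMatrix.app (AugMatrix.mk A b) z')
    rw [sub_self, abs_zero, add_zero] at h1
    have h2 := AugMatrix.norm_app_sub_le (AugMatrix.mk A b) z z'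
    have h3 : ‖AugMatrix.mk A b‖ ≤ max ‖AugMatrix.mk A b‖ 1 := le_max_left _ _
    calc rest.paramNorm * max 1 |α| ^ L * _
        ≤ rest.paramNorm * max 1 |α| ^ L *
          (max 1 |α| * (max ‖AugMatrix.mk A b‖ 1 * ‖z - z'‖)) := by
          refine mul_le_mul_of_nonneg_left (h1.trans ?_)
            (mul_nonneg rest.paramNorm_nonneg (by positivity))
          gcongr
          exact h2.trans (by gcongr)
      _ = _ := by ring

end Net

/-- The functions `z ↦ N(R z)` with `R ≥ 1` and `R ‖N‖ ≤ M`. -/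
def scaledClass (α : ℝ) (o W : ℕ) (M : ℝ) (L k : ℕ) : Set ((Fin k → ℝ) → Fin o → ℝ) :=
  {f | ∃ (N : Net o L k) (R : ℝ), 1 ≤ R ∧ N.WidthLE W ∧ N.paramNorm * R ≤ M ∧
    ∀ z, f z = N.realize α (R • z)}

theorem norm_sub_le_of_mem_scaledClass {α : ℝ} {o W : ℕ} {M : ℝ} {L k : ℕ}
    {f : (Fin k → ℝ) → Fin o → ℝ} (hf : f ∈ scaledClass α o W M L k) (z z' : Fin k → ℝ) :
    ‖f z - f z'‖ ≤ M * max 1 |α| ^ L * ‖z - z'‖ := by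
  obtain ⟨N, R, hR, -, hM, hf⟩ := hf
  rw [hf, hf]
  refine (N.norm_realize_sub_le α _ _).trans ?_
  rw [← smul_sub, norm_smul, Real.norm_of_nonneg (by linarith)]
  calc N.paramNorm * max 1 |α| ^ L * (R * ‖z - z'‖)
      = N.paramNorm * R * max 1 |α| ^ L * ‖z - z'‖ := by ring
    _ ≤ _ := by gcongr

/-- The first layer of a function in `scaledClass` can be normalized. -/
theorem exists_of_mem_scaledClass_succ {α : ℝ} {o W : ℕ} {M : ℝ} {L k : ℕ}
    {f : (Fin k → ℝ) → Fin o → ℝ} (hf : f ∈ scaledClass α o W M (L + 1) k) :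
    ∃ l ≤ W, ∃ (v : AugMatrix l k) (ρ : ℝ), ‖v‖ ≤ 1 ∧ 0 < ρ ∧ ρ ≤ 1 ∧
      ∃ g ∈ scaledClass α o W M L l,
        ∀ z, f z = g fun i => scaledSignReLU α ρ (AugMatrix.app v z i) := by
  obtain ⟨N, R, hR, hW, hM, hf⟩ := hf
  cases N with
  | hidden l A b rest =>
    set r := max (augNorm A b) 1 with hr_def
    have hr : 1 ≤ r := le_max_right _ _
    have hr0 : 0 < r := by linarith
    have hR0 : 0 < R := by linarith
    have hRr : 1 ≤ R * r := one_le_mul_of_one_le_of_one_le hR hr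
    -- `A (R z) + b = R r ((A / r) z + b / (R r))`. The scale `R r` passes through the activation
    -- and becomes the input scale of the remaining network, so the product of scale and parameter
    -- norm is unchanged.
    refine ⟨l, hW.1, AugMatrix.mk (r⁻¹ • A) ((R * r)⁻¹ • b), (R * r)⁻¹, ?_, by positivity,
      inv_le_one_of_one_le₀ hRr, fun z => rest.realize α ((R * r) • z),
      ⟨rest, R * r, hRr, hW.2, ?_, fun z => rfl⟩, fun z => ?_⟩
    · refine (pi_norm_le_iff_of_nonneg zero_le_one).mpr fun i => ?_
      have h1 : ‖AugMatrix.mk A b i‖ ≤ r :=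
        (norm_le_pi_norm _ i).trans ((AugMatrix.norm_mk A b).le.trans (le_max_left _ _))
      rw [AugMatrix.norm_row] at h1 ⊢
      simp only [AugMatrix.mk, Option.elim, Pi.smul_apply, smul_eq_mul, Matrix.smul_apply,
        abs_mul, abs_inv, abs_of_pos hr0, abs_of_pos hR0, ← Finset.mul_sum] at h1 ⊢
      have h2 : (R * r)⁻¹ * |b i| ≤ r⁻¹ * |b i| := by
        refine mul_le_mul_of_nonneg_right ?_ (abs_nonneg _)
        exact inv_anti₀ hr0 (le_mul_of_one_le_left hr0.le hR)
      have h3 : r⁻¹ * (∑ j, |A i j| + |b i|) ≤ 1 := by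
        rw [inv_mul_le_iff₀ hr0]; linarith
      linarith
    · refine le_trans (le_of_eq ?_) hM
      simp only [Net.paramNorm]; ring
    · rw [hf]
      simp only [Net.realize]
      congr 1
      ext i
      rw [Pi.smul_apply, smul_eq_mul, ← signReLU_eq_scaled α _ (by positivity : 0 < R * r)]
      congr 1
      simp only [AugMatrix.app_mk, Pi.add_apply, Matrix.mulVec_smul, Matrix.smul_mulVec,
        Pi.smul_apply, smul_eq_mul]
      field_simp

/-- The shift `i + 1` keeps the grid away from `0`, where the rescaled activation is not controlled
by the Lipschitz bounds. -/
theorem exists_grid_point {ρ : ℝ} (h0 : 0 < ρ) (h1 : ρ ≤ 1) (j : ℕ) :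
    ∃ i ∈ Finset.range (2 ^ j), |ρ - ((i : ℝ) + 1) / 2 ^ j| ≤ 1 / 2 ^ j := by
  have hp : (0 : ℝ) < 2 ^ j := by positivity
  have hc : 0 < ⌈ρ * 2 ^ j⌉₊ := Nat.ceil_pos.mpr (by positivity)
  refine ⟨⌈ρ * 2 ^ j⌉₊ - 1, ?_, ?_⟩
  · rw [Finset.mem_range]
    have : ⌈ρ * 2 ^ j⌉₊ ≤ 2 ^ j := Nat.ceil_le.mpr (by push_cast; nlinarith)
    omega
  · have e : ((⌈ρ * 2 ^ j⌉₊ - 1 : ℕ) : ℝ) + 1 = ⌈ρ * 2 ^ j⌉₊ := by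
      rw [Nat.cast_sub hc]; simp
    rw [e]
    have h2 := Nat.le_ceil (ρ * 2 ^ j)
    have h3 := Nat.ceil_lt_add_one (by positivity : 0 ≤ ρ * 2 ^ j)
    rw [abs_le]
    constructor
    · rw [neg_le_sub_iff_le_add, div_le_iff₀ hp, add_mul, div_mul_cancel₀ _ hp.ne']
      exact h3.le
    · have : ρ ≤ ⌈ρ * 2 ^ j⌉₊ / 2 ^ j := by rwa [le_div_iff₀ hp]
      have : 0 ≤ 1 / (2 : ℝ) ^ j := by positivity
      linarith

theorem natCast_five_pow_le_exp (n : ℕ) : ((5 ^ n : ℕ) : ℝ) ≤ Real.exp (2 * n) := by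
  have h : (5 : ℝ) ≤ Real.exp 2 := by
    have h1 := Real.exp_one_gt_d9
    have h2 : Real.exp 2 = Real.exp 1 * Real.exp 1 := by rw [← Real.exp_add]; norm_num
    rw [h2]; nlinarith
  calc ((5 ^ n : ℕ) : ℝ) = 5 ^ n := by push_cast; rfl
    _ ≤ Real.exp 2 ^ n := by gcongr
    _ = Real.exp (2 * n) := by rw [← Real.exp_nat_mul]; ring_nf

/-- Networks of depth `L` and width at most `D` are covered by `exp (2 (L + 1) (D + 1)² (j + 1))`
functions up to an error of order `2⁻ʲ`, relative to the growth of the functions. -/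
theorem exists_cover_scaledClass (α : ℝ) {o W D : ℕ} (ho : o ≤ D) (hW : W ≤ D) {M : ℝ}
    (hM : 0 < M) (j L k : ℕ) (hk : k ≤ D) :
    ∃ F : Finset ((Fin k → ℝ) → Fin o → ℝ),
      (F.card : ℝ) ≤ Real.exp (2 * (L + 1) * (D + 1) ^ 2 * (j + 1)) ∧
      ∀ f ∈ scaledClass α o W M L k, ∃ g ∈ F, ∀ z,
        ‖f z - g z‖ ≤ M * (4 * max 1 |α|) ^ L / 2 ^ j * max 1 ‖z‖ := by
  classical
  have hcov : ∀ l k : ℕ, l ≤ D → k ≤ D → ∃ S : Finset (AugMatrix l k),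
      (S.card : ℝ) ≤ Real.exp (2 * (D * (D + 1)) * j) ∧
      ∀ v, ‖v‖ ≤ 1 → ∃ s ∈ S, ‖v - s‖ ≤ 1 / 2 ^ j := by
    intro l k hl hk
    obtain ⟨S, hS, hSc⟩ := exists_cover_closedBall_one (AugMatrix l k) j
    refine ⟨S, ?_, hSc⟩
    rw [AugMatrix.finrank_eq, ← pow_mul] at hS
    refine (Nat.cast_le.mpr hS).trans ((natCast_five_pow_le_exp _).trans ?_)
    refine Real.exp_le_exp.mpr ?_
    have hl' : (l : ℝ) ≤ D := by exact_mod_cast hl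
    have hk' : (k : ℝ) ≤ D := by exact_mod_cast hk
    push_cast
    rw [mul_assoc 2]
    gcongr
  induction L generalizing k with
  | zero =>
    obtain ⟨S, hS, hSc⟩ := hcov o k ho hk
    refine ⟨S.image fun v z => M • AugMatrix.app v z, ?_, ?_⟩
    · refine (Nat.cast_le.mpr Finset.card_image_le).trans (hS.trans (Real.exp_le_exp.mpr ?_))
      push_cast
      have : (0 : ℝ) ≤ j := Nat.cast_nonneg _
      have : (0 : ℝ) ≤ D := Nat.cast_nonneg _
      have h1 : (D : ℝ) * (D + 1) * j ≤ (D + 1) ^ 2 * (j + 1) := by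
        rw [sq]; gcongr <;> linarith
      nlinarith
    · rintro f ⟨N, R, hR, -, hNM, hf⟩
      cases N with
      | out A b =>
        have hR0 : 0 < R := by linarith
        -- In the output layer the input scale `R ≥ 1` is absorbed by `A`; the resulting augmented
        -- norm is at most `R ‖(A, b)‖ ≤ M`.
        have hv : ‖M⁻¹ • AugMatrix.mk (R • A) b‖ ≤ 1 := by
          rw [norm_smul, Real.norm_of_nonneg (by positivity), inv_mul_le_iff₀ hM, mul_one]
          refine (pi_norm_le_iff_of_nonneg hM.le).mpr fun i => le_trans ?_ hNM
          rw [Net.paramNorm, ← AugMatrix.norm_mk]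
          refine le_trans ?_ (mul_le_mul_of_nonneg_right
            (norm_le_pi_norm (AugMatrix.mk A b) i) hR0.le)
          rw [AugMatrix.norm_row, AugMatrix.norm_row]
          simp only [AugMatrix.mk, Option.elim, smul_eq_mul, Matrix.smul_apply, abs_mul,
            abs_of_pos hR0, ← Finset.mul_sum]
          nlinarith [abs_nonneg (b i)]
        obtain ⟨s, hs, hvs⟩ := hSc _ hv
        refine ⟨_, Finset.mem_image_of_mem _ hs, fun z => ?_⟩
        have e : f z - M • AugMatrix.app s z =
            M • AugMatrix.app (M⁻¹ • AugMatrix.mk (R • A) b - s) z := by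
          rw [hf, AugMatrix.app_sub, AugMatrix.app_smul, smul_sub, smul_smul,
            mul_inv_cancel₀ hM.ne', one_smul, AugMatrix.app_mk, Net.realize,
            Matrix.mulVec_smul, Matrix.smul_mulVec]
        rw [e, norm_smul, Real.norm_of_nonneg hM.le, pow_zero, mul_one,
          div_eq_mul_one_div M, mul_assoc]
        refine mul_le_mul_of_nonneg_left ((AugMatrix.norm_app_le _ _).trans ?_) hM.le
        gcongr
  | succ L ih =>
    -- Empty dummy nets for `l > W` make the choice of nets a total function of the unknown width.
    have ih' : ∀ l : ℕ, ∃ F : Finset ((Fin l → ℝ) → Fin o → ℝ), l ≤ W →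
        (F.card : ℝ) ≤ Real.exp (2 * (L + 1) * (D + 1) ^ 2 * (j + 1)) ∧
        ∀ f ∈ scaledClass α o W M L l, ∃ g ∈ F, ∀ z,
          ‖f z - g z‖ ≤ M * (4 * max 1 |α|) ^ L / 2 ^ j * max 1 ‖z‖ := by
      intro l
      by_cases hl : l ≤ W
      · obtain ⟨F, hF⟩ := ih l (hl.trans hW)
        exact ⟨F, fun _ => hF⟩
      · exact ⟨∅, fun h => absurd h hl⟩
    have hcov' : ∀ l : ℕ, ∃ S : Finset (AugMatrix l k), l ≤ W →
        (S.card : ℝ) ≤ Real.exp (2 * (D * (D + 1)) * j) ∧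
        ∀ v, ‖v‖ ≤ 1 → ∃ s ∈ S, ‖v - s‖ ≤ 1 / 2 ^ j := by
      intro l
      by_cases hl : l ≤ W
      · obtain ⟨F, hF⟩ := hcov l k (hl.trans hW) hk
        exact ⟨F, fun _ => hF⟩
      · exact ⟨∅, fun h => absurd h hl⟩
    choose F₁ hF₁ using ih'
    choose S hS using hcov'
    refine ⟨(Finset.range (W + 1)).biUnion fun l =>
      (S l ×ˢ (Finset.range (2 ^ j) ×ˢ F₁ l)).image fun p z => p.2.2 fun i =>
        scaledSignReLU α (((p.2.1 : ℝ) + 1) / 2 ^ j) (AugMatrix.app p.1 z i), ?_, ?_⟩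
    · have hone : ∀ l ∈ Finset.range (W + 1), (((S l ×ˢ (Finset.range (2 ^ j) ×ˢ F₁ l)).image
          fun p z => p.2.2 fun i => scaledSignReLU α (((p.2.1 : ℝ) + 1) / 2 ^ j)
            (AugMatrix.app p.1 z i)).card : ℝ) ≤
          Real.exp (2 * (D * (D + 1)) * j) * (Real.exp j *
            Real.exp (2 * (L + 1) * (D + 1) ^ 2 * (j + 1))) := by
        intro l hl
        have hl : l ≤ W := Nat.lt_succ_iff.mp (Finset.mem_range.mp hl)
        refine (Nat.cast_le.mpr Finset.card_image_le).trans ?_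
        rw [Finset.card_product, Finset.card_product, Finset.card_range, Nat.cast_mul,
          Nat.cast_mul]
        have h2 : ((2 ^ j : ℕ) : ℝ) ≤ Real.exp j := by
          have := Real.add_one_le_exp (1 : ℝ)
          rw [← Real.exp_one_pow]; push_cast
          gcongr; linarith
        gcongr
        exacts [(hS l hl).1, (hF₁ l hl).1]
      refine (Nat.cast_le.mpr Finset.card_biUnion_le).trans ?_
      rw [Nat.cast_sum]
      refine (Finset.sum_le_sum hone).trans ?_
      rw [Finset.sum_const, Finset.card_range, nsmul_eq_mul]
      -- Choosing the width costs `D` in the exponent. Together with the weights and the scale, a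
      -- layer costs at most `2 (D + 1)² (j + 1)`.
      have hWe : ((W + 1 : ℕ) : ℝ) ≤ Real.exp D := by
        have h1 := Real.add_one_le_exp (D : ℝ)
        have h2 : (W : ℝ) ≤ D := by exact_mod_cast hW
        push_cast; linarith
      refine (mul_le_mul_of_nonneg_right hWe (by positivity)).trans ?_
      rw [← Real.exp_add, ← Real.exp_add, ← Real.exp_add]
      refine Real.exp_le_exp.mpr ?_
      push_cast
      have : (0 : ℝ) ≤ j := Nat.cast_nonneg _
      have : (0 : ℝ) ≤ D := Nat.cast_nonneg _
      have h1 : (D : ℝ) ≤ 2 * (D + 1) ^ 2 := by nlinarith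
      have h2 : 2 * ((D : ℝ) * (D + 1)) * j + j ≤ 2 * (D + 1) ^ 2 * j := by nlinarith
      nlinarith
    · intro f hf
      obtain ⟨l, hl, v, ρ, hv, hρ0, hρ1, f₁, hf₁, hff⟩ := exists_of_mem_scaledClass_succ hf
      obtain ⟨s, hs, hvs⟩ := (hS l hl).2 v hv
      obtain ⟨i, hi, hρi⟩ := exists_grid_point hρ0 hρ1 j
      obtain ⟨g, hg, hfg⟩ := (hF₁ l hl).2 f₁ hf₁
      refine ⟨_, Finset.mem_biUnion.mpr ⟨l, Finset.mem_range.mpr (by omega),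
        Finset.mem_image_of_mem _ (Finset.mk_mem_product hs (Finset.mk_mem_product hi hg))⟩,
        fun z => ?_⟩
      simp only []
      rw [hff]
      set ρ' : ℝ := ((i : ℝ) + 1) / 2 ^ j
      have hρ' : 0 < ρ' := by positivity
      set u := fun i => scaledSignReLU α ρ (AugMatrix.app v z i)
      set u' := fun i => scaledSignReLU α ρ' (AugMatrix.app s z i)
      set c := max 1 |α|
      have hc : 1 ≤ c := le_max_left _ _
      set e : ℝ := 1 / 2 ^ j with he
      have he0 : 0 ≤ e := by positivity
      have he1 : e ≤ 1 := by
        rw [he, div_le_one (by positivity)]; exact one_le_pow₀ (by norm_num)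
      set h := max 1 ‖z‖
      have hh : 1 ≤ h := le_max_left _ _
      have hu : ‖u - u'‖ ≤ 2 * c * e * h := by
        refine (norm_scaledSignReLU_sub_le α hρ0 hρ' _ _).trans ?_
        rw [← AugMatrix.app_sub]
        have h1 := AugMatrix.norm_app_le (v - s) z
        have h2 : ‖v - s‖ * h ≤ e * h := by gcongr
        calc c * (‖AugMatrix.app (v - s) z‖ + |ρ - ρ'|) ≤ c * (e * h + e * h) := by
              gcongr
              · exact h1.trans h2
              · exact hρi.trans (le_mul_of_one_le_right he0 hh)
          _ = 2 * c * e * h := by ring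
      have hu' : max 1 ‖u'‖ ≤ 2 * c * h := by
        refine max_le (by nlinarith) ?_
        refine (norm_scaledSignReLU_le α hρ' _).trans ?_
        have h1 := AugMatrix.norm_app_le s z
        have h2 : ‖s‖ ≤ 2 := by
          have := norm_le_norm_add_norm_sub v s
          linarith
        calc c * ‖AugMatrix.app s z‖ ≤ c * (2 * h) := by
              gcongr; exact h1.trans (by gcongr)
          _ = 2 * c * h := by ring
      -- Two errors arise: the first-layer error propagated by the Lipschitz bound, and the net
      -- error of the rest at the perturbed point. Each is at most `2c` times the previous relative
      -- error, giving the factor `4c` per layer.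
      have h1 := norm_sub_le_of_mem_scaledClass hf₁ u u'
      have h2 := hfg u'
      have h3 : M * c ^ L * ‖u - u'‖ ≤ M * c ^ L * (2 * c * e * h) := by gcongr
      have h4 : M * (4 * c) ^ L / 2 ^ j * max 1 ‖u'‖ ≤ M * (4 * c) ^ L / 2 ^ j * (2 * c * h) := by
        gcongr
      have h5 : c ^ L ≤ (4 * c) ^ L := by gcongr; linarith
      have h6 : M * c ^ L * (2 * c * e * h) ≤ M * (4 * c) ^ L * (2 * c * e * h) := by gcongr
      have h7 : M * (4 * c) ^ L / 2 ^ j * (2 * c * h) = M * (4 * c) ^ L * (2 * c * e * h) := by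
        rw [he]; ring
      have h8 : M * (4 * c) ^ (L + 1) / 2 ^ j * h = 2 * (M * (4 * c) ^ L * (2 * c * e * h)) := by
        rw [he, pow_succ]; ring
      rw [h8]
      calc ‖f₁ u - g u'‖ ≤ ‖f₁ u - f₁ u'‖ + ‖f₁ u' - g u'‖ := norm_sub_le_norm_sub_add_norm_sub _ _ _
        _ ≤ _ := by linarith

/-! ### Iterated kernel integrals over paths. -/

section PathIntegral

variable {X : Type*} [MeasureSpace X]

/-- The integral of `h (z_T) ∏ k_t (z_{t+1}, z_t)` over the paths starting at `x`. -/
def pathIntegral {T : ℕ} (h : X → ℝ≥0∞) (k : Fin T → X → X → ℝ≥0∞) (x : X) : ℝ≥0∞ :=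
  ∫⁻ z : Fin T → X,
    h ((Fin.cons x z : Fin (T + 1) → X) (Fin.last T)) *
      ∏ t : Fin T, k t ((Fin.cons x z : Fin (T + 1) → X) t.succ)
        ((Fin.cons x z : Fin (T + 1) → X) t.castSucc)

theorem measurable_finCons {T : ℕ} :
    Measurable fun p : X × (Fin T → X) => (Fin.cons p.1 p.2 : Fin (T + 1) → X) := by
  refine measurable_pi_lambda _ fun i => ?_
  refine Fin.cases ?_ (fun i => ?_) i
  · exact measurable_fst
  · exact (measurable_pi_apply i).comp measurable_snd

theorem measurable_finCons_right {T : ℕ} (x : X) :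
    Measurable fun z : Fin T → X => (Fin.cons x z : Fin (T + 1) → X) :=
  measurable_finCons.comp measurable_prodMk_left

theorem measurable_pathIntegrand {T : ℕ} {h : X → ℝ≥0∞} {k : Fin T → X → X → ℝ≥0∞}
    (hh : Measurable h) (hk : ∀ t, Measurable fun p : X × X => k t p.1 p.2) :
    Measurable fun p : Fin (T + 1) → X =>
      h (p (Fin.last T)) * ∏ t : Fin T, k t (p t.succ) (p t.castSucc) :=
  (hh.comp (measurable_pi_apply _)).mul (Finset.measurable_prod _ fun t _ =>
    (hk t).comp (f := fun p : Fin (T + 1) → X => (p t.succ, p t.castSucc))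
      ((measurable_pi_apply _).prodMk (measurable_pi_apply _)))

theorem pathIntegral_zero (h : X → ℝ≥0∞) (k : Fin 0 → X → X → ℝ≥0∞) (x : X) :
    pathIntegral h k x = h x := by
  simp [pathIntegral, volume_pi]

variable [SigmaFinite (volume : Measure X)]

theorem measurable_pathIntegral {T : ℕ} {h : X → ℝ≥0∞} {k : Fin T → X → X → ℝ≥0∞}
    (hh : Measurable h) (hk : ∀ t, Measurable fun p : X × X => k t p.1 p.2) :
    Measurable (pathIntegral h k) :=
  ((measurable_pathIntegrand hh hk).comp measurable_finCons).lintegral_prod_right'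

/-- Tonelli in the first free point `z_1`. This recursion carries all inductions on `T`; values in
`ℝ≥0∞` avoid integrability conditions. -/
theorem pathIntegral_succ {T : ℕ} {h : X → ℝ≥0∞} {k : Fin (T + 1) → X → X → ℝ≥0∞}
    (hh : Measurable h) (hk : ∀ t, Measurable fun p : X × X => k t p.1 p.2) (x : X) :
    pathIntegral h k x = ∫⁻ y, k 0 y x * pathIntegral h (fun t => k t.succ) y := by
  have e := (volume_preserving_piFinSuccAbove (fun _ : Fin (T + 1) => X) 0).symm
  have hm : Measurable fun z : Fin (T + 1) → X =>
      h ((Fin.cons x z : Fin (T + 2) → X) (Fin.last (T + 1))) *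
      ∏ t, k t ((Fin.cons x z : Fin (T + 2) → X) t.succ)
        ((Fin.cons x z : Fin (T + 2) → X) t.castSucc) :=
    (measurable_pathIntegrand hh hk).comp (measurable_finCons_right x)
  have hm' : Measurable fun p : Fin (T + 1) → X =>
      h (p (Fin.last T)) * ∏ t : Fin T, k t.succ (p t.succ) (p t.castSucc) :=
    measurable_pathIntegrand hh fun t => hk t.succ
  rw [pathIntegral, ← e.lintegral_comp hm, Measure.volume_eq_prod, lintegral_prod _
    (by exact (hm.comp e.measurable).aemeasurable)]
  refine lintegral_congr fun y => ?_
  rw [pathIntegral, ← lintegral_const_mul _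
    (by exact hm'.comp (measurable_finCons_right y))]
  refine lintegral_congr fun z => ?_
  have hz : (MeasurableEquiv.piFinSuccAbove (fun _ : Fin (T + 1) => X) 0).symm (y, z) =
      (Fin.cons y z : Fin (T + 1) → X) := by
    simp [MeasurableEquiv.piFinSuccAbove]
    rfl
  rw [hz, Fin.prod_univ_succ]
  simp only [← Fin.succ_last, Fin.cons_succ, ← Fin.succ_castSucc, Fin.castSucc_zero, Fin.cons_zero]
  ring

theorem lintegral_pathIntegral {T : ℕ} {h : X → ℝ≥0∞} {k : Fin T → X → X → ℝ≥0∞}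
    (hh : Measurable h) (hk : ∀ t, Measurable fun p : X × X => k t p.1 p.2) {c : ℝ≥0∞}
    (hc : ∀ t y, ∫⁻ x, k t y x = c) :
    ∫⁻ x, pathIntegral h k x = c ^ T * ∫⁻ x, h x := by
  induction T with
  | zero => simp [pathIntegral_zero]
  | succ T ih =>
    have hI := measurable_pathIntegral hh fun t => hk (Fin.succ t)
    simp_rw [pathIntegral_succ hh hk]
    rw [lintegral_lintegral_swap
      (((hk 0).comp measurable_swap).mul (hI.comp measurable_snd)).aemeasurable]
    have h1 : ∀ y, ∫⁻ x, k 0 y x * pathIntegral h (fun t => k t.succ) y =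
        c * pathIntegral h (fun t => k t.succ) y := fun y => by
      rw [lintegral_mul_const _ (by exact (hk 0).comp measurable_prodMk_left), hc]
    simp_rw [h1]
    rw [lintegral_const_mul _ hI, ih (fun t => hk _) (fun t => hc _), pow_succ]
    ring

/-- Only the kernel ending at `x` is estimated pointwise; the other `T` kernels are integrated and
contribute their masses. -/
theorem pathIntegral_succ_le {T : ℕ} {h : X → ℝ≥0∞} {k : Fin (T + 1) → X → X → ℝ≥0∞}
    (hh : Measurable h) (hk : ∀ t, Measurable fun p : X × X => k t p.1 p.2) {b c : ℝ≥0∞}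
    (hb : ∀ y x, k 0 y x ≤ b) (hc : ∀ t y, ∫⁻ x, k t y x = c) (x : X) :
    pathIntegral h k x ≤ b * (c ^ T * ∫⁻ x, h x) := by
  rw [pathIntegral_succ hh hk, ← lintegral_pathIntegral hh (fun t => hk (Fin.succ t))
    (fun t => hc _), ← lintegral_const_mul _ (measurable_pathIntegral hh fun t => hk (Fin.succ t))]
  exact lintegral_mono fun y => mul_le_mul_left (hb _ _) _

/-- Confine every point to `S`. There are `T + 1` kernels but only `T` volume factors, because the
last point is integrated against `h`. -/
theorem le_pathIntegral_succ {T : ℕ} {h : X → ℝ≥0∞} {k : Fin (T + 1) → X → X → ℝ≥0∞}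
    (hh : Measurable h) (hk : ∀ t, Measurable fun p : X × X => k t p.1 p.2) {γ : ℝ≥0∞}
    {S : Set X} (hS : MeasurableSet S) (hγ : ∀ t, ∀ y ∈ S, ∀ x ∈ S, γ ≤ k t y x) {x : X}
    (hx : x ∈ S) : γ * (γ * volume S) ^ T * ∫⁻ x in S, h x ≤ pathIntegral h k x := by
  induction T generalizing x with
  | zero =>
    rw [pathIntegral_succ hh hk, pow_zero, mul_one, ← lintegral_const_mul _ hh]
    simp_rw [pathIntegral_zero]
    refine (setLIntegral_mono' hS fun y hy => ?_).trans (setLIntegral_le_lintegral S _)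
    exact mul_le_mul_left (hγ 0 y hy x hx) _
  | succ T ih =>
    rw [pathIntegral_succ hh hk]
    refine le_trans ?_ (setLIntegral_le_lintegral S _)
    refine le_trans (le_of_eq ?_) (setLIntegral_mono' hS fun y hy => mul_le_mul'
      (hγ 0 y hy x hx) (ih (fun t => hk (Fin.succ t)) (fun t => hγ _) hy))
    rw [setLIntegral_const, pow_succ]
    ring

end PathIntegral

/-! ### Gaussian densities and their tilts. -/

section Gaussian

variable {d : ℕ}

theorem gaussianDensity_nonneg (μ : E d) (s : ℝ) (x : E d) : 0 ≤ gaussianDensity μ s x := by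
  unfold gaussianDensity; positivity

theorem gaussianDensity_le (μ : E d) (s : ℝ) (x : E d) :
    gaussianDensity μ s x ≤ (2 * Real.pi * s ^ 2) ^ (-(d : ℝ) / 2) := by
  unfold gaussianDensity
  refine mul_le_of_le_one_right (by positivity) (Real.exp_le_one_iff.mpr ?_)
  rw [neg_div]
  exact neg_nonpos.mpr (by positivity)

theorem measurable_gaussianDensity (s : ℝ) :
    Measurable fun p : E d × E d => gaussianDensity p.1 s p.2 := by
  unfold gaussianDensity
  fun_prop

theorem lintegral_exp_neg_mul_sq_norm_sub (μ : E d) {b : ℝ} (hb : 0 < b) :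
    ∫⁻ x, ENNReal.ofReal (Real.exp (-b * ‖x - μ‖ ^ 2)) =
      ENNReal.ofReal ((Real.pi / b) ^ ((d : ℝ) / 2)) := by
  have h0 := GaussianFourier.integral_rexp_neg_mul_sq_norm (V := E d) hb
  rw [finrank_euclideanSpace_fin] at h0
  -- A non-integrable function has Bochner integral `0` by convention, whereas the known value is
  -- positive.
  have hint : Integrable fun x : E d => Real.exp (-b * ‖x‖ ^ 2) := by
    by_contra hcon
    rw [integral_undef hcon] at h0
    have : 0 < (Real.pi / b) ^ ((d : ℝ) / 2) := by positivity
    linarith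
  rw [← h0, lintegral_sub_right_eq_self (fun x => ENNReal.ofReal (Real.exp (-b * ‖x‖ ^ 2))) μ,
    ofReal_integral_eq_lintegral_ofReal hint (ae_of_all _ fun x => (Real.exp_pos _).le)]

theorem lintegral_gaussianDensity (μ : E d) {s : ℝ} (hs : 0 < s) :
    ∫⁻ x, ENNReal.ofReal (gaussianDensity μ s x) = 1 := by
  unfold gaussianDensity
  have h := lintegral_exp_neg_mul_sq_norm_sub μ (b := 1 / (2 * s ^ 2)) (by positivity)
  have e : ∀ x : E d, -‖x - μ‖ ^ 2 / (2 * s ^ 2) = -(1 / (2 * s ^ 2)) * ‖x - μ‖ ^ 2 :=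
    fun x => by ring
  simp_rw [e, ENNReal.ofReal_mul (by positivity : 0 ≤ (2 * Real.pi * s ^ 2) ^ (-(d : ℝ) / 2))]
  rw [lintegral_const_mul _ (by fun_prop), h, ← ENNReal.ofReal_mul (by positivity),
    show Real.pi / (1 / (2 * s ^ 2)) = 2 * Real.pi * s ^ 2 by field_simp, neg_div,
    Real.rpow_neg (by positivity), inv_mul_cancel₀ (by positivity), ENNReal.ofReal_one]

/-- The Gaussian density at `x`, tilted by `exp (‖x - μ‖² / (4 s²))`. -/
theorem lintegral_tilted_gaussianDensity (μ : E d) {s : ℝ} (hs : 0 < s) :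
    ∫⁻ x, ENNReal.ofReal (gaussianDensity μ s x * Real.exp (‖x - μ‖ ^ 2 / (4 * s ^ 2))) =
      ENNReal.ofReal (2 ^ ((d : ℝ) / 2)) := by
  unfold gaussianDensity
  have h := lintegral_exp_neg_mul_sq_norm_sub μ (b := 1 / (4 * s ^ 2)) (by positivity)
  have e : ∀ x : E d, Real.exp (-‖x - μ‖ ^ 2 / (2 * s ^ 2)) *
      Real.exp (‖x - μ‖ ^ 2 / (4 * s ^ 2)) = Real.exp (-(1 / (4 * s ^ 2)) * ‖x - μ‖ ^ 2) :=
    fun x => by rw [← Real.exp_add]; congr 1; field_simp; ring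
  simp_rw [mul_assoc, e,
    ENNReal.ofReal_mul (by positivity : 0 ≤ (2 * (Real.pi * s ^ 2)) ^ (-(d : ℝ) / 2))]
  rw [lintegral_const_mul _ (by fun_prop), h, ← ENNReal.ofReal_mul (by positivity),
    show Real.pi / (1 / (4 * s ^ 2)) = 2 * (2 * (Real.pi * s ^ 2)) by field_simp; ring, neg_div,
    Real.rpow_neg (by positivity), Real.mul_rpow (x := 2) (y := 2 * (Real.pi * s ^ 2))
    (by positivity) (by positivity)]
  congr 1
  field_simp

theorem tilted_gaussianDensity_le (μ : E d) (s : ℝ) (x : E d) :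
    gaussianDensity μ s x * Real.exp (‖x - μ‖ ^ 2 / (4 * s ^ 2)) ≤
      (2 * Real.pi * s ^ 2) ^ (-(d : ℝ) / 2) := by
  unfold gaussianDensity
  rw [mul_assoc, ← Real.exp_add]
  refine mul_le_of_le_one_right (by positivity) (Real.exp_le_one_iff.mpr ?_)
  have : -‖x - μ‖ ^ 2 / (2 * s ^ 2) + ‖x - μ‖ ^ 2 / (4 * s ^ 2) =
      -(‖x - μ‖ ^ 2 / (4 * s ^ 2)) := by
    -- For `s = 0` every quotient is `0` by the convention for division by zero.
    by_cases hs : s = 0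
    · simp [hs]
    · field_simp; ring
  rw [this]
  exact neg_nonpos.mpr (by positivity)

theorem le_gaussianDensity {μ x : E d} {s b : ℝ} (hb : ‖x - μ‖ ≤ b) :
    (2 * Real.pi * s ^ 2) ^ (-(d : ℝ) / 2) * Real.exp (-b ^ 2 / (2 * s ^ 2)) ≤
      gaussianDensity μ s x := by
  unfold gaussianDensity
  gcongr

/-- Moving the mean of a Gaussian density by at most `ε g`. -/
theorem gaussianDensity_mul_exp_le {μ μ' x : E d} {s s₁ ε g : ℝ} (hs₁ : 0 < s₁) (hs : s₁ ≤ s)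
    (hε : 0 ≤ ε) (hε1 : ε ≤ 1) (hμ : ‖μ - μ'‖ ≤ ε * g) :
    gaussianDensity μ s x * Real.exp (-(ε / (2 * s₁ ^ 2) * (‖x - μ‖ ^ 2 + 2 * g ^ 2))) ≤
      gaussianDensity μ' s x := by
  unfold gaussianDensity
  rw [mul_assoc, ← Real.exp_add]
  refine mul_le_mul_of_nonneg_left (Real.exp_le_exp.mpr ?_) (by positivity)
  have hs0 : 0 < s := hs₁.trans_le hs
  have h1 : ‖x - μ'‖ ≤ ‖x - μ‖ + ε * g :=
    (norm_sub_le_norm_sub_add_norm_sub x μ μ').trans (by linarith)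
  have h2 : ‖x - μ'‖ ^ 2 ≤ (‖x - μ‖ + ε * g) ^ 2 := by gcongr
  -- The cross term is split by `2ab ≤ a² + b²`, and `ε² ≤ ε`.
  have h3 : (‖x - μ‖ + ε * g) ^ 2 ≤ ‖x - μ‖ ^ 2 + ε * (‖x - μ‖ ^ 2 + 2 * g ^ 2) := by
    have := mul_nonneg hε (sq_nonneg (‖x - μ‖ - g))
    have := mul_nonneg (mul_nonneg hε (by linarith : 0 ≤ 1 - ε)) (sq_nonneg g)
    nlinarith
  have h4 : ε / (2 * s ^ 2) * (‖x - μ‖ ^ 2 + 2 * g ^ 2) ≤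
      ε / (2 * s₁ ^ 2) * (‖x - μ‖ ^ 2 + 2 * g ^ 2) := by gcongr
  have h5 : -‖x - μ‖ ^ 2 / (2 * s ^ 2) - ε / (2 * s ^ 2) * (‖x - μ‖ ^ 2 + 2 * g ^ 2) ≤
      -‖x - μ'‖ ^ 2 / (2 * s ^ 2) := by
    have e : -‖x - μ‖ ^ 2 / (2 * s ^ 2) - ε / (2 * s ^ 2) * (‖x - μ‖ ^ 2 + 2 * g ^ 2) =
      -(‖x - μ‖ ^ 2 + ε * (‖x - μ‖ ^ 2 + 2 * g ^ 2)) / (2 * s ^ 2) := by ring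
    rw [e]
    gcongr
    linarith
  linarith

end Gaussian

/-! ### Logarithmic stability of integrals under tilting. -/

section Tilting

/-- If `w'` is at least `w` times `exp (-η (1 + S))`, where `S` has an exponential moment under
`w`, then the total mass of `w'` is bounded below. -/
theorem log_integral_le_of_tilt {Ω : Type*} [MeasurableSpace Ω] {μ : Measure Ω}
    {w w' S : Ω → ℝ} {Y η : ℝ} (hw : ∀ z, 0 ≤ w z) (hwi : Integrable w μ)
    (hwi' : Integrable w' μ) (hS : ∀ z, 0 ≤ S z) (hSm : Measurable S)
    (hSi : Integrable (fun z => Real.exp (S z) * w z) μ) (hY0 : 0 < Y)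
    (hY : ∫ z, Real.exp (S z) * w z ∂μ ≤ Y) (hZ : 0 < ∫ z, w z ∂μ) (hη : 0 ≤ η)
    (h : ∀ z, w z * Real.exp (-(η * (1 + S z))) ≤ w' z) :
    Real.log (∫ z, w z ∂μ) - η * (2 + (Real.log Y - Real.log (∫ z, w z ∂μ))) ≤
      Real.log (∫ z, w' z ∂μ) := by
  set Z := ∫ z, w z ∂μ with hZdef
  set s₀ := Real.log Y - Real.log Z with hs₀
  set a := η * (2 + s₀) with ha
  have hSwi : Integrable (fun z => S z * w z) μ := by
    refine hSi.mono (hSm.aestronglyMeasurable.mul hwi.aestronglyMeasurable)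
      (ae_of_all _ fun z => ?_)
    rw [norm_mul, norm_mul, Real.norm_of_nonneg (hS z), Real.norm_of_nonneg (Real.exp_pos _).le]
    have := Real.add_one_le_exp (S z)
    gcongr; linarith
  have hes : Real.exp (-s₀) = Z / Y := by
    rw [hs₀, neg_sub, Real.exp_sub, Real.exp_log hZ, Real.exp_log hY0]
  -- Entropy duality: integrate `S ≤ s₀ + exp (S - s₀)`, with `s₀` chosen so that the exponential
  -- term contributes at most `Z`.
  have hSw : ∫ z, S z * w z ∂μ ≤ (s₀ + 1) * Z := by
    have h1 : ∫ z, S z * w z ∂μ ≤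
        ∫ z, (s₀ * w z + Real.exp (-s₀) * (Real.exp (S z) * w z)) ∂μ := by
      refine integral_mono hSwi ((hwi.const_mul _).add (hSi.const_mul _)) fun z => ?_
      have h2 := Real.add_one_le_exp (S z - s₀)
      rw [sub_eq_neg_add, Real.exp_add] at h2
      have h3 := hw z
      simp only
      nlinarith
    refine h1.trans ?_
    rw [integral_add (hwi.const_mul _) (hSi.const_mul _), integral_const_mul, integral_const_mul,
      hes, ← hZdef]
    have h2 : Z / Y * ∫ z, Real.exp (S z) * w z ∂μ ≤ Z / Y * Y := by gcongr
    rw [div_mul_cancel₀ _ hY0.ne'] at h2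
    linarith
  -- Jensen in linearized form: `exp` is replaced by its tangent at `-a`. For `a = η (2 + s₀)` the
  -- bound on the mean of `S` makes the integrated tangent at least `exp (-a) Z`.
  have hlow : Real.exp (-a) * Z ≤ ∫ z, w' z ∂μ := by
    have h1 : ∫ z, Real.exp (-a) * ((1 + a - η) * w z - η * (S z * w z)) ∂μ ≤ ∫ z, w' z ∂μ := by
      refine integral_mono (((hwi.const_mul _).sub (hSwi.const_mul _)).const_mul _) hwi'
        fun z => ?_
      refine le_trans ?_ (h z)
      have h2 := Real.add_one_le_exp (a - η * (1 + S z))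
      rw [show -(η * (1 + S z)) = -a + (a - η * (1 + S z)) by ring, Real.exp_add]
      have h3 := mul_le_mul_of_nonneg_left h2 (mul_nonneg (hw z) (Real.exp_pos (-a)).le)
      simp only
      nlinarith
    refine le_trans ?_ h1
    rw [integral_const_mul, integral_sub (hwi.const_mul _) (hSwi.const_mul _),
      integral_const_mul, integral_const_mul, ← hZdef]
    refine mul_le_mul_of_nonneg_left ?_ (Real.exp_pos _).le
    have h2 := mul_le_mul_of_nonneg_left hSw hη
    rw [ha]
    nlinarith
  have := Real.log_le_log (mul_pos (Real.exp_pos _) hZ) hlow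
  rw [Real.log_mul (Real.exp_pos _).ne' hZ.ne', Real.log_exp] at this
  linarith

end Tilting

/-! ### Growth of paths in terms of their noise. -/

section PathGrowth

variable {V : Type*} [NormedAddCommGroup V]

/-- Along a path whose steps are `φ_t` plus noise, the points are controlled by the last point
and by the noise. -/
theorem sq_max_norm_path_le {T : ℕ} {A : ℝ} (hA : 1 ≤ A) {φ : Fin T → V → V}
    (hφ : ∀ t z, ‖φ t z‖ ≤ A * max 1 ‖z‖) (p : Fin (T + 1) → V) (i : Fin (T + 1)) :
    max 1 ‖p i‖ ^ 2 ≤ (4 * A ^ 2) ^ T *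
      (1 + ‖p (Fin.last T)‖ ^ 2 + ∑ t, ‖p t.castSucc - φ t (p t.succ)‖ ^ 2) := by
  set N := 1 + ‖p (Fin.last T)‖ ^ 2 + ∑ t, ‖p t.castSucc - φ t (p t.succ)‖ ^ 2 with hN
  have hsum : 0 ≤ ∑ t, ‖p t.castSucc - φ t (p t.succ)‖ ^ 2 :=
    Finset.sum_nonneg fun _ _ => sq_nonneg _
  have hN1 : 1 ≤ N := by
    have := sq_nonneg ‖p (Fin.last T)‖
    linarith
  have hA4 : 1 ≤ 4 * A ^ 2 := by nlinarith
  -- Backward from time `T`: each step costs `4 A²`, since `(A g + n)² ≤ 2 A² g² + 2 n²` and a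
  -- single noise term satisfies `n² ≤ N`.
  have key : ∀ i : Fin (T + 1), max 1 ‖p i‖ ^ 2 ≤ (4 * A ^ 2) ^ (T - i.val) * N := by
    intro i
    induction i using Fin.reverseInduction with
    | last =>
      simp only [Fin.val_last, Nat.sub_self, pow_zero, one_mul]
      rcases max_cases 1 ‖p (Fin.last T)‖ with ⟨h, -⟩ | ⟨h, -⟩ <;> rw [h] <;>
        nlinarith [sq_nonneg ‖p (Fin.last T)‖]
    | cast i ih =>
      have hpow : T - (i.castSucc : Fin (T + 1)).val = (T - (i.succ : Fin (T + 1)).val) + 1 := by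
        simp only [Fin.val_castSucc, Fin.val_succ]; omega
      rw [hpow, pow_succ]
      set q := (4 * A ^ 2) ^ (T - (i.succ : Fin (T + 1)).val)
      have hq : 1 ≤ q := one_le_pow₀ hA4
      set g := max 1 ‖p i.succ‖
      have hg : 1 ≤ g := le_max_left _ _
      set n := ‖p i.castSucc - φ i (p i.succ)‖ with hn
      have hnN : n ^ 2 ≤ N := by
        have h1 := Finset.single_le_sum (f := fun t => ‖p t.castSucc - φ t (p t.succ)‖ ^ 2)
          (fun _ _ => sq_nonneg _) (Finset.mem_univ i)
        have := sq_nonneg ‖p (Fin.last T)‖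
        linarith
      have hn0 : 0 ≤ n := norm_nonneg _
      have h1 : max 1 ‖p i.castSucc‖ ≤ A * g + n := by
        refine max_le (by nlinarith) ?_
        have := norm_le_norm_add_norm_sub (φ i (p i.succ)) (p i.castSucc)
        rw [norm_sub_rev] at this
        exact this.trans (add_le_add (hφ i _) (by rw [hn, norm_sub_rev]))
      calc max 1 ‖p i.castSucc‖ ^ 2 ≤ (A * g + n) ^ 2 := by gcongr
        _ ≤ 2 * A ^ 2 * g ^ 2 + 2 * n ^ 2 := by nlinarith [sq_nonneg (A * g - n)]
        _ ≤ 2 * A ^ 2 * (q * N) + 2 * A ^ 2 * (q * N) := by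
          have h2 : n ^ 2 ≤ A ^ 2 * (q * N) := by
            have h3 : N ≤ q * N := le_mul_of_one_le_left (by linarith) hq
            have h4 : q * N ≤ A ^ 2 * (q * N) :=
              le_mul_of_one_le_left (by positivity) (one_le_pow₀ hA)
            linarith
          have h5 : 2 * A ^ 2 * g ^ 2 ≤ 2 * A ^ 2 * (q * N) := by gcongr
          linarith
        _ = q * (4 * A ^ 2) * N := by ring
  refine (key i).trans ?_
  gcongr
  exact Nat.sub_le _ _

end PathGrowth

/-! ### Terminal densities, path weights and noise energy. -/

variable {d : ℕ}

/-- A probability density `r` with `∫ exp (‖z‖² / 8) r(z) dz ≤ c₀`. -/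
structure IsTerminalDensity (c₀ : ℝ) (r : E d → ℝ) : Prop where
  measurable : Measurable r
  nonneg : ∀ z, 0 ≤ r z
  lintegral_eq_one : ∫⁻ z, ENNReal.ofReal (r z) = 1
  expMoment : ∫⁻ z, ENNReal.ofReal (r z * Real.exp (‖z‖ ^ 2 / 8)) ≤ ENNReal.ofReal c₀

/-- Chernoff bound: outside the ball the exponential weight is at least `2 c₀`, so at most half of
the mass lies there. -/
theorem IsTerminalDensity.half_le {c₀ : ℝ} {r : E d → ℝ} (hr : IsTerminalDensity c₀ r)
    {R : ℝ} (hR0 : 0 ≤ R) (hR : 2 * c₀ ≤ Real.exp (R ^ 2 / 8)) :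
    ENNReal.ofReal (1 / 2) ≤ ∫⁻ z in Metric.closedBall 0 R, ENNReal.ofReal (r z) := by
  have hS : MeasurableSet (Metric.closedBall (0 : E d) R) := measurableSet_closedBall
  have h1 := lintegral_add_compl (μ := volume) (fun z => ENNReal.ofReal (r z)) hS
  rw [hr.lintegral_eq_one] at h1
  have h2 : ∫⁻ z in (Metric.closedBall (0 : E d) R)ᶜ, ENNReal.ofReal (r z) ≤
      ENNReal.ofReal (1 / 2) := by
    have h3 : ∀ z ∈ (Metric.closedBall (0 : E d) R)ᶜ, ENNReal.ofReal (r z) ≤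
        ENNReal.ofReal (Real.exp (-(R ^ 2 / 8))) *
          ENNReal.ofReal (r z * Real.exp (‖z‖ ^ 2 / 8)) := by
      intro z hz
      rw [Set.mem_compl_iff, mem_closedBall_zero_iff, not_le] at hz
      rw [← ENNReal.ofReal_mul (Real.exp_pos _).le]
      refine ENNReal.ofReal_le_ofReal ?_
      rw [mul_left_comm, ← Real.exp_add]
      refine le_mul_of_one_le_right (hr.nonneg z) (Real.one_le_exp ?_)
      have : R ^ 2 ≤ ‖z‖ ^ 2 := by gcongr
      linarith
    refine (setLIntegral_mono' hS.compl h3).trans ((setLIntegral_le_lintegral _ _).trans ?_)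
    rw [lintegral_const_mul' _ _ ENNReal.ofReal_ne_top]
    refine (mul_le_mul_right hr.expMoment _).trans ?_
    rw [← ENNReal.ofReal_mul (Real.exp_pos _).le]
    refine ENNReal.ofReal_le_ofReal ?_
    rw [Real.exp_neg, inv_mul_le_iff₀ (Real.exp_pos _)]
    linarith
  have h4 : (1 : ℝ≥0∞) = ENNReal.ofReal (1 / 2) + ENNReal.ofReal (1 / 2) := by
    rw [← ENNReal.ofReal_add (by norm_num) (by norm_num)]; norm_num
  have h5 : ENNReal.ofReal (1 / 2) + ENNReal.ofReal (1 / 2) ≤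
      (∫⁻ z in Metric.closedBall 0 R, ENNReal.ofReal (r z)) + ENNReal.ofReal (1 / 2) := by
    rw [← h4, ← h1]
    exact add_le_add_right h2 _
  exact (ENNReal.add_le_add_iff_right ENNReal.ofReal_ne_top).mp h5

/-- Measurable transition maps of linear growth. -/
structure IsGrowthFamily {T : ℕ} (A : ℝ) (φ : Fin T → E d → E d) : Prop where
  measurable : ∀ t, Measurable (φ t)
  norm_le : ∀ t z, ‖φ t z‖ ≤ A * max 1 ‖z‖

/-- The integrand of `generatedDensity` at a path. -/
def pathWeight {T : ℕ} (r : E d → ℝ) (σ : Fin T → ℝ) (φ : Fin T → E d → E d)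
    (p : Fin (T + 1) → E d) : ℝ :=
  r (p (Fin.last T)) * ∏ t, gaussianDensity (φ t (p t.succ)) (σ t) (p t.castSucc)

/-- The noise energy of a path. -/
def pathEnergy {T : ℕ} (σ : Fin T → ℝ) (φ : Fin T → E d → E d) (p : Fin (T + 1) → E d) : ℝ :=
  ‖p (Fin.last T)‖ ^ 2 / 8 +
    ∑ t, ‖p t.castSucc - φ t (p t.succ)‖ ^ 2 / (4 * (σ t) ^ 2)

section Weights

variable {T : ℕ} {r : E d → ℝ} {σ : Fin T → ℝ} {φ : Fin T → E d → E d} {A c₀ : ℝ}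

theorem generatedDensity_eq (x : E d) :
    generatedDensity r σ φ x = ∫ z : Fin T → E d, pathWeight r σ φ (Fin.cons x z) := rfl

theorem pathWeight_nonneg (hr : ∀ z, 0 ≤ r z) (p : Fin (T + 1) → E d) :
    0 ≤ pathWeight r σ φ p :=
  mul_nonneg (hr _) (Finset.prod_nonneg fun _ _ => gaussianDensity_nonneg _ _ _)

theorem pathEnergy_nonneg (p : Fin (T + 1) → E d) : 0 ≤ pathEnergy σ φ p :=
  add_nonneg (by positivity) (Finset.sum_nonneg fun _ _ => by positivity)

theorem generatedDensity_nonneg (hr : ∀ z, 0 ≤ r z) (x : E d) : 0 ≤ generatedDensity r σ φ x :=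
  integral_nonneg fun _ => pathWeight_nonneg hr _

theorem measurable_transition (hφ : ∀ t, Measurable (φ t)) (t : Fin T) :
    Measurable fun p : E d × E d => gaussianDensity (φ t p.1) (σ t) p.2 :=
  Measurable.comp (g := fun p : E d × E d => gaussianDensity p.1 (σ t) p.2)
    (f := fun p : E d × E d => (φ t p.1, p.2)) (measurable_gaussianDensity (σ t))
    (((hφ t).comp measurable_fst).prodMk measurable_snd)

theorem measurable_pathWeight (hr : Measurable r) (hφ : ∀ t, Measurable (φ t)) :
    Measurable (pathWeight r σ φ) := by
  unfold pathWeight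
  have hp : ∀ i, Measurable fun p : Fin (T + 1) → E d => p i := measurable_pi_apply
  refine Measurable.mul (hr.comp (hp _)) (Finset.measurable_prod _ fun t _ => ?_)
  exact Measurable.comp (g := fun p : E d × E d => gaussianDensity (φ t p.1) (σ t) p.2)
    (f := fun p : Fin (T + 1) → E d => (p t.succ, p t.castSucc)) (measurable_transition hφ t)
    ((hp _).prodMk (hp _))

theorem measurable_pathEnergy (hφ : ∀ t, Measurable (φ t)) : Measurable (pathEnergy σ φ) := by
  unfold pathEnergy
  have hp : ∀ i, Measurable fun p : Fin (T + 1) → E d => p i := measurable_pi_apply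
  exact Measurable.add (((hp _).norm.pow_const 2).div_const _)
    (Finset.measurable_sum _ fun t _ =>
      (((hp _).sub ((hφ t).comp (hp _))).norm.pow_const 2).div_const _)

theorem measurable_generatedDensity (hr : Measurable r) (hφ : ∀ t, Measurable (φ t)) :
    Measurable (generatedDensity r σ φ) :=
  (((measurable_pathWeight hr hφ).comp
    measurable_finCons).stronglyMeasurable.integral_prod_right').measurable

theorem lintegral_pathWeight (hr : ∀ z, 0 ≤ r z) (x : E d) :
    ∫⁻ z : Fin T → E d, ENNReal.ofReal (pathWeight r σ φ (Fin.cons x z)) =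
      pathIntegral (fun z => ENNReal.ofReal (r z))
        (fun t y x => ENNReal.ofReal (gaussianDensity (φ t y) (σ t) x)) x := by
  refine lintegral_congr fun z => ?_
  rw [pathWeight, ENNReal.ofReal_mul (hr _),
    ENNReal.ofReal_prod_of_nonneg fun _ _ => gaussianDensity_nonneg _ _ _]

/-- The energy is a sum over the steps, so its exponential distributes over the kernels and the
result is again a path integral. Each energy term is half of the Gaussian exponent, so the tilted
kernels remain integrable. -/
theorem lintegral_tilted_pathWeight (hr : ∀ z, 0 ≤ r z) (x : E d) :
    ∫⁻ z : Fin T → E d, ENNReal.ofReal (Real.exp (pathEnergy σ φ (Fin.cons x z)) *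
        pathWeight r σ φ (Fin.cons x z)) =
      pathIntegral (fun z => ENNReal.ofReal (r z * Real.exp (‖z‖ ^ 2 / 8)))
        (fun t y x => ENNReal.ofReal (gaussianDensity (φ t y) (σ t) x *
          Real.exp (‖x - φ t y‖ ^ 2 / (4 * (σ t) ^ 2)))) x := by
  refine lintegral_congr fun z => ?_
  rw [pathWeight, pathEnergy, Real.exp_add, Real.exp_sum,
    ← ENNReal.ofReal_prod_of_nonneg fun _ _ => mul_nonneg (gaussianDensity_nonneg _ _ _)
      (Real.exp_pos _).le, ← ENNReal.ofReal_mul (mul_nonneg (hr _) (Real.exp_pos _).le),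
    Finset.prod_mul_distrib]
  congr 1
  ring

end Weights

/-! ### Bounds and modulus of continuity for the log-density. -/

section Bounds

variable {T : ℕ} {r : E d → ℝ} {σ : Fin (T + 1) → ℝ} {φ : Fin (T + 1) → E d → E d}
  {A c₀ s₁ s₂ : ℝ}

theorem rpow_neg_half_anti {s : ℝ} (hs₁ : 0 < s₁) (hs : s₁ ≤ s) :
    (2 * Real.pi * s ^ 2) ^ (-(d : ℝ) / 2) ≤ (2 * Real.pi * s₁ ^ 2) ^ (-(d : ℝ) / 2) := by
  have hd : -(d : ℝ) / 2 ≤ 0 := by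
    rw [neg_div]; exact neg_nonpos.mpr (by positivity)
  exact Real.rpow_le_rpow_of_nonpos (by positivity) (by gcongr) hd

theorem lintegral_pathWeight_le (hr : IsTerminalDensity c₀ r) (hφ : IsGrowthFamily A φ)
    (hs₁ : 0 < s₁) (hσ : ∀ t, s₁ ≤ σ t) (x : E d) :
    ∫⁻ z : Fin (T + 1) → E d, ENNReal.ofReal (pathWeight r σ φ (Fin.cons x z)) ≤
      ENNReal.ofReal ((2 * Real.pi * s₁ ^ 2) ^ (-(d : ℝ) / 2)) := by
  rw [lintegral_pathWeight hr.nonneg]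
  refine (pathIntegral_succ_le hr.measurable.ennreal_ofReal
    (fun t => (measurable_transition hφ.measurable t).ennreal_ofReal)
    (b := ENNReal.ofReal ((2 * Real.pi * s₁ ^ 2) ^ (-(d : ℝ) / 2))) (c := 1)
    (fun y x => ENNReal.ofReal_le_ofReal
      ((gaussianDensity_le _ _ _).trans (rpow_neg_half_anti hs₁ (hσ 0))))
    (fun t y => lintegral_gaussianDensity _ (hs₁.trans_le (hσ t))) x).trans ?_
  rw [hr.lintegral_eq_one]
  simp

theorem integrable_pathWeight (hr : IsTerminalDensity c₀ r) (hφ : IsGrowthFamily A φ)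
    (hs₁ : 0 < s₁) (hσ : ∀ t, s₁ ≤ σ t) (x : E d) :
    Integrable fun z : Fin (T + 1) → E d => pathWeight r σ φ (Fin.cons x z) := by
  refine ⟨((measurable_pathWeight hr.measurable hφ.measurable).comp
    (measurable_finCons_right x)).aestronglyMeasurable, ?_⟩
  rw [hasFiniteIntegral_iff_ofReal (ae_of_all _ fun z => pathWeight_nonneg hr.nonneg _)]
  exact (lintegral_pathWeight_le hr hφ hs₁ hσ x).trans_lt ENNReal.ofReal_lt_top

theorem ofReal_generatedDensity (hr : IsTerminalDensity c₀ r) (hφ : IsGrowthFamily A φ)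
    (hs₁ : 0 < s₁) (hσ : ∀ t, s₁ ≤ σ t) (x : E d) :
    ENNReal.ofReal (generatedDensity r σ φ x) =
      pathIntegral (fun z => ENNReal.ofReal (r z))
        (fun t y x => ENNReal.ofReal (gaussianDensity (φ t y) (σ t) x)) x := by
  rw [generatedDensity_eq, ofReal_integral_eq_lintegral_ofReal
    (integrable_pathWeight hr hφ hs₁ hσ x) (ae_of_all _ fun z => pathWeight_nonneg hr.nonneg _),
    lintegral_pathWeight hr.nonneg]

theorem lintegral_generatedDensity (hr : IsTerminalDensity c₀ r) (hφ : IsGrowthFamily A φ)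
    (hs₁ : 0 < s₁) (hσ : ∀ t, s₁ ≤ σ t) :
    ∫⁻ x, ENNReal.ofReal (generatedDensity r σ φ x) = 1 := by
  simp_rw [ofReal_generatedDensity hr hφ hs₁ hσ]
  rw [lintegral_pathIntegral hr.measurable.ennreal_ofReal
    (fun t => (measurable_transition hφ.measurable t).ennreal_ofReal)
    (c := 1) (fun t y => lintegral_gaussianDensity _ (hs₁.trans_le (hσ t))), hr.lintegral_eq_one]
  simp

theorem generatedDensity_le (hr : IsTerminalDensity c₀ r) (hφ : IsGrowthFamily A φ)
    (hs₁ : 0 < s₁) (hσ : ∀ t, s₁ ≤ σ t) (x : E d) :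
    generatedDensity r σ φ x ≤ (2 * Real.pi * s₁ ^ 2) ^ (-(d : ℝ) / 2) := by
  have h := lintegral_pathWeight_le hr hφ hs₁ hσ x
  rw [lintegral_pathWeight hr.nonneg, ← ofReal_generatedDensity hr hφ hs₁ hσ] at h
  exact (ENNReal.ofReal_le_ofReal_iff (by positivity)).mp h

/-- Exponential moment of the energy under the path weights: a sup bound for the first tilted
kernel, mass `2 ^ (d / 2)` for each of the other `T`, and `c₀` for the terminal density. Its
logarithm is linear in `T`. -/
theorem lintegral_tilted_pathWeight_le (hr : IsTerminalDensity c₀ r)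
    (hφ : IsGrowthFamily A φ) (hs₁ : 0 < s₁) (hσ : ∀ t, s₁ ≤ σ t) (x : E d) :
    ∫⁻ z : Fin (T + 1) → E d, ENNReal.ofReal (Real.exp (pathEnergy σ φ (Fin.cons x z)) *
        pathWeight r σ φ (Fin.cons x z)) ≤
      ENNReal.ofReal ((2 * Real.pi * s₁ ^ 2) ^ (-(d : ℝ) / 2) *
        ((2 ^ ((d : ℝ) / 2)) ^ T * c₀)) := by
  rw [lintegral_tilted_pathWeight hr.nonneg]
  have hmr : Measurable fun z => r z * Real.exp (‖z‖ ^ 2 / 8) :=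
    hr.measurable.mul (Real.measurable_exp.comp ((measurable_norm.pow_const 2).div_const _))
  have hmk : ∀ t, Measurable fun p : E d × E d => gaussianDensity (φ t p.1) (σ t) p.2 *
      Real.exp (‖p.2 - φ t p.1‖ ^ 2 / (4 * (σ t) ^ 2)) := fun t =>
    (measurable_transition hφ.measurable t).mul (Real.measurable_exp.comp
      (((measurable_snd.sub ((hφ.measurable t).comp measurable_fst)).norm.pow_const 2).div_const _))
  refine (pathIntegral_succ_le hmr.ennreal_ofReal (fun t => (hmk t).ennreal_ofReal)
    (b := ENNReal.ofReal ((2 * Real.pi * s₁ ^ 2) ^ (-(d : ℝ) / 2)))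
    (c := ENNReal.ofReal (2 ^ ((d : ℝ) / 2)))
    (fun y x => ENNReal.ofReal_le_ofReal
      ((tilted_gaussianDensity_le _ _ _).trans (rpow_neg_half_anti hs₁ (hσ 0))))
    (fun t y => lintegral_tilted_gaussianDensity _ (hs₁.trans_le (hσ t))) x).trans ?_
  rw [ENNReal.ofReal_mul (by positivity), ENNReal.ofReal_mul (by positivity),
    ENNReal.ofReal_pow (by positivity)]
  gcongr
  exact hr.expMoment

/-- For points in the ball of radius `R` the distance to the mean is at most `R + A R`, so `g`
bounds every transition kernel from below there; half of the terminal mass lies in the ball. -/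
theorem le_generatedDensity (hr : IsTerminalDensity c₀ r) (hφ : IsGrowthFamily A φ)
    (hs₁ : 0 < s₁) (hσ : ∀ t, s₁ ≤ σ t) (hσ₂ : ∀ t, σ t ≤ s₂) {R : ℝ} (hR1 : 1 ≤ R)
    (hR : 2 * c₀ ≤ Real.exp (R ^ 2 / 8)) (hA : 0 ≤ A) {x : E d} (hx : ‖x‖ ≤ R) {v g : ℝ}
    (hv : ENNReal.ofReal v = volume (Metric.closedBall (0 : E d) R))
    (hv0 : 0 ≤ v)
    (hg : g = (2 * Real.pi * s₂ ^ 2) ^ (-(d : ℝ) / 2) *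
      Real.exp (-(R + A * R) ^ 2 / (2 * s₁ ^ 2))) :
    g * (g * v) ^ T * (1 / 2) ≤ generatedDensity r σ φ x := by
  have hg0 : 0 ≤ g := by rw [hg]; positivity
  have hγ : ∀ t, ∀ y ∈ Metric.closedBall (0 : E d) R, ∀ x ∈ Metric.closedBall (0 : E d) R,
      ENNReal.ofReal g ≤ ENNReal.ofReal (gaussianDensity (φ t y) (σ t) x) := by
    intro t y hy x hx
    rw [mem_closedBall_zero_iff] at hx hy
    refine ENNReal.ofReal_le_ofReal (le_trans ?_ (le_gaussianDensity (b := R + A * R) ?_))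
    · rw [hg]
      have hσt : 0 < σ t := hs₁.trans_le (hσ t)
      have h1 : -(R + A * R) ^ 2 / (2 * s₁ ^ 2) ≤ -(R + A * R) ^ 2 / (2 * (σ t) ^ 2) := by
        rw [neg_div, neg_div]
        have := hσ t
        gcongr
      exact mul_le_mul (rpow_neg_half_anti hσt (hσ₂ t)) (Real.exp_le_exp.mpr h1)
        (Real.exp_pos _).le (by positivity)
    · refine (norm_sub_le _ _).trans (add_le_add hx ((hφ.norm_le t y).trans ?_))
      gcongr
      exact max_le hR1 hy
  have h := le_pathIntegral_succ hr.measurable.ennreal_ofReal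
    (fun t => (measurable_transition hφ.measurable t).ennreal_ofReal)
    measurableSet_closedBall hγ (mem_closedBall_zero_iff.mpr hx)
  rw [← ofReal_generatedDensity hr hφ hs₁ hσ, ← hv] at h
  have h2 := (mul_le_mul_right (hr.half_le (by linarith) hR) _).trans h
  rw [← ENNReal.ofReal_mul hg0, ← ENNReal.ofReal_pow (mul_nonneg hg0 hv0),
    ← ENNReal.ofReal_mul hg0, ← ENNReal.ofReal_mul (by positivity)] at h2
  exact (ENNReal.ofReal_le_ofReal_iff (generatedDensity_nonneg hr.nonneg x)).mp h2

/-- Under a perturbation of the transition maps, the path weights change by a factor controlled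
by the noise energy. -/
theorem pathWeight_mul_exp_le {φ' : Fin (T + 1) → E d → E d} {ε : ℝ} (hr : ∀ z, 0 ≤ r z)
    (hφ : IsGrowthFamily A φ) (hA : 1 ≤ A) (hs₁ : 0 < s₁) (hσ : ∀ t, s₁ ≤ σ t)
    (hσ₂ : ∀ t, σ t ≤ s₂) (hε : 0 ≤ ε) (hε1 : ε ≤ 1)
    (hφφ' : ∀ t z, ‖φ t z - φ' t z‖ ≤ ε * max 1 ‖z‖) (p : Fin (T + 2) → E d) :
    pathWeight r σ φ p * Real.exp (-(ε / (2 * s₁ ^ 2) * (3 * (T + 1 : ℕ) *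
      (4 * A ^ 2) ^ (T + 1) * (8 + 4 * s₂ ^ 2)) * (1 + pathEnergy σ φ p))) ≤
      pathWeight r σ φ' p := by
  set N := 1 + ‖p (Fin.last (T + 1))‖ ^ 2 + ∑ t, ‖p t.castSucc - φ t (p t.succ)‖ ^ 2 with hN
  set q := (4 * A ^ 2) ^ (T + 1) with hq
  have hq1 : 1 ≤ q := one_le_pow₀ (by nlinarith)
  have hg : ∀ i, max 1 ‖p i‖ ^ 2 ≤ q * N := sq_max_norm_path_le hA hφ.norm_le p
  have hsum0 : 0 ≤ ∑ t, ‖p t.castSucc - φ t (p t.succ)‖ ^ 2 :=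
    Finset.sum_nonneg fun _ _ => sq_nonneg _
  -- The denominators `8` and `4 σ_t² ≤ 4 s₂²` of the energy are undone.
  have hNE : N ≤ (8 + 4 * s₂ ^ 2) * (1 + pathEnergy σ φ p) := by
    have h1 : ∑ t, ‖p t.castSucc - φ t (p t.succ)‖ ^ 2 ≤
        4 * s₂ ^ 2 * ∑ t, ‖p t.castSucc - φ t (p t.succ)‖ ^ 2 / (4 * (σ t) ^ 2) := by
      rw [Finset.mul_sum]
      refine Finset.sum_le_sum fun t _ => ?_
      have hσt : 0 < σ t := hs₁.trans_le (hσ t)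
      rw [mul_div_assoc', le_div_iff₀ (by positivity), mul_comm]
      have := hσ₂ t
      gcongr
    have h2 : 0 ≤ ∑ t, ‖p t.castSucc - φ t (p t.succ)‖ ^ 2 / (4 * (σ t) ^ 2) :=
      Finset.sum_nonneg fun _ _ => by positivity
    rw [hN, pathEnergy]
    nlinarith [sq_nonneg s₂, mul_nonneg (sq_nonneg s₂) (sq_nonneg ‖p (Fin.last (T + 1))‖)]
  have hstep : ∑ t : Fin (T + 1), (‖p t.castSucc - φ t (p t.succ)‖ ^ 2 +
      2 * max 1 ‖p t.succ‖ ^ 2) ≤ 3 * (T + 1 : ℕ) * q * N := by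
    have hN0 : 0 ≤ N := by rw [hN]; positivity
    have h1 : ∑ t : Fin (T + 1), 2 * max 1 ‖p t.succ‖ ^ 2 ≤ (T + 1 : ℕ) * (2 * (q * N)) := by
      refine (Finset.sum_le_sum fun t _ =>
        mul_le_mul_of_nonneg_left (hg t.succ) zero_le_two).trans (le_of_eq ?_)
      simp
    have h2 : ∑ t : Fin (T + 1), ‖p t.castSucc - φ t (p t.succ)‖ ^ 2 ≤ (T + 1 : ℕ) * (q * N) := by
      have h3 : N ≤ q * N := le_mul_of_one_le_left hN0 hq1
      have h4 : q * N ≤ (T + 1 : ℕ) * (q * N) :=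
        le_mul_of_one_le_left (by positivity) (by push_cast; linarith [T.cast_nonneg (α := ℝ)])
      have := sq_nonneg ‖p (Fin.last (T + 1))‖
      linarith
    rw [Finset.sum_add_distrib]
    linarith
  have hexp : ε / (2 * s₁ ^ 2) * ∑ t : Fin (T + 1), (‖p t.castSucc - φ t (p t.succ)‖ ^ 2 +
      2 * max 1 ‖p t.succ‖ ^ 2) ≤ ε / (2 * s₁ ^ 2) * (3 * (T + 1 : ℕ) * q * (8 + 4 * s₂ ^ 2)) *
        (1 + pathEnergy σ φ p) := by
    rw [mul_assoc (ε / (2 * s₁ ^ 2))]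
    refine mul_le_mul_of_nonneg_left (hstep.trans ?_) (by positivity)
    rw [mul_assoc (3 * ((T + 1 : ℕ) : ℝ) * q)]
    gcongr
  calc pathWeight r σ φ p * Real.exp _
      ≤ pathWeight r σ φ p * Real.exp (-(ε / (2 * s₁ ^ 2) * ∑ t : Fin (T + 1),
        (‖p t.castSucc - φ t (p t.succ)‖ ^ 2 + 2 * max 1 ‖p t.succ‖ ^ 2))) :=
        mul_le_mul_of_nonneg_left (Real.exp_le_exp.mpr (neg_le_neg hexp))
          (pathWeight_nonneg hr p)
    _ = r (p (Fin.last (T + 1))) * ∏ t, (gaussianDensity (φ t (p t.succ)) (σ t) (p t.castSucc) *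
          Real.exp (-(ε / (2 * s₁ ^ 2) * (‖p t.castSucc - φ t (p t.succ)‖ ^ 2 +
            2 * max 1 ‖p t.succ‖ ^ 2)))) := by
        rw [pathWeight, Finset.prod_mul_distrib, ← Real.exp_sum, Finset.sum_neg_distrib,
          ← Finset.mul_sum, mul_assoc]
    _ ≤ pathWeight r σ φ' p := by
        refine mul_le_mul_of_nonneg_left (Finset.prod_le_prod (fun t _ =>
          mul_nonneg (gaussianDensity_nonneg _ _ _) (Real.exp_pos _).le) fun t _ => ?_) (hr _)
        exact gaussianDensity_mul_exp_le hs₁ (hσ t) hε hε1 (hφφ' t _)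

end Bounds

theorem norm_le_of_mem_cube {x : E d} (hx : x ∈ cube d) : ‖x‖ ≤ √d := by
  rw [EuclideanSpace.norm_eq]
  refine Real.sqrt_le_sqrt ?_
  calc ∑ i, ‖x i‖ ^ 2 ≤ ∑ _i : Fin d, (1 : ℝ) := Finset.sum_le_sum fun i _ => by
        have h : |x i| ≤ 1 := abs_le.mpr (hx i)
        rw [Real.norm_eq_abs]
        exact pow_le_one₀ (abs_nonneg _) h
    _ = d := by simp

theorem log_mul_pow_mul_half_ge {a x v A : ℝ} {T : ℕ} (ha : 0 < a) (hv : 0 < v)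
    (hA : 1 ≤ A) :
    -((|Real.log a| + x + |Real.log v| + 1) * (T + 1 : ℕ) * A ^ 2) ≤
      Real.log ((a * Real.exp (-(x * A ^ 2))) * ((a * Real.exp (-(x * A ^ 2))) * v) ^ T *
        (1 / 2)) := by
  have hg : 0 < a * Real.exp (-(x * A ^ 2)) := by positivity
  rw [Real.log_mul (by positivity) (by norm_num), Real.log_mul hg.ne' (by positivity),
    Real.log_pow, Real.log_mul hg.ne' hv.ne', Real.log_mul ha.ne' (Real.exp_pos _).ne',
    Real.log_exp, one_div, Real.log_inv]
  have h2 : Real.log 2 ≤ 1 := by linarith [Real.log_le_sub_one_of_pos (zero_lt_two (α := ℝ))]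
  have hA2 : 1 ≤ A ^ 2 := one_le_pow₀ hA
  have h3 := neg_abs_le (Real.log a)
  have h4 := neg_abs_le (Real.log v)
  have hT : (0 : ℝ) ≤ T := Nat.cast_nonneg _
  have h5 : -|Real.log a| - x * A ^ 2 ≤ Real.log a + -(x * A ^ 2) := by linarith
  have h6 : (T : ℝ) * (-|Real.log a| - x * A ^ 2 - |Real.log v|) ≤
      T * (Real.log a + -(x * A ^ 2) + Real.log v) :=
    mul_le_mul_of_nonneg_left (by linarith) hT
  have h7 : (|Real.log a| + |Real.log v| + 1) * (T + 1) ≤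
      (|Real.log a| + |Real.log v| + 1) * (T + 1) * A ^ 2 :=
    le_mul_of_one_le_right (by positivity) hA2
  push_cast
  nlinarith [abs_nonneg (Real.log v)]

/-- The tilting inequality on path space, with the noise energy as `S` and the two path weights as
`w` and `w'`. -/
theorem log_generatedDensity_sub_le {T : ℕ} {r : E d → ℝ} {σ : Fin (T + 1) → ℝ}
    {φ φ' : Fin (T + 1) → E d → E d} {A A' c₀ s₁ s₂ ε Y : ℝ} {x : E d}
    (hr : IsTerminalDensity c₀ r) (hA : 1 ≤ A) (hφ : IsGrowthFamily A φ)
    (hφ' : IsGrowthFamily A' φ') (hs₁ : 0 < s₁) (hσ : ∀ t, s₁ ≤ σ t) (hσ₂ : ∀ t, σ t ≤ s₂)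
    (hε : 0 ≤ ε) (hε1 : ε ≤ 1) (hgap : ∀ t z, ‖φ t z - φ' t z‖ ≤ ε * max 1 ‖z‖) (hY0 : 0 < Y)
    (hY : (2 * Real.pi * s₁ ^ 2) ^ (-(d : ℝ) / 2) * ((2 ^ ((d : ℝ) / 2)) ^ T * c₀) ≤ Y)
    (hpos : 0 < generatedDensity r σ φ x) :
    Real.log (generatedDensity r σ φ x) -
      ε / (2 * s₁ ^ 2) * (3 * (T + 1 : ℕ) * (4 * A ^ 2) ^ (T + 1) * (8 + 4 * s₂ ^ 2)) *
        (2 + (Real.log Y - Real.log (generatedDensity r σ φ x))) ≤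
      Real.log (generatedDensity r σ φ' x) := by
  have hm := measurable_finCons_right (T := T + 1) x
  have hwi := integrable_pathWeight hr hφ hs₁ hσ x
  have hwi' := integrable_pathWeight hr hφ' hs₁ hσ x
  have hSm : Measurable fun z : Fin (T + 1) → E d => pathEnergy σ φ (Fin.cons x z) :=
    (measurable_pathEnergy hφ.measurable).comp hm
  have hl := lintegral_tilted_pathWeight_le hr hφ hs₁ hσ x
  have hw : ∀ z : Fin (T + 1) → E d, 0 ≤ pathWeight r σ φ (Fin.cons x z) := fun z =>
    pathWeight_nonneg hr.nonneg _
  have hS : ∀ z : Fin (T + 1) → E d, 0 ≤ pathEnergy σ φ (Fin.cons x z) := fun z =>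
    pathEnergy_nonneg _
  have hnn : ∀ z : Fin (T + 1) → E d, 0 ≤ Real.exp (pathEnergy σ φ (Fin.cons x z)) *
      pathWeight r σ φ (Fin.cons x z) := fun z => mul_nonneg (Real.exp_pos _).le (hw z)
  have htilt : ∀ z : Fin (T + 1) → E d, _ := fun z =>
    pathWeight_mul_exp_le hr.nonneg hφ hA hs₁ hσ hσ₂ hε hε1 hgap (Fin.cons x z)
  have hη : 0 ≤ ε / (2 * s₁ ^ 2) * (3 * (T + 1 : ℕ) * (4 * A ^ 2) ^ (T + 1) *
      (8 + 4 * s₂ ^ 2)) := by positivity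
  rw [generatedDensity_eq] at hpos ⊢
  rw [generatedDensity_eq]
  generalize ε / (2 * s₁ ^ 2) * (3 * (T + 1 : ℕ) * (4 * A ^ 2) ^ (T + 1) *
      (8 + 4 * s₂ ^ 2)) = η at htilt hη ⊢
  have hSi : Integrable fun z : Fin (T + 1) → E d =>
      Real.exp (pathEnergy σ φ (Fin.cons x z)) * pathWeight r σ φ (Fin.cons x z) := by
    refine ⟨(Real.measurable_exp.comp hSm).aestronglyMeasurable.mul hwi.aestronglyMeasurable, ?_⟩
    rw [hasFiniteIntegral_iff_ofReal (ae_of_all _ hnn)]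
    exact hl.trans_lt ENNReal.ofReal_lt_top
  have hSY : ∫ z : Fin (T + 1) → E d,
      Real.exp (pathEnergy σ φ (Fin.cons x z)) * pathWeight r σ φ (Fin.cons x z) ≤ Y := by
    rw [← ofReal_integral_eq_lintegral_ofReal hSi (ae_of_all _ hnn)] at hl
    exact (ENNReal.ofReal_le_ofReal_iff hY0.le).mp (hl.trans (ENNReal.ofReal_le_ofReal hY))
  exact log_integral_le_of_tilt hw hwi hwi' hS hSm hSi hY0 hSY hpos hη htilt

theorem abs_log_generatedDensity_le {T : ℕ} {r : E d → ℝ} {σ : Fin (T + 1) → ℝ}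
    {φ : Fin (T + 1) → E d → E d} {A c₀ s₁ s₂ R a b v : ℝ} {x : E d}
    (hr : IsTerminalDensity c₀ r) (hφ : IsGrowthFamily A φ) (hs₁ : 0 < s₁)
    (hσ : ∀ t, s₁ ≤ σ t) (hσ₂ : ∀ t, σ t ≤ s₂) (hR1 : 1 ≤ R)
    (hRc : 2 * c₀ ≤ Real.exp (R ^ 2 / 8)) (hRd : √d ≤ R) (hA : 1 ≤ A) (hx : x ∈ cube d)
    (ha : a = (2 * Real.pi * s₂ ^ 2) ^ (-(d : ℝ) / 2))
    (hb : b = (2 * Real.pi * s₁ ^ 2) ^ (-(d : ℝ) / 2))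
    (hv : ENNReal.ofReal v = volume (Metric.closedBall (0 : E d) R)) (hv0 : 0 < v) :
    0 < generatedDensity r σ φ x ∧ |Real.log (generatedDensity r σ φ x)| ≤
      (|Real.log a| + 2 * R ^ 2 / s₁ ^ 2 + |Real.log v| + 1 + |Real.log b|) * (T + 1 : ℕ) *
        A ^ 2 := by
  -- For `A ≥ 1`, `(R + A R)² / (2 s₁²) ≤ y A²`.
  set y : ℝ := 2 * R ^ 2 / s₁ ^ 2 with hy
  have hy0 : 0 ≤ y := by positivity
  have hs₂ : 0 < s₂ := hs₁.trans_le ((hσ 0).trans (hσ₂ 0))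
  have ha0 : 0 < a := by rw [ha]; positivity
  have hA2 : 1 ≤ A ^ 2 := one_le_pow₀ hA
  have hT1 : (1 : ℝ) ≤ (T + 1 : ℕ) := by push_cast; linarith [T.cast_nonneg (α := ℝ)]
  have h1 := le_generatedDensity hr hφ hs₁ hσ hσ₂ hR1 hRc (by linarith)
    ((norm_le_of_mem_cube hx).trans hRd) hv hv0.le rfl
  rw [← ha] at h1
  have h2 : a * Real.exp (-(y * A ^ 2)) ≤ a * Real.exp (-(R + A * R) ^ 2 / (2 * s₁ ^ 2)) := by
    refine mul_le_mul_of_nonneg_left (Real.exp_le_exp.mpr ?_) ha0.le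
    have h3 : (R + A * R) ^ 2 ≤ 4 * R ^ 2 * A ^ 2 := by
      have : R + A * R ≤ 2 * R * A := by nlinarith
      calc (R + A * R) ^ 2 ≤ (2 * R * A) ^ 2 := by gcongr
        _ = _ := by ring
    rw [neg_div]
    refine neg_le_neg ?_
    rw [hy, div_le_iff₀ (by positivity)]
    refine h3.trans (le_of_eq ?_)
    field_simp
    ring
  have h4 : (a * Real.exp (-(y * A ^ 2))) * ((a * Real.exp (-(y * A ^ 2))) * v) ^ T * (1 / 2) ≤
      generatedDensity r σ φ x := le_trans (by gcongr) h1
  have hpos : 0 < (a * Real.exp (-(y * A ^ 2))) * ((a * Real.exp (-(y * A ^ 2))) * v) ^ T *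
      (1 / 2) := by positivity
  refine ⟨hpos.trans_le h4, abs_le.mpr ⟨?_, ?_⟩⟩
  · refine le_trans ?_ ((log_mul_pow_mul_half_ge ha0 hv0 hA).trans
      (Real.log_le_log hpos h4))
    refine neg_le_neg (mul_le_mul_of_nonneg_right (mul_le_mul_of_nonneg_right ?_
      (by positivity)) (by positivity))
    linarith [abs_nonneg (Real.log b)]
  · refine (Real.log_le_log (hpos.trans_le h4) ((generatedDensity_le hr hφ hs₁ hσ x).trans_eq hb.symm)).trans ?_
    refine (le_abs_self (Real.log b)).trans ?_
    have h5 := abs_nonneg (Real.log a)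
    have h6 := abs_nonneg (Real.log v)
    have h7 := abs_nonneg (Real.log b)
    have h8 : |Real.log b| ≤ |Real.log a| + y + |Real.log v| + 1 + |Real.log b| := by linarith
    rw [mul_assoc]
    exact h8.trans (le_mul_of_one_le_right (by linarith)
      (one_le_mul_of_one_le_of_one_le hT1 hA2))

/-- Bounds, uniform over the cube, for the logarithm of generated densities and for its
modulus of continuity in the transition maps. -/
theorem exists_logDensity_bounds (d : ℕ) {s₁ s₂ c₀ : ℝ} (hs₁ : 0 < s₁) (hc₀ : 0 < c₀) :
    ∃ C : ℝ, 1 ≤ C ∧ ∀ (T : ℕ) (r : E d → ℝ), IsTerminalDensity c₀ r →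
      ∀ σ : Fin (T + 1) → ℝ, (∀ t, s₁ ≤ σ t) → (∀ t, σ t ≤ s₂) →
      ∀ (A : ℝ), 1 ≤ A → ∀ φ : Fin (T + 1) → E d → E d, IsGrowthFamily A φ → ∀ x ∈ cube d,
        0 < generatedDensity r σ φ x ∧
        |Real.log (generatedDensity r σ φ x)| ≤ C * (T + 1 : ℕ) * A ^ 2 ∧
        ∀ φ' : Fin (T + 1) → E d → E d, IsGrowthFamily A φ' → ∀ ε : ℝ, 0 ≤ ε → ε ≤ 1 →
          (∀ t z, ‖φ t z - φ' t z‖ ≤ ε * max 1 ‖z‖) →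
          Real.log (generatedDensity r σ φ x) - Real.log (generatedDensity r σ φ' x) ≤
            ε * (C * (T + 1 : ℕ) ^ 2 * A ^ 2 * (4 * A ^ 2) ^ (T + 1)) := by
  -- The ball must contain the cube (`√d`) and half of the terminal mass; for the latter `R² ≥ R ≥ 8
  -- log (2 c₀)` suffices.
  set R : ℝ := 1 + √d + 8 * |Real.log (2 * c₀)| with hR
  set a : ℝ := (2 * Real.pi * s₂ ^ 2) ^ (-(d : ℝ) / 2) with ha
  set b : ℝ := (2 * Real.pi * s₁ ^ 2) ^ (-(d : ℝ) / 2) with hb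
  set v : ℝ := (volume (Metric.closedBall (0 : E d) R)).toReal with hv
  set y : ℝ := 2 * R ^ 2 / s₁ ^ 2 with hy
  set C₁ : ℝ := |Real.log a| + y + |Real.log v| + 1 + |Real.log b| with hC₁
  set C₂ : ℝ := |Real.log b| + d / 2 * Real.log 2 + |Real.log c₀| with hC₂
  set C₃ : ℝ := 3 * (8 + 4 * s₂ ^ 2) / (2 * s₁ ^ 2) with hC₃
  have hb0 : 0 < b := by positivity
  have hR1 : 1 ≤ R := by
    have := Real.sqrt_nonneg d
    have := abs_nonneg (Real.log (2 * c₀))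
    rw [hR]; linarith
  have hRc : 2 * c₀ ≤ Real.exp (R ^ 2 / 8) := by
    rw [← Real.exp_log (by positivity : 0 < 2 * c₀), Real.exp_le_exp]
    have h1 := le_abs_self (Real.log (2 * c₀))
    have h2 : 8 * |Real.log (2 * c₀)| ≤ R := by
      have := Real.sqrt_nonneg d
      rw [hR]; linarith
    nlinarith
  have hRd : √d ≤ R := by
    have := abs_nonneg (Real.log (2 * c₀))
    rw [hR]; linarith
  have hvtop : volume (Metric.closedBall (0 : E d) R) ≠ ∞ := measure_closedBall_lt_top.ne
  have hv0 : 0 < v := ENNReal.toReal_pos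
    (Metric.measure_closedBall_pos volume _ (by linarith)).ne' hvtop
  have hy0 : 0 ≤ y := by positivity
  have hl2 : 0 ≤ Real.log 2 := Real.log_nonneg one_le_two
  have hC₁1 : 1 ≤ C₁ := by
    have := abs_nonneg (Real.log a); have := abs_nonneg (Real.log v)
    have := abs_nonneg (Real.log b)
    rw [hC₁]; linarith
  have hC₂0 : 0 ≤ C₂ := by positivity
  have hC₃0 : 0 ≤ C₃ := by positivity
  have hmax : C₁ ≤ max C₁ (C₃ * (2 + C₁ + C₂)) := le_max_left _ _
  refine ⟨max C₁ (C₃ * (2 + C₁ + C₂)), hC₁1.trans hmax, ?_⟩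
  intro T r hr σ hσ hσ₂ A hA φ hφ x hx
  have hs₂ : 0 < s₂ := hs₁.trans_le ((hσ 0).trans (hσ₂ 0))
  have ha0 : 0 < a := by positivity
  have hA2 : 1 ≤ A ^ 2 := one_le_pow₀ hA
  have hT1 : (1 : ℝ) ≤ (T + 1 : ℕ) := by push_cast; linarith [T.cast_nonneg (α := ℝ)]
  obtain ⟨hpos, hlog⟩ := abs_log_generatedDensity_le hr hφ hs₁ hσ hσ₂ hR1 hRc hRd hA hx ha hb
    (ENNReal.ofReal_toReal hvtop) hv0
  rw [← hy, ← hC₁] at hlog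
  refine ⟨hpos, hlog.trans (by gcongr), ?_⟩
  intro φ' hφ' ε hε hε1 hgap
  set Y := b * ((2 ^ ((d : ℝ) / 2)) ^ T * c₀) with hY
  have hY0 : 0 < Y := by positivity
  have hYlog : Real.log Y ≤ C₂ * (T + 1 : ℕ) := by
    rw [hY, Real.log_mul hb0.ne' (by positivity), Real.log_mul (by positivity) hc₀.ne',
      Real.log_pow, Real.log_rpow two_pos]
    have h1 := le_abs_self (Real.log b)
    have h2 := le_abs_self (Real.log c₀)
    have h3 : 0 ≤ (d : ℝ) / 2 * Real.log 2 := by positivity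
    have hT : (0 : ℝ) ≤ T := Nat.cast_nonneg _
    have h4 := mul_nonneg (add_nonneg (abs_nonneg (Real.log b)) (abs_nonneg (Real.log c₀))) hT
    rw [hC₂]; push_cast
    nlinarith
  have h := log_generatedDensity_sub_le hr hA hφ hφ' hs₁ hσ hσ₂ hε hε1 hgap hY0 le_rfl hpos
  have hq : 0 ≤ (4 * A ^ 2) ^ (T + 1) := by positivity
  have hη : ε / (2 * s₁ ^ 2) * (3 * (T + 1 : ℕ) * (4 * A ^ 2) ^ (T + 1) * (8 + 4 * s₂ ^ 2)) =
      ε * (C₃ * (T + 1 : ℕ) * (4 * A ^ 2) ^ (T + 1)) := by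
    rw [hC₃]; ring
  rw [hη] at h
  generalize (4 * A ^ 2) ^ (T + 1) = q at h hq ⊢
  -- The entropy gap is of order `T A²`: `log Y` is linear in `T`, and the lower bound on the
  -- density controls the rest.
  have hfac : 2 + (Real.log Y - Real.log (generatedDensity r σ φ x)) ≤
      (2 + C₁ + C₂) * ((T + 1 : ℕ) * A ^ 2) := by
    have h1 := (abs_le.mp hlog).1
    have h2 : 1 ≤ ((T + 1 : ℕ) : ℝ) * A ^ 2 := one_le_mul_of_one_le_of_one_le hT1 hA2
    have h3 : C₂ * (T + 1 : ℕ) ≤ C₂ * ((T + 1 : ℕ) * A ^ 2) := by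
      gcongr; exact le_mul_of_one_le_right (by positivity) hA2
    linarith
  have h5 := mul_le_mul_of_nonneg_left hfac
    (by positivity : 0 ≤ ε * (C₃ * (T + 1 : ℕ) * q))
  have h6 : ε * (C₃ * (2 + C₁ + C₂) * (T + 1 : ℕ) ^ 2 * A ^ 2 * q) ≤
      ε * (max C₁ (C₃ * (2 + C₁ + C₂)) * (T + 1 : ℕ) ^ 2 * A ^ 2 * q) := by
    gcongr
    exact le_max_right _ _
  have h7 : ε * (C₃ * (T + 1 : ℕ) * q) *
      ((2 + C₁ + C₂) * ((T + 1 : ℕ) * A ^ 2)) =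
      ε * (C₃ * (2 + C₁ + C₂) * (T + 1 : ℕ) ^ 2 * A ^ 2 * q) := by ring
  linarith

/-- A bound for the exponential moments of the terminal densities. -/
def expMomentBound (d : ℕ) : ℝ := Real.exp ((d : ℝ) / 4) * 2 ^ ((d : ℝ) / 2)

theorem expMomentBound_pos (d : ℕ) : 0 < expMomentBound d := by
  unfold expMomentBound; positivity

/-- `‖z‖² / 8 ≤ ‖z - μ‖² / 4 + d / 4`, and for `s ≤ 1` this is at most the tilt with a known
integral. This dictates the factor `1 / 8` for terminal densities. -/
theorem lintegral_gaussianDensity_mul_exp_le {μ : E d} {s : ℝ} (hs : 0 < s) (hs1 : s ≤ 1)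
    (hμ : ‖μ‖ ≤ √d) :
    ∫⁻ z, ENNReal.ofReal (gaussianDensity μ s z * Real.exp (‖z‖ ^ 2 / 8)) ≤
      ENNReal.ofReal (expMomentBound d) := by
  rw [expMomentBound, ENNReal.ofReal_mul (Real.exp_pos _).le,
    ← lintegral_tilted_gaussianDensity μ hs, ← lintegral_const_mul' _ _ ENNReal.ofReal_ne_top]
  refine lintegral_mono fun z => ?_
  rw [← ENNReal.ofReal_mul (Real.exp_pos _).le, mul_left_comm, ← Real.exp_add]
  refine ENNReal.ofReal_le_ofReal (mul_le_mul_of_nonneg_left (Real.exp_le_exp.mpr ?_)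
    (gaussianDensity_nonneg _ _ _))
  have h1 : ‖z‖ ≤ ‖z - μ‖ + √d := by
    have := norm_le_norm_add_norm_sub μ z
    rw [norm_sub_rev] at this
    rw [norm_sub_rev]
    linarith [norm_sub_rev μ z]
  have h2 : ‖z‖ ^ 2 ≤ 2 * ‖z - μ‖ ^ 2 + 2 * d := by
    have h3 : ‖z‖ ^ 2 ≤ (‖z - μ‖ + √d) ^ 2 := by gcongr
    nlinarith [sq_nonneg (‖z - μ‖ - √d), Real.sq_sqrt (Nat.cast_nonneg d : (0 : ℝ) ≤ d)]
  have h4 : ‖z - μ‖ ^ 2 / 4 ≤ ‖z - μ‖ ^ 2 / (4 * s ^ 2) := by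
    gcongr
    have : s ^ 2 ≤ 1 := pow_le_one₀ hs.le hs1
    linarith
  linarith

theorem isTerminalDensity_gaussianDensity (d : ℕ) :
    IsTerminalDensity (expMomentBound d) (gaussianDensity (0 : E d) 1) where
  measurable := Measurable.comp (g := fun p : E d × E d => gaussianDensity p.1 1 p.2)
    (f := fun x : E d => (0, x)) (measurable_gaussianDensity 1) measurable_prodMk_left
  nonneg := gaussianDensity_nonneg _ _
  lintegral_eq_one := lintegral_gaussianDensity _ one_pos
  expMoment := lintegral_gaussianDensity_mul_exp_le one_pos le_rfl (by simp)

/-! ### The target density and the forward marginal. -/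

section Target

variable {k : ℕ} {C : ℝ} {q₀ : E d → ℝ}

theorem measurableSet_cube : MeasurableSet (cube d) := by
  have : cube d = ⋂ i, {x : E d | x i ∈ Set.Icc (-1 : ℝ) 1} := by ext; simp [cube]
  rw [this]
  refine MeasurableSet.iInter fun i => ?_
  have hm : Measurable fun x : E d => x i := by fun_prop
  exact hm measurableSet_Icc

namespace IsTargetDensity

theorem nonneg (h : IsTargetDensity k C q₀) (x : E d) : 0 ≤ q₀ x := by
  by_cases hx : x ∈ cube d
  · exact (inv_nonneg.mpr (zero_le_one.trans h.one_le)).trans (h.lower x hx)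
  · rw [h.support x hx]

theorem pos (h : IsTargetDensity k C q₀) {x : E d} (hx : x ∈ cube d) : 0 < q₀ x :=
  (inv_pos.mpr (zero_lt_one.trans_le h.one_le)).trans_le (h.lower x hx)

theorem measurable (h : IsTargetDensity k C q₀) : Measurable q₀ := by
  classical
  have hi : q₀ = (cube d).indicator q₀ := by
    ext x
    by_cases hx : x ∈ cube d
    · simp [hx]
    · simp [hx, h.support x hx]
  rw [hi]
  have hc : ContinuousOn q₀ (cube d) := h.smooth.continuousOn
  refine measurable_of_restrict_of_restrict_compl (measurableSet_cube (d := d)) ?_ ?_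
  · have e : (cube d).domRestrict ((cube d).indicator q₀) = (cube d).domRestrict q₀ := by
      ext x; simp [Set.domRestrict_apply]
    rw [e]
    exact hc.domRestrict.measurable
  · have e : ((cube d)ᶜ).domRestrict ((cube d).indicator q₀) = fun _ => 0 := by
      ext x
      exact Set.indicator_of_notMem x.2 _
    rw [e]
    exact measurable_const

theorem integrable (h : IsTargetDensity k C q₀) : Integrable q₀ :=
  integrable_of_integral_eq_one h.integral_eq_one

theorem lintegral_eq_one (h : IsTargetDensity k C q₀) : ∫⁻ x, ENNReal.ofReal (q₀ x) = 1 := by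
  rw [← ofReal_integral_eq_lintegral_ofReal h.integrable (ae_of_all _ h.nonneg),
    h.integral_eq_one, ENNReal.ofReal_one]

theorem isProbabilityMeasure (h : IsTargetDensity k C q₀) :
    IsProbabilityMeasure (densityMeasure q₀) := ⟨by
  rw [densityMeasure, withDensity_apply _ MeasurableSet.univ, Measure.restrict_univ,
    h.lintegral_eq_one]⟩

theorem ae_mem_cube (h : IsTargetDensity k C q₀) : ∀ᵐ x ∂densityMeasure q₀, x ∈ cube d := by
  rw [densityMeasure, ae_withDensity_iff h.measurable.ennreal_ofReal]
  refine ae_of_all _ fun x hx => ?_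
  by_contra hcon
  exact hx (by rw [h.support x hcon, ENNReal.ofReal_zero])

theorem alphaBar_mem {T : ℕ} (hT : 1 ≤ T) {β : Fin T → ℝ} (hβ : ∀ t, 0 < β t ∧ β t < 1) :
    0 < alphaBar β ∧ alphaBar β < 1 := by
  obtain ⟨T, rfl⟩ := Nat.exists_eq_add_of_le' hT
  refine ⟨Finset.prod_pos fun t _ => by linarith [(hβ t).2], ?_⟩
  rw [alphaBar, Fin.prod_univ_succ]
  have h1 : ∏ t : Fin T, (1 - β t.succ) ≤ 1 :=
    Finset.prod_le_one (fun t _ => by linarith [(hβ t.succ).2])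
      fun t _ => by linarith [(hβ t.succ).1]
  have h2 := hβ 0
  nlinarith

theorem lintegral_forwardMarginal_mul {T : ℕ} (h : IsTargetDensity k C q₀) (β : Fin T → ℝ)
    {w : E d → ℝ} (hw : Measurable w) (hw0 : ∀ z, 0 ≤ w z) :
    ∫⁻ z, ENNReal.ofReal (forwardMarginal q₀ β z * w z) =
      ∫⁻ x, ENNReal.ofReal (q₀ x) * ∫⁻ z, ENNReal.ofReal
        (gaussianDensity (√(alphaBar β) • x) (√(1 - alphaBar β)) z * w z) := by
  have hg : Measurable fun p : E d × E d =>
      gaussianDensity (√(alphaBar β) • p.1) (√(1 - alphaBar β)) p.2 :=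
    Measurable.comp (g := fun p : E d × E d => gaussianDensity p.1 (√(1 - alphaBar β)) p.2)
      (f := fun p : E d × E d => (√(alphaBar β) • p.1, p.2)) (measurable_gaussianDensity _)
      (by fun_prop)
  have hgw : Measurable fun p : E d × E d => ENNReal.ofReal (q₀ p.1) * ENNReal.ofReal
      (gaussianDensity (√(alphaBar β) • p.1) (√(1 - alphaBar β)) p.2 * w p.2) :=
    (h.measurable.comp measurable_fst).ennreal_ofReal.mul
      (hg.mul (hw.comp measurable_snd)).ennreal_ofReal
  have h1 : ∀ z, ENNReal.ofReal (forwardMarginal q₀ β z * w z) =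
      ∫⁻ x, ENNReal.ofReal (q₀ x) * ENNReal.ofReal
        (gaussianDensity (√(alphaBar β) • x) (√(1 - alphaBar β)) z * w z) := by
    intro z
    have hi : Integrable fun x =>
        q₀ x * gaussianDensity (√(alphaBar β) • x) (√(1 - alphaBar β)) z :=
      h.integrable.mul_bdd
        (c := (2 * Real.pi * √(1 - alphaBar β) ^ 2) ^ (-(d : ℝ) / 2))
        (hg.comp measurable_prodMk_right).aestronglyMeasurable
        (ae_of_all _ fun x => by
          rw [Real.norm_of_nonneg (gaussianDensity_nonneg _ _ _)]
          exact gaussianDensity_le _ _ _)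
    rw [forwardMarginal, ← integral_mul_const, ofReal_integral_eq_lintegral_ofReal
      (hi.mul_const _) (ae_of_all _ fun x => mul_nonneg (mul_nonneg (h.nonneg x)
        (gaussianDensity_nonneg _ _ _)) (hw0 z))]
    refine lintegral_congr fun x => ?_
    rw [mul_assoc, ENNReal.ofReal_mul (h.nonneg x)]
  simp_rw [h1]
  rw [lintegral_lintegral_swap (by exact (hgw.comp measurable_swap).aemeasurable)]
  exact lintegral_congr fun x => lintegral_const_mul' _ _ ENNReal.ofReal_ne_top

/-- The forward marginal is a mixture of Gaussians with means of norm at most `√d` and variance in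
`(0, 1]`, so the Gaussian moment bound averages, uniformly in the schedule. -/
theorem isTerminalDensity_forwardMarginal {T : ℕ} (h : IsTargetDensity k C q₀) (hT : 1 ≤ T)
    {β : Fin T → ℝ} (hβ : ∀ t, 0 < β t ∧ β t < 1) :
    IsTerminalDensity (expMomentBound d) (forwardMarginal q₀ β) := by
  obtain ⟨ha0, ha1⟩ := alphaBar_mem hT hβ
  have hs : 0 < √(1 - alphaBar β) := Real.sqrt_pos.mpr (by linarith)
  have hs1 : √(1 - alphaBar β) ≤ 1 := Real.sqrt_le_one.mpr (by linarith)
  have hg : Measurable fun p : E d × E d =>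
      q₀ p.2 * gaussianDensity (√(alphaBar β) • p.2) (√(1 - alphaBar β)) p.1 :=
    (h.measurable.comp measurable_snd).mul
      (Measurable.comp (g := fun p : E d × E d => gaussianDensity p.1 (√(1 - alphaBar β)) p.2)
        (f := fun p : E d × E d => (√(alphaBar β) • p.2, p.1)) (measurable_gaussianDensity _)
        (by fun_prop))
  refine ⟨hg.stronglyMeasurable.integral_prod_right'.measurable, fun z =>
    integral_nonneg fun x => mul_nonneg (h.nonneg x) (gaussianDensity_nonneg _ _ _), ?_, ?_⟩
  · have h1 := h.lintegral_forwardMarginal_mul β (w := fun _ => 1) measurable_const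
      fun _ => zero_le_one
    simp_rw [mul_one, lintegral_gaussianDensity _ hs, mul_one, h.lintegral_eq_one] at h1
    exact h1
  · rw [h.lintegral_forwardMarginal_mul β (w := fun z => Real.exp (‖z‖ ^ 2 / 8))
      (Real.measurable_exp.comp ((measurable_norm.pow_const 2).div_const _))
      fun z => (Real.exp_pos _).le]
    have h1 : ∀ x, ENNReal.ofReal (q₀ x) * ∫⁻ z, ENNReal.ofReal
        (gaussianDensity (√(alphaBar β) • x) (√(1 - alphaBar β)) z * Real.exp (‖z‖ ^ 2 / 8)) ≤
        ENNReal.ofReal (q₀ x) * ENNReal.ofReal (expMomentBound d) := by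
      intro x
      by_cases hx : x ∈ cube d
      · refine mul_le_mul_right (lintegral_gaussianDensity_mul_exp_le hs hs1 ?_) _
        rw [norm_smul, Real.norm_of_nonneg (Real.sqrt_nonneg _)]
        exact (mul_le_of_le_one_left (norm_nonneg _) (Real.sqrt_le_one.mpr ha1.le)).trans
          (norm_le_of_mem_cube hx)
      · simp [h.support x hx]
    refine (lintegral_mono h1).trans (le_of_eq ?_)
    rw [lintegral_mul_const' _ _ ENNReal.ofReal_ne_top, h.lintegral_eq_one, one_mul]

end IsTargetDensity

end Target

/-! ### Nets of network families. -/

section Networks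

variable {α : ℝ} {W L T : ℕ} {M : ℝ}

theorem norm_toLp_le (v : Fin d → ℝ) : ‖(WithLp.toLp 2 v : E d)‖ ≤ √d * ‖v‖ := by
  rw [EuclideanSpace.norm_eq]
  refine Real.sqrt_le_iff.mpr ⟨by positivity, ?_⟩
  rw [mul_pow, Real.sq_sqrt (Nat.cast_nonneg d)]
  calc ∑ i, ‖v i‖ ^ 2 ≤ ∑ _i : Fin d, ‖v‖ ^ 2 :=
        Finset.sum_le_sum fun i _ => by gcongr; exact norm_le_pi_norm v i
    _ = d * ‖v‖ ^ 2 := by simp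

theorem norm_ofLp_le (z : E d) : ‖WithLp.ofLp z‖ ≤ ‖z‖ :=
  (pi_norm_le_iff_of_nonneg (norm_nonneg z)).mpr fun i => PiLp.norm_apply_le z i

theorem norm_le_of_mem_networkClass {f : E d → E d} (hf : f ∈ networkClass α d W L M) (z : E d) :
    ‖f z‖ ≤ √d * max 1 |α| ^ L * M * max 1 ‖z‖ := by
  obtain ⟨N, -, hM, hf⟩ := hf
  rw [hf]
  refine (norm_toLp_le _).trans ?_
  have h1 := N.norm_realize_le α (WithLp.ofLp z)
  have h2 : max 1 ‖WithLp.ofLp z‖ ≤ max 1 ‖z‖ := max_le_max_left 1 (norm_ofLp_le z)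
  have h3 : N.paramNorm * max 1 |α| ^ L * max 1 ‖WithLp.ofLp z‖ ≤
      M * max 1 |α| ^ L * max 1 ‖z‖ := by
    gcongr
    exact mul_nonneg (N.paramNorm_nonneg.trans hM) (by positivity)
  calc √d * ‖N.realize α (WithLp.ofLp z)‖ ≤ √d * (M * max 1 |α| ^ L * max 1 ‖z‖) := by
        gcongr; exact h1.trans h3
    _ = _ := by ring

theorem measurable_of_mem_networkClass {f : E d → E d} (hf : f ∈ networkClass α d W L M) :
    Measurable f := by
  obtain ⟨N, -, -, hf⟩ := hf
  have hc : Continuous (N.realize α) := by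
    refine (LipschitzWith.of_dist_le' (K := N.paramNorm * max 1 |α| ^ L) fun z z' => ?_).continuous
    rw [dist_eq_norm, dist_eq_norm]
    exact N.norm_realize_sub_le α z z'
  have : f = fun z => WithLp.toLp 2 (N.realize α (WithLp.ofLp z)) := funext hf
  rw [this]
  have h2 : Continuous fun z : E d => (WithLp.toLp 2 (N.realize α (WithLp.ofLp z)) : E d) := by
    fun_prop
  exact h2.measurable

theorem isGrowthFamily_of_mem {φ : Fin T → E d → E d}
    (hφ : φ ∈ networkFamilies α d W L M T) : IsGrowthFamily (√d * max 1 |α| ^ L * M) φ :=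
  ⟨fun t => measurable_of_mem_networkClass (hφ t), fun t => norm_le_of_mem_networkClass (hφ t)⟩

/-- A net consisting of arbitrary points gives a net consisting of points of the set. -/
theorem exists_internal_net {A : Type*} (P : Set A) (F : Finset A) (r : A → A → Prop)
    (h : ∀ a ∈ P, ∃ g ∈ F, r a g) :
    ∃ F' : Finset P, F'.card ≤ F.card ∧ ∀ a : P, ∃ b ∈ F', ∃ g, r a g ∧ r b g := by
  classical
  choose! c hcF hc using h
  refine ⟨(F.filter fun g => ∃ a : P, r a g).attach.image fun g =>
    (Finset.mem_filter.mp g.2).2.choose, ?_, fun a => ?_⟩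
  · refine Finset.card_image_le.trans ?_
    rw [Finset.card_attach]
    exact Finset.card_filter_le _ _
  · have hg : c a ∈ F.filter fun g => ∃ a : P, r a g :=
      Finset.mem_filter.mpr ⟨hcF a a.2, a, hc a a.2⟩
    exact ⟨_, Finset.mem_image_of_mem _ (Finset.mem_attach _ ⟨c a, hg⟩), c a, hc a a.2,
      (Finset.mem_filter.mp hg).2.choose_spec⟩

/-- A product over the time steps of nets of single networks. The net is made internal, at the cost
of a factor `2`, because the modulus of continuity requires measurability and linear growth of both
families. -/
theorem exists_net_networkFamilies (α : ℝ) {d W D : ℕ} (hd : d ≤ D) (hW : W ≤ D) (hM : 0 < M)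
    (L T j : ℕ) :
    ∃ F : Finset (networkFamilies α d W L M T),
      (F.card : ℝ) ≤ Real.exp (2 * (L + 1) * T * (D + 1) ^ 2 * (j + 1)) ∧
      ∀ φ : networkFamilies α d W L M T, ∃ ψ ∈ F, ∀ t z,
        ‖φ.1 t z - ψ.1 t z‖ ≤ 2 * √d * (M * (4 * max 1 |α|) ^ L / 2 ^ j) * max 1 ‖z‖ := by
  classical
  obtain ⟨F₀, hF₀, hF₀c⟩ := exists_cover_scaledClass α hd hW hM j L d hd
  let lift : ((Fin d → ℝ) → Fin d → ℝ) → E d → E d := fun g z => WithLp.toLp 2 (g (WithLp.ofLp z))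
  let r : (Fin T → E d → E d) → (Fin T → E d → E d) → Prop := fun φ g => ∀ t z,
    ‖φ t z - g t z‖ ≤ √d * (M * (4 * max 1 |α|) ^ L / 2 ^ j) * max 1 ‖z‖
  have hcov : ∀ φ ∈ networkFamilies α d W L M T,
      ∃ g ∈ Fintype.piFinset fun _ : Fin T => F₀.image lift, r φ g := by
    intro φ hφ
    have hone : ∀ t, ∃ g ∈ F₀.image lift, ∀ z,
        ‖φ t z - g z‖ ≤ √d * (M * (4 * max 1 |α|) ^ L / 2 ^ j) * max 1 ‖z‖ := by
      intro t
      obtain ⟨N, hNW, hNM, hN⟩ := hφ t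
      obtain ⟨g, hg, hfg⟩ := hF₀c (N.realize α) ⟨N, 1, le_rfl, hNW, by rwa [mul_one],
        fun z => by rw [one_smul]⟩
      refine ⟨lift g, Finset.mem_image_of_mem _ hg, fun z => ?_⟩
      rw [hN, ← WithLp.toLp_sub]
      refine (norm_toLp_le _).trans ?_
      rw [mul_assoc]
      refine mul_le_mul_of_nonneg_left ((hfg _).trans ?_) (Real.sqrt_nonneg _)
      gcongr
      exact norm_ofLp_le z
    choose g hg hgc using hone
    exact ⟨g, Fintype.mem_piFinset.mpr hg, hgc⟩
  obtain ⟨F, hF, hFc⟩ := exists_internal_net _ _ r hcov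
  refine ⟨F, ?_, fun φ => ?_⟩
  · have h1 : (Fintype.piFinset fun _ : Fin T => F₀.image lift).card ≤ F₀.card ^ T := by
      rw [Fintype.card_piFinset_const]
      exact Nat.pow_le_pow_left Finset.card_image_le _
    calc (F.card : ℝ) ≤ (F₀.card : ℝ) ^ T := by exact_mod_cast hF.trans h1
      _ ≤ Real.exp (2 * (L + 1) * (D + 1) ^ 2 * (j + 1)) ^ T := by gcongr
      _ = _ := by rw [← Real.exp_nat_mul]; ring_nf
  · obtain ⟨ψ, hψ, g, hφg, hψg⟩ := hFc φ
    refine ⟨ψ, hψ, fun t z => ?_⟩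
    have h1 := hφg t z
    have h2 := hψg t z
    rw [norm_sub_rev] at h2
    have h3 := norm_sub_le_norm_sub_add_norm_sub (φ.1 t z) (g t z) (ψ.1 t z)
    linarith

end Networks

/-! ### Divergences as differences of log-likelihoods. -/

section Divergence

variable {k : ℕ} {C B : ℝ} {q₀ p : E d → ℝ}

/-- Both logarithms are bounded on the cube, which carries `q₀`, so the log-likelihood ratio is
integrable and its integral splits. -/
theorem IsTargetDensity.klDiv_densityMeasure (hq : IsTargetDensity k C q₀) (hp : Measurable p)
    (hp1 : ∫⁻ x, ENNReal.ofReal (p x) = 1) (hppos : ∀ x ∈ cube d, 0 < p x)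
    (hpB : ∀ x ∈ cube d, |Real.log (p x)| ≤ B) :
    klDiv (densityMeasure q₀) (densityMeasure p) ≠ ∞ ∧
      (klDiv (densityMeasure q₀) (densityMeasure p)).toReal =
        ∫ x, Real.log (q₀ x) ∂densityMeasure q₀ - ∫ x, Real.log (p x) ∂densityMeasure q₀ := by
  have := hq.isProbabilityMeasure
  have hpm : IsProbabilityMeasure (densityMeasure p) := ⟨by
    rw [densityMeasure, withDensity_apply _ MeasurableSet.univ, Measure.restrict_univ, hp1]⟩
  set f : E d → ℝ≥0∞ := fun x => ENNReal.ofReal (q₀ x) / ENNReal.ofReal (p x) with hf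
  have hfm : Measurable f := hq.measurable.ennreal_ofReal.div hp.ennreal_ofReal
  have hqf : densityMeasure q₀ = (densityMeasure p).withDensity f := by
    rw [densityMeasure, densityMeasure, ← withDensity_mul _ hp.ennreal_ofReal hfm]
    congr 1
    ext x
    rw [Pi.mul_apply, hf]
    by_cases hx : x ∈ cube d
    · exact (ENNReal.mul_div_cancel (by simpa using hppos x hx) ENNReal.ofReal_ne_top).symm
    · simp [hq.support x hx]
  have hac : densityMeasure q₀ ≪ densityMeasure p := by
    rw [hqf]; exact withDensity_absolutelyContinuous _ _
  have hllr : llr (densityMeasure q₀) (densityMeasure p) =ᵐ[densityMeasure q₀]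
      fun x => Real.log (q₀ x) - Real.log (p x) := by
    have h1 : (densityMeasure q₀).rnDeriv (densityMeasure p) =ᵐ[densityMeasure p] f := by
      conv_lhs => rw [hqf]
      exact Measure.rnDeriv_withDensity _ hfm
    filter_upwards [hac.ae_le h1, hq.ae_mem_cube] with x hx hxc
    rw [llr, hx, hf, ENNReal.toReal_div, ENNReal.toReal_ofReal (hq.nonneg x),
      ENNReal.toReal_ofReal (hppos x hxc).le,
      Real.log_div (hq.pos hxc).ne' (hppos x hxc).ne']
  have hC : 0 < C := zero_lt_one.trans_le hq.one_le
  have hi1 : Integrable (fun x => Real.log (q₀ x)) (densityMeasure q₀) := by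
    refine Integrable.of_bound hq.measurable.log.aestronglyMeasurable (Real.log C) ?_
    filter_upwards [hq.ae_mem_cube] with x hx
    rw [Real.norm_eq_abs, abs_le, ← Real.log_inv]
    exact ⟨Real.log_le_log (inv_pos.mpr hC) (hq.lower x hx),
      Real.log_le_log (hq.pos hx) (hq.upper x hx)⟩
  have hi2 : Integrable (fun x => Real.log (p x)) (densityMeasure q₀) := by
    refine Integrable.of_bound hp.log.aestronglyMeasurable B ?_
    filter_upwards [hq.ae_mem_cube] with x hx using hpB x hx
  refine ⟨klDiv_ne_top hac ((hi1.sub hi2).congr hllr.symm), ?_⟩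
  rw [toReal_klDiv_of_measure_eq hac (by rw [measure_univ, measure_univ]), integral_congr_ae hllr,
    integral_sub hi1 hi2]

end Divergence

/-! ### Entropy of the log-likelihoods and the final rate. -/

/-- The modulus of continuity is exponential in `T`, but only its logarithm enters the entropy: `i`
is the number of dyadic scales that absorb it. The choice `⌈2 y⌉₊` works since `log 2 ≥ 1 / 2`. -/
theorem exists_dyadic_exponent {a q ℓ : ℝ} (hq : 0 ≤ q) (hℓ : 0 ≤ ℓ) (ha : 1 ≤ a)
    (T : ℕ) (hT : 1 ≤ T) {M : ℝ} (hM : Real.log M = ℓ) (hM0 : 0 < M) :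
    ∃ i : ℕ, q * M * T * (a * M ^ 2) ^ T ≤ 2 ^ i ∧
      (i : ℝ) + 1 ≤ 2 * T * (q + Real.log a + 3 * ℓ + 2) := by
  have hT1 : (1 : ℝ) ≤ T := by exact_mod_cast hT
  have hl2 : (1 : ℝ) / 2 ≤ Real.log 2 := by linarith [Real.log_two_gt_d9]
  have hla : 0 ≤ Real.log a := Real.log_nonneg ha
  set y : ℝ := q + ℓ + T + T * (Real.log a + 2 * ℓ) with hy
  have hy0 : 0 ≤ y := by positivity
  have h1 : q * M * T * (a * M ^ 2) ^ T ≤ Real.exp y := by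
    have hqe : q ≤ Real.exp q := by linarith [Real.add_one_le_exp q]
    have hTe : (T : ℝ) ≤ Real.exp T := by linarith [Real.add_one_le_exp (T : ℝ)]
    have hMe : M = Real.exp ℓ := by rw [← hM, Real.exp_log hM0]
    have hae : (a * M ^ 2) ^ T = Real.exp (T * (Real.log a + 2 * ℓ)) := by
      have ha0 : 0 < a := by linarith
      rw [← hM, ← Real.exp_log (show 0 < (a * M ^ 2) ^ T by positivity), Real.log_pow,
        Real.log_mul ha0.ne' (by positivity), Real.log_pow]
      push_cast; rfl
    rw [hae, hy, Real.exp_add, Real.exp_add, Real.exp_add, ← hMe]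
    gcongr
  refine ⟨⌈2 * y⌉₊, h1.trans ?_, ?_⟩
  · have h2 : y ≤ ⌈2 * y⌉₊ * Real.log 2 := by
      have := Nat.le_ceil (2 * y)
      nlinarith
    calc Real.exp y ≤ Real.exp (⌈2 * y⌉₊ * Real.log 2) := Real.exp_le_exp.mpr h2
      _ = 2 ^ ⌈2 * y⌉₊ := by rw [Real.exp_nat_mul, Real.exp_log two_pos]
  · have h2 := Nat.ceil_lt_add_one (by positivity : 0 ≤ 2 * y)
    have h3 : 2 * y + 2 ≤ 2 * T * (q + Real.log a + 3 * ℓ + 2) := by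
      rw [hy]
      nlinarith [mul_le_mul_of_nonneg_left hT1 hq, mul_le_mul_of_nonneg_left hT1 hℓ]
    linarith

/-- Nets of the log-likelihoods, with bounded entropy. -/
theorem exists_net_logLik {α : ℝ} {d W D L T : ℕ} {M C q a₀ H : ℝ} (hdD : d ≤ D)
    (hW : W ≤ D) (hM : 0 < M) (ha₀ : a₀ = √d * max 1 |α| ^ L)
    (hq : q = 2 * √d * (4 * max 1 |α|) ^ L) {i : ℕ}
    (hi : q * M * (T + 1 : ℕ) * (4 * a₀ ^ 2 * M ^ 2) ^ (T + 1) ≤ 2 ^ i)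
    (hH : 2 * (L + 1) * (T + 1 : ℕ) * (D + 1) ^ 2 * ((i : ℝ) + 1) ≤ H)
    (hA : 1 ≤ a₀ * M) (hC : 1 ≤ C) {r : E d → ℝ} {σ : Fin (T + 1) → ℝ}
    (hmod : ∀ φ : Fin (T + 1) → E d → E d, IsGrowthFamily (a₀ * M) φ → ∀ x ∈ cube d,
      ∀ φ' : Fin (T + 1) → E d → E d, IsGrowthFamily (a₀ * M) φ' → ∀ ε : ℝ, 0 ≤ ε → ε ≤ 1 →
        (∀ t z, ‖φ t z - φ' t z‖ ≤ ε * max 1 ‖z‖) →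
        Real.log (generatedDensity r σ φ x) - Real.log (generatedDensity r σ φ' x) ≤
          ε * (C * (T + 1 : ℕ) ^ 2 * (a₀ * M) ^ 2 * (4 * (a₀ * M) ^ 2) ^ (T + 1))) (j : ℕ) :
    ∃ F : Finset (networkFamilies α d W L M (T + 1)),
      (F.card : ℝ) ≤ Real.exp (H * (j + 1)) ∧
      ∀ φ : networkFamilies α d W L M (T + 1), ∃ ψ ∈ F, ∀ x ∈ cube d,
        |Real.log (generatedDensity r σ φ.1 x) - Real.log (generatedDensity r σ ψ.1 x)| ≤
          C * (T + 1 : ℕ) * (a₀ * M) ^ 2 / 2 ^ j := by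
  -- The shift by `i` compensates for the modulus; by `j + i + 1 ≤ (i + 1) (j + 1)` it only
  -- multiplies the entropy by `i + 1`.
  obtain ⟨F, hF, hFc⟩ := exists_net_networkFamilies α hdD hW hM L (T + 1) (j + i)
  refine ⟨F, hF.trans (Real.exp_le_exp.mpr ?_), fun φ => ?_⟩
  · have h1 : ((j + i : ℕ) : ℝ) + 1 ≤ (i + 1) * (j + 1) := by
      push_cast
      nlinarith [mul_nonneg (Nat.cast_nonneg i : (0 : ℝ) ≤ i) (Nat.cast_nonneg j : (0 : ℝ) ≤ j)]
    calc 2 * ((L : ℝ) + 1) * (T + 1 : ℕ) * (D + 1) ^ 2 * ((j + i : ℕ) + 1)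
        ≤ 2 * ((L : ℝ) + 1) * (T + 1 : ℕ) * (D + 1) ^ 2 * ((i + 1) * (j + 1)) := by gcongr
      _ = 2 * ((L : ℝ) + 1) * (T + 1 : ℕ) * (D + 1) ^ 2 * (i + 1) * (j + 1) := by ring
      _ ≤ H * (j + 1) := by gcongr
  · obtain ⟨ψ, hψ, hgap⟩ := hFc φ
    refine ⟨ψ, hψ, fun x hx => ?_⟩
    set ε : ℝ := 2 * √d * (M * (4 * max 1 |α|) ^ L / 2 ^ (j + i)) with hε
    have hε0 : 0 ≤ ε := by positivity
    have hT1 : (1 : ℝ) ≤ (T + 1 : ℕ) := by push_cast; linarith [T.cast_nonneg (α := ℝ)]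
    have hpow : (4 * (a₀ * M) ^ 2) = 4 * a₀ ^ 2 * M ^ 2 := by ring
    set P : ℝ := (4 * a₀ ^ 2 * M ^ 2) ^ (T + 1) with hP
    have hP1 : 1 ≤ P := by
      refine one_le_pow₀ ?_
      rw [← hpow]; nlinarith
    have hεP : ε * ((T + 1 : ℕ) * P) ≤ 1 / 2 ^ j := by
      have e : ε * ((T + 1 : ℕ) * P) = q * M * (T + 1 : ℕ) * P / 2 ^ i / 2 ^ j := by
        rw [hε, hq, pow_add]; field_simp
      rw [e]
      gcongr
      rwa [div_le_one (by positivity)]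
    have hε1 : ε ≤ 1 := by
      have h1 : ε ≤ ε * ((T + 1 : ℕ) * P) :=
        le_mul_of_one_le_right hε0 (one_le_mul_of_one_le_of_one_le hT1 hP1)
      have h2 : 1 / (2 : ℝ) ^ j ≤ 1 := by
        rw [div_le_one (by positivity)]; exact one_le_pow₀ one_le_two
      linarith
    have hfin : ε * (C * (T + 1 : ℕ) ^ 2 * (a₀ * M) ^ 2 * (4 * (a₀ * M) ^ 2) ^ (T + 1)) ≤
        C * (T + 1 : ℕ) * (a₀ * M) ^ 2 / 2 ^ j := by
      rw [hpow, ← hP]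
      calc ε * (C * (T + 1 : ℕ) ^ 2 * (a₀ * M) ^ 2 * P)
          = C * (T + 1 : ℕ) * (a₀ * M) ^ 2 * (ε * ((T + 1 : ℕ) * P)) := by ring
        _ ≤ C * (T + 1 : ℕ) * (a₀ * M) ^ 2 * (1 / 2 ^ j) := by gcongr
        _ = _ := by ring
    have hg : ∀ φ : networkFamilies α d W L M (T + 1), IsGrowthFamily (a₀ * M) φ.1 := fun φ => by
      rw [ha₀]; exact isGrowthFamily_of_mem φ.2
    rw [abs_le]
    constructor
    · have := hmod ψ.1 (hg ψ) x hx φ.1 (hg φ) ε hε0 hε1 fun t z => by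
        rw [norm_sub_rev]; exact hgap t z
      linarith
    · exact (hmod φ.1 (hg φ) x hx ψ.1 (hg ψ) ε hε0 hε1 hgap).trans hfin

/-- The entropy of the network families is of order `(T n log M)²`. -/
theorem exists_entropy_bound (d : ℕ) (c : ℝ) {M₀ a₀ q : ℝ} (hM₀ : 1 < M₀) (ha₀1 : 1 ≤ a₀)
    (hq0 : 0 ≤ q) :
    ∃ K : ℝ, 1 ≤ K ∧ ∀ (T n W : ℕ) (M : ℝ), 1 ≤ T → 1 ≤ n → (W : ℝ) ≤ c * (n + 9 * d) →
      M₀ ≤ M → ∃ i : ℕ, q * M * T * (4 * a₀ ^ 2 * M ^ 2) ^ T ≤ 2 ^ i ∧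
        2 * ((7 : ℕ) + 1) * T * (((max W d : ℕ) : ℝ) + 1) ^ 2 * ((i : ℝ) + 1) ≤
          (K * T * n * Real.log M) ^ 2 ∧
        1 ≤ (K * T * n * Real.log M) ^ 2 := by
  set ℓ₀ : ℝ := Real.log M₀ with hℓ₀
  have hℓ₀0 : 0 < ℓ₀ := Real.log_pos hM₀
  have h4a : 1 ≤ 4 * a₀ ^ 2 := by nlinarith
  have hla : 0 ≤ Real.log (4 * a₀ ^ 2) := Real.log_nonneg h4a
  set C₄ : ℝ := (q + Real.log (4 * a₀ ^ 2) + 2) / ℓ₀ + 3 with hC₄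
  set C₆ : ℝ := |c| * (1 + 9 * d) + d + 1 with hC₆
  -- `C₄` absorbs additive constants into `log M ≥ ℓ₀ > 0`, and `C₆ n` bounds `D + 1`. The factor
  -- `32` is `2 · (7 + 1) · 2`; the summand `1 / ℓ₀` gives `K log M ≥ 1`, hence entropy at least
  -- `1`, as chaining requires.
  set K : ℝ := 32 * C₄ * C₆ ^ 2 / ℓ₀ + 1 + 1 / ℓ₀ with hK
  have hC₄0 : 0 ≤ C₄ := by positivity
  have hC₆0 : 0 ≤ C₆ := by positivity
  have hK1 : 1 ≤ K := by
    have : 0 ≤ 32 * C₄ * C₆ ^ 2 / ℓ₀ := by positivity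
    have : 0 ≤ 1 / ℓ₀ := by positivity
    rw [hK]; linarith
  have hKℓ : 1 / ℓ₀ ≤ K := by
    have : 0 ≤ 32 * C₄ * C₆ ^ 2 / ℓ₀ := by positivity
    rw [hK]; linarith
  have hKC : 32 * C₄ * C₆ ^ 2 / ℓ₀ ≤ K := by
    have : 0 ≤ 1 / ℓ₀ := by positivity
    rw [hK]; linarith
  refine ⟨K, hK1, fun T n W M hT hn hW hM => ?_⟩
  have hT1 : (1 : ℝ) ≤ T := by exact_mod_cast hT
  have hn1 : (1 : ℝ) ≤ n := by exact_mod_cast hn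
  have hM0 : 0 < M := by linarith
  set ℓ : ℝ := Real.log M with hℓ
  have hℓℓ : ℓ₀ ≤ ℓ := Real.log_le_log (by linarith) hM
  have hℓ0 : 0 < ℓ := hℓ₀0.trans_le hℓℓ
  obtain ⟨i, hi, hi1⟩ := exists_dyadic_exponent hq0 hℓ0.le h4a T hT rfl hM0
  have hi2 : (i : ℝ) + 1 ≤ 2 * (T : ℝ) * (C₄ * ℓ) := by
    refine hi1.trans (mul_le_mul_of_nonneg_left ?_ (by positivity))
    have h1 : q + Real.log (4 * a₀ ^ 2) + 2 ≤ (q + Real.log (4 * a₀ ^ 2) + 2) / ℓ₀ * ℓ := by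
      rw [div_mul_eq_mul_div, le_div_iff₀ hℓ₀0]
      gcongr
    rw [hC₄, add_mul]
    linarith
  set D : ℕ := max W d with hD
  have hD6 : (D : ℝ) + 1 ≤ C₆ * n := by
    have h1 : c * (n + 9 * d) ≤ |c| * (1 + 9 * d) * n := by
      have h2 : c * (n + 9 * d) ≤ |c| * (n + 9 * d) := by gcongr; exact le_abs_self c
      have h3 : (n : ℝ) + 9 * d ≤ (1 + 9 * d) * n := by
        have h4 : (d : ℝ) ≤ d * n := le_mul_of_one_le_right (by positivity) hn1
        linarith
      have h5 := mul_le_mul_of_nonneg_left h3 (abs_nonneg c)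
      linarith
    have h4 : (d : ℝ) ≤ d * n := le_mul_of_one_le_right (by positivity) hn1
    have h5 : 0 ≤ |c| * (1 + 9 * d) * n := by positivity
    have h6 : (0 : ℝ) ≤ d * n := by positivity
    rw [hC₆, hD, Nat.cast_max]
    rcases max_cases (W : ℝ) d with ⟨h, -⟩ | ⟨h, -⟩ <;> rw [h] <;> linarith
  set H : ℝ := (K * (T : ℝ) * n * ℓ) ^ 2 with hH
  have hKℓ1 : 1 ≤ K * ℓ := by
    have h1 : 1 / ℓ₀ * ℓ₀ ≤ K * ℓ := by gcongr
    rwa [one_div_mul_cancel hℓ₀0.ne'] at h1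
  have hH1 : 1 ≤ H := by
    refine one_le_pow₀ ?_
    calc (1 : ℝ) ≤ (K * ℓ) * ((T : ℝ) * n) := one_le_mul_of_one_le_of_one_le hKℓ1
          (one_le_mul_of_one_le_of_one_le hT1 hn1)
      _ = _ := by ring
  have hHbound : 2 * ((7 : ℕ) + 1) * (T : ℝ) * ((D : ℝ) + 1) ^ 2 * ((i : ℝ) + 1) ≤ H := by
    have h1 : 32 * C₄ * C₆ ^ 2 ≤ K ^ 2 * ℓ := by
      have h2 : 32 * C₄ * C₆ ^ 2 ≤ K * ℓ₀ := by rwa [div_le_iff₀ hℓ₀0] at hKC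
      have h3 : K * ℓ₀ ≤ K ^ 2 * ℓ := by
        rw [sq, mul_assoc K]
        gcongr
        exact hℓℓ.trans (le_mul_of_one_le_left hℓ0.le hK1)
      exact h2.trans h3
    calc 2 * (((7 : ℕ) : ℝ) + 1) * (T : ℝ) * ((D : ℝ) + 1) ^ 2 * ((i : ℝ) + 1)
        ≤ 2 * (((7 : ℕ) : ℝ) + 1) * (T : ℝ) * (C₆ * n) ^ 2 *
          (2 * (T : ℝ) * (C₄ * ℓ)) := by gcongr
      _ = (32 * C₄ * C₆ ^ 2) * ((T : ℝ) ^ 2 * n ^ 2 * ℓ) := by push_cast; ring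
      _ ≤ (K ^ 2 * ℓ) * ((T : ℝ) ^ 2 * n ^ 2 * ℓ) := by gcongr
      _ = H := by rw [hH]; ring
  exact ⟨i, hi, hHbound, hH1⟩

/-- The chaining term is of order `t² M² ℓ n / √m` and is covered by the summand `t³ M² ℓ`; the
confidence term `v` is covered by the summand `M²`. -/
theorem deviation_le {C t a₀ M K ℓ v n m : ℝ} (hC : 1 ≤ C) (hT1 : 1 ≤ t) (hK1 : 1 ≤ K)
    (hℓ0 : 0 < ℓ) (hm0 : 0 < m) (hv0 : 0 ≤ v) :
    2 * (34 * (C * t * (a₀ * M) ^ 2) * (√((K * t * n * ℓ) ^ 2 / m) + v)) ≤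
      68 * C * a₀ ^ 2 * K * (t * (M ^ 2 + ℓ + t ^ 3 * M ^ 2 * ℓ) * (√(7 * n ^ 2 / m) + v)) := by
  set u : ℝ := √(7 * n ^ 2 / m) with hu
  have hu0 : 0 ≤ u := Real.sqrt_nonneg _
  have hHu : √((K * t * n * ℓ) ^ 2 / m) ≤ K * t * ℓ * u := by
    refine Real.sqrt_le_iff.mpr ⟨by positivity, ?_⟩
    rw [mul_pow (K * t * ℓ), hu, Real.sq_sqrt (by positivity)]
    have e : (K * t * ℓ) ^ 2 * (7 * n ^ 2 / m) =
        7 * ((K * t * n * ℓ) ^ 2 / m) := by ring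
    rw [e]
    have : 0 ≤ (K * t * n * ℓ) ^ 2 / m := by positivity
    linarith
  have ht3 : t ≤ t ^ 3 := le_self_pow₀ hT1 (by norm_num)
  have h5 : M ^ 2 * (K * t * ℓ * u) ≤ K * ((M ^ 2 + ℓ + t ^ 3 * M ^ 2 * ℓ) * u) := by
    have h6 : t * (K * M ^ 2 * ℓ * u) ≤ t ^ 3 * (K * M ^ 2 * ℓ * u) := by gcongr
    have h7 : 0 ≤ K * ((M ^ 2 + ℓ) * u) := by positivity
    linarith
  have h8 : M ^ 2 * v ≤ K * ((M ^ 2 + ℓ + t ^ 3 * M ^ 2 * ℓ) * v) := by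
    have h9 : M ^ 2 * v ≤ K * (M ^ 2 * v) := le_mul_of_one_le_left (by positivity) hK1
    have h10 : 0 ≤ K * ((ℓ + t ^ 3 * M ^ 2 * ℓ) * v) := by positivity
    linarith
  calc 2 * (34 * (C * t * (a₀ * M) ^ 2) * (√((K * t * n * ℓ) ^ 2 / m) + v)) ≤ 2 * (34 * (C * t * (a₀ * M) ^ 2) * (K * t * ℓ * u + v)) := by gcongr
    _ = 68 * C * a₀ ^ 2 * t * (M ^ 2 * (K * t * ℓ * u) + M ^ 2 * v) := by ring
    _ ≤ 68 * C * a₀ ^ 2 * t * (K * ((M ^ 2 + ℓ + t ^ 3 * M ^ 2 * ℓ) * u) +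
          K * ((M ^ 2 + ℓ + t ^ 3 * M ^ 2 * ℓ) * v)) := by gcongr
    _ = _ := by ring

/-- The excess risk is at most twice the uniform deviation of the log-likelihoods. -/
theorem klDiv_sub_klDiv_le {d k m T : ℕ} {Cq B η v : ℝ} {q₀ r : E d → ℝ}
    {σ : Fin T → ℝ} {S : Set (Fin T → E d → E d)} {φpop φemp : Fin T → E d → E d}
    (hq : IsTargetDensity k Cq q₀)
    (hmeas : ∀ φ ∈ S, Measurable (generatedDensity r σ φ))
    (hone : ∀ φ ∈ S, ∫⁻ x, ENNReal.ofReal (generatedDensity r σ φ x) = 1)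
    (hpos : ∀ φ ∈ S, ∀ x ∈ cube d, 0 < generatedDensity r σ φ x)
    (hB : ∀ φ ∈ S, ∀ x ∈ cube d, |Real.log (generatedDensity r σ φ x)| ≤ B)
    (hpop : φpop ∈ S) {x : Fin m → E d}
    (hemp : IsArgmaxUpTo η (empiricalLogLik x r σ) S φemp)
    (hdev : ∀ φ ∈ S, |empiricalLogLik x r σ φ - populationLogLik q₀ r σ φ| ≤ v) :
    klDiv (densityMeasure q₀) (densityMeasure (generatedDensity r σ φemp)) ≠ ∞ ∧
      klDiv (densityMeasure q₀) (densityMeasure (generatedDensity r σ φpop)) ≠ ∞ ∧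
      (klDiv (densityMeasure q₀) (densityMeasure (generatedDensity r σ φemp))).toReal -
        (klDiv (densityMeasure q₀) (densityMeasure (generatedDensity r σ φpop))).toReal ≤
        2 * v + η := by
  obtain ⟨h1, h2⟩ := hq.klDiv_densityMeasure (hmeas _ hemp.1) (hone _ hemp.1) (hpos _ hemp.1)
    (hB _ hemp.1)
  obtain ⟨h3, h4⟩ := hq.klDiv_densityMeasure (hmeas _ hpop) (hone _ hpop) (hpos _ hpop)
    (hB _ hpop)
  refine ⟨h1, h3, ?_⟩
  rw [h2, h4]
  have h5 := abs_le.mp (hdev _ hemp.1)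
  have h6 := abs_le.mp (hdev _ hpop)
  have h7 := hemp.2 _ hpop
  simp only [populationLogLik] at h5 h6
  linarith [h5.2, h6.1]

end DDPM

end

theorem mainTheorem4
    -- dimension, activation parameter, bounds for the reverse standard deviations,
    -- width constant and lower bound for the parameter norm
    (d : ℕ) (hd : 1 ≤ d) (α s₁ s₂ c M₀ : ℝ) (hs₁ : 0 < s₁) (hM₀ : 1 < M₀) :
    ∃ K : ℝ, 0 < K ∧
      ∀ (T n m W : ℕ) (M δ η : ℝ), 1 ≤ T → 1 ≤ n → 1 ≤ m → (W : ℝ) ≤ c * (n + 9 * d) →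
        M₀ ≤ M → 0 < δ → δ < 1 → 0 ≤ η →
      -- target density, forward and reverse variance schedules
      ∀ (k : ℕ) (C : ℝ) (q₀ : DDPM.E d → ℝ), DDPM.IsTargetDensity k C q₀ →
      ∀ β : Fin T → ℝ, (∀ t, 0 < β t ∧ β t < 1) →
      ∀ σ : Fin T → ℝ, (∀ t, s₁ ≤ σ t ∧ σ t ≤ s₂) →
      -- terminal density of the reverse chain: the forward marginal or the standard Gaussian
      ∀ r : DDPM.E d → ℝ,
        (r = DDPM.forwardMarginal q₀ β ∨ r = DDPM.gaussianDensity 0 1) →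
      -- population optimizer
      ∀ φpop : Fin T → DDPM.E d → DDPM.E d,
        DDPM.IsArgmaxUpTo η (DDPM.populationLogLik q₀ r σ)
          (DDPM.networkFamilies α d W 7 M T) φpop →
      -- an event of probability at least `1 - 2δ` for `m` i.i.d. samples from `q₀`
      ∃ G : Set (Fin m → DDPM.E d), MeasurableSet G ∧
        ENNReal.ofReal (1 - 2 * δ) ≤
          Measure.pi (fun _ : Fin m => DDPM.densityMeasure q₀) G ∧
        ∀ x ∈ G, ∀ φemp : Fin T → DDPM.E d → DDPM.E d,
          DDPM.IsArgmaxUpTo η (DDPM.empiricalLogLik x r σ)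
            (DDPM.networkFamilies α d W 7 M T) φemp →
          klDiv (DDPM.densityMeasure q₀)
              (DDPM.densityMeasure (DDPM.generatedDensity r σ φemp)) ≠ ∞ ∧
          klDiv (DDPM.densityMeasure q₀)
              (DDPM.densityMeasure (DDPM.generatedDensity r σ φpop)) ≠ ∞ ∧
          (klDiv (DDPM.densityMeasure q₀)
              (DDPM.densityMeasure (DDPM.generatedDensity r σ φemp))).toReal -
            (klDiv (DDPM.densityMeasure q₀)
              (DDPM.densityMeasure (DDPM.generatedDensity r σ φpop))).toReal ≤
            K * (T * (M ^ 2 + Real.log M + T ^ 3 * M ^ 2 * Real.log M) *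
              (Real.sqrt (7 * n ^ 2 / m) + Real.sqrt (2 * Real.log (1 / δ) / m))) + η := by
  set a₀ : ℝ := √d * max 1 |α| ^ 7 with ha₀
  set q : ℝ := 2 * √d * (4 * max 1 |α|) ^ 7 with hq
  have ha₀1 : 1 ≤ a₀ := one_le_mul_of_one_le_of_one_le
    (Real.one_le_sqrt.mpr (by exact_mod_cast hd)) (one_le_pow₀ (le_max_left _ _))
  have hq0 : 0 ≤ q := by positivity
  obtain ⟨C, hC, hbounds⟩ := DDPM.exists_logDensity_bounds d (s₂ := s₂) hs₁
    (DDPM.expMomentBound_pos d)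
  obtain ⟨K, hK1, hent⟩ := DDPM.exists_entropy_bound d c hM₀ ha₀1 hq0
  refine ⟨68 * C * a₀ ^ 2 * K, by positivity, ?_⟩
  intro T n m W M δ η hT hn hm hW hM hδ hδ1 hη k Cq q₀ hq₀ β hβ σ hσ r hr φpop hpop
  have := hq₀.isProbabilityMeasure
  have hrt : DDPM.IsTerminalDensity (DDPM.expMomentBound d) r := by
    rcases hr with rfl | rfl
    exacts [hq₀.isTerminalDensity_forwardMarginal hT hβ, DDPM.isTerminalDensity_gaussianDensity d]
  clear hr hβ
  obtain ⟨T, rfl⟩ := Nat.exists_eq_add_of_le' hT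
  have hT1 : (1 : ℝ) ≤ (T + 1 : ℕ) := by exact_mod_cast hT
  have hn1 : (1 : ℝ) ≤ n := by exact_mod_cast hn
  have hm0 : (0 : ℝ) < m := by exact_mod_cast hm
  have hM1 : 1 < M := hM₀.trans_le hM
  have hM0 : 0 < M := by linarith
  have hA : 1 ≤ a₀ * M := one_le_mul_of_one_le_of_one_le ha₀1 hM1.le
  set ℓ : ℝ := Real.log M with hℓ
  have hℓ0 : 0 < ℓ := Real.log_pos hM1
  set B : ℝ := C * (T + 1 : ℕ) * (a₀ * M) ^ 2 with hB
  have hB0 : 0 < B := by positivity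
  have hb := hbounds T r hrt σ (fun t => (hσ t).1) (fun t => (hσ t).2) (a₀ * M) hA
  have hgrow : ∀ φ ∈ DDPM.networkFamilies α d W 7 M (T + 1),
      DDPM.IsGrowthFamily (a₀ * M) φ := fun φ hφ => DDPM.isGrowthFamily_of_mem hφ
  obtain ⟨i, hi, hHbound, hH1⟩ := hent (T + 1) n W M hT hn hW hM
  rw [← hℓ] at hHbound hH1
  set H : ℝ := (K * (T + 1 : ℕ) * n * ℓ) ^ 2 with hH
  choose F hFcard hF using DDPM.exists_net_logLik (le_max_right W d) (le_max_left W d) hM0 ha₀ hq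
    hi hHbound hA hC (fun φ hφ x hx => (hb φ hφ x hx).2.2)
  obtain ⟨G, hGm, hGp, hG⟩ := DDPM.exists_uniform_deviation (DDPM.densityMeasure q₀) hm
    -- Chaining needs bounds at every point, while `log p₀` is controlled only on the cube.
    -- Truncation to the cube changes nothing almost surely.
    (fun (φ : DDPM.networkFamilies α d W 7 M (T + 1)) => (DDPM.cube d).indicator fun x =>
      Real.log (DDPM.generatedDensity r σ φ.1 x))
    (fun φ => (DDPM.measurable_generatedDensity hrt.measurable
      (hgrow _ φ.2).measurable).log.indicator DDPM.measurableSet_cube)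
    hB0
    (fun φ x => by
      by_cases hx : x ∈ DDPM.cube d
      · rw [Set.indicator_of_mem hx]; exact (hb φ.1 (hgrow _ φ.2) x hx).2.1
      · rw [Set.indicator_of_notMem hx, abs_zero]; exact hB0.le)
    hH1 F hFcard
    (fun j φ => by
      obtain ⟨ψ, hψ, h⟩ := hF j φ
      refine ⟨ψ, hψ, fun x => ?_⟩
      by_cases hx : x ∈ DDPM.cube d
      · rw [Set.indicator_of_mem hx, Set.indicator_of_mem hx]; exact h x hx
      · rw [Set.indicator_of_notMem hx, Set.indicator_of_notMem hx, sub_zero, abs_zero]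
        positivity)
    hδ hδ1
  have hcubem : MeasurableSet {x : Fin m → DDPM.E d | ∀ i, x i ∈ DDPM.cube d} := by
    have e : {x : Fin m → DDPM.E d | ∀ i, x i ∈ DDPM.cube d} =
        ⋂ i, (fun x : Fin m → DDPM.E d => x i) ⁻¹' DDPM.cube d := by ext; simp
    rw [e]
    exact MeasurableSet.iInter fun i => measurable_pi_apply i DDPM.measurableSet_cube
  have hcube : ∀ᵐ x ∂Measure.pi (fun _ : Fin m => DDPM.densityMeasure q₀),
      x ∈ {x : Fin m → DDPM.E d | ∀ i, x i ∈ DDPM.cube d} :=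
    ae_all_iff.mpr fun i => (measurePreserving_eval (fun _ : Fin m => DDPM.densityMeasure q₀)
      i).quasiMeasurePreserving.ae hq₀.ae_mem_cube
  -- On this event, of the same probability as `G`, the truncated empirical sums are the true
  -- log-likelihoods.
  refine ⟨G ∩ {x | ∀ i, x i ∈ DDPM.cube d}, hGm.inter hcubem, hGp.trans
    (measure_mono_ae (by filter_upwards [hcube] with x hx hxG using ⟨hxG, hx⟩)), ?_⟩
  rintro x ⟨hxG, hxc⟩ φemp hemp
  have hdev : ∀ φ ∈ DDPM.networkFamilies α d W 7 M (T + 1),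
      |DDPM.empiricalLogLik x r σ φ - DDPM.populationLogLik q₀ r σ φ| ≤
        34 * B * (√(H / m) + √(2 * Real.log (1 / δ) / m)) := by
    intro φ hφ
    have h1 := hG x hxG ⟨φ, hφ⟩
    have h2 : ∫ y, (DDPM.cube d).indicator (fun x => Real.log (DDPM.generatedDensity r σ φ x)) y
        ∂DDPM.densityMeasure q₀ = DDPM.populationLogLik q₀ r σ φ := by
      refine integral_congr_ae ?_
      filter_upwards [hq₀.ae_mem_cube] with y hy using Set.indicator_of_mem hy _
    have h3 : ∀ i, (DDPM.cube d).indicator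
        (fun x => Real.log (DDPM.generatedDensity r σ φ x)) (x i) =
        Real.log (DDPM.generatedDensity r σ φ (x i)) := fun i => Set.indicator_of_mem (hxc i) _
    simp only [h2, h3] at h1
    exact h1
  obtain ⟨h1, h2, h3⟩ := DDPM.klDiv_sub_klDiv_le hq₀
    (fun φ hφ => DDPM.measurable_generatedDensity hrt.measurable (hgrow φ hφ).measurable)
    (fun φ hφ => DDPM.lintegral_generatedDensity hrt (hgrow φ hφ) hs₁ fun t => (hσ t).1)
    (fun φ hφ x hx => (hb φ (hgrow φ hφ) x hx).1)
    (fun φ hφ x hx => (hb φ (hgrow φ hφ) x hx).2.1) hpop.1 hemp hdev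
  refine ⟨h1, h2, h3.trans (add_le_add_left ?_ η)⟩
  rw [hB, hH]
  exact DDPM.deviation_le hC hT1 hK1 hℓ0 hm0 (Real.sqrt_nonneg _)
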